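/- Let $d\ge 2$ and $\beta>\frac{1-d}{4}$. With $\widehat f(\xi)=\int_{\mathbb R^d}e^{-ix\cdot\xi}f(x)\,dx$, an initial datum $f$ on $\mathbb R^d$ is specified by its Fourier transform, a measurable function $\widehat f:\mathbb R^d\to\mathbb C$ (modulo null sets). Put \[ \mathcal I_\beta(f,g)=\int_{\mathbb R^{2d}}|\widehat f(y_1)|^2|\widehat g(y_2)|^2(|y_1||y_2|)^{\frac{d-1}{2}+2\beta}\Big(1-\tfrac{y_1}{|y_1|}\cdot\tfrac{y_2}{|y_2|}\Big)^{\frac{d-3}{2}+2\beta}\,dy_1dy_2\in[0,\infty], \] \[ \mathbf W(\beta,d)=2^{\frac{1-5d+4\beta}{2}}\pi^{\frac{1-5d}{2}}\frac{\Gamma(\frac{d-1}{2}+2\beta)}{\Gamma(d-1+2\beta)} . \] If $\widehat f\in L^1(\mathbb R^d)$, let $e^{itD}f(x)=(2\pi)^{-d}\int_{\mathbb R^d}e^{ix\cdot\xi+it|\xi|}\widehat f(\xi)\,d\xi$. For a function $u$ of $(t,x)\in\mathbb R\times\mathbb R^d$ let $\widetilde u$ be its space-time Fourier transform as a tempered distribution,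 normalised by $\widetilde u(\tau,\xi)=\int e^{-it\tau-ix\cdot\xi}u(t,x)\,dx\,dt$, and define $|\square|^\beta u$ by $\widetilde{|\square|^\beta u}(\tau,\xi)=|\tau^2-|\xi|^2|^\beta\,\widetilde u(\tau,\xi)$. For general $f,g$, $|\square|^\beta(e^{itD}f\,\overline{e^{itD}g})$ denotes the common limit in $L^2(\mathbb R^{d+1})$, if it exists, of $|\square|^\beta(e^{itD}f_n\,\overline{e^{itD}g_n})$ along all sequences with $\widehat f_n,\widehat g_n\in L^1$, $|\widehat f_n|\le|\widehat f|$, $|\widehat g_n|\le|\widehat g|$ and $\widehat f_n\to\widehat f$, $\widehat g_n\to\widehat g$ almost everywhere. (i) If $\mathcal I_\beta(f,g)<\infty$, then $|\square|^\beta(e^{itD}f\,\overline{e^{itD}g})$ exists in $L^2(\mathbb R^{d+1})$ and \[ \big\||\square|^\beta(e^{itD}f\,\overline{e^{itD}g})\big\|_{L^2(\mathbb R^{d+1})}^2\le \mathbf W(\beta,d)\,\mathcal I_\beta(f,g). \] (ii) If moreover $\beta>\max\{\frac{1-d}{4},\frac{2-d}{2}\}$, then $\mathbf W(\beta,d)$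 is the smallest constant for which the inequality in (i) holds for all $f,g$ with $\mathcal I_\beta(f,g)<\infty$. For $f,g$ not almost everywhere zero on the Fourier side, one has $\mathcal I_\beta(f,g)<\infty$ and equality in (i) if and only if \[ \widehat f(\xi)=\lambda\widehat g(\xi)=\frac{e^{a|\xi|+b\cdot\xi+c}}{|\xi|}\qquad\text{for almost every }\xi\in\mathbb R^d \] for some $\lambda,a,c\in\mathbb C$ and $b\in\mathbb C^d$ with $\operatorname{Re}a<0$ and $|\operatorname{Re}b|<-\operatorname{Re}a$ (here $b\cdot\xi=\sum_i b_i\xi_i$). -/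

import Mathlib

open MeasureTheory Filter Topology
open scoped SchwartzMap ENNReal

noncomputable section

namespace HalfWave

/-- The space `ℝ^d` with its Euclidean norm. -/
abbrev Space (d : ℕ) : Type := EuclideanSpace ℝ (Fin d)

/-- Space-time (and space-time frequency) `ℝ^{d+1} = ℝ × ℝ^d`, points `(t, x)` or `(τ, ξ)`,
with Lebesgue measure. -/
abbrev Spacetime (d : ℕ) : Type := ℝ × Space d

/-- The half-wave `e^{itD} f (x) = (2π)^{-d} ∫ e^{i x·ξ} e^{it|ξ|} f̂(ξ) dξ`, as a function of
`p = (t, x)`. The datum `f` is given by its Fourier transform `fHat`,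
`fHat ξ = ∫ e^{-i x·ξ} f(x) dx` when `f` is integrable. -/
def halfWave {d : ℕ} (fHat : Space d → ℂ) (p : Spacetime d) : ℂ :=
  (((2 * Real.pi) ^ d : ℝ) : ℂ)⁻¹ *
    ∫ ξ : Space d, Complex.exp (Complex.I * ((inner ℝ p.2 ξ + p.1 * ‖ξ‖ : ℝ) : ℂ)) * fHat ξ

/-- The product `e^{itD} f · conj (e^{itD} g)` of a `(+)` and a `(-)` wave. -/
def waveProduct {d : ℕ} (fHat gHat : Space d → ℂ) (p : Spacetime d) : ℂ :=
  halfWave fHat p * starRingEnd ℂ (halfWave gHat p)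

/-- The space-time Fourier transform `∫ e^{-itτ - ix·ξ} φ(t, x) dx dt` at `q = (τ, ξ)`. -/
def spacetimeFourier {d : ℕ} (φ : Spacetime d → ℂ) (q : Spacetime d) : ℂ :=
  ∫ p : Spacetime d, Complex.exp (-Complex.I * ((p.1 * q.1 + inner ℝ p.2 q.2 : ℝ) : ℂ)) * φ p

/-- The tempered distribution `u` (given by a function) has space-time Fourier transform `U`
(again given by a function): `⟨ũ, φ⟩ = ⟨u, φ̃⟩ = ∫ U φ` for all Schwartz functions `φ`. -/
def HasSpacetimeFourier {d : ℕ} (u U : Spacetime d → ℂ) : Prop :=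
  ∀ φ : 𝓢(Spacetime d, ℂ),
    Integrable (fun p => u p * spacetimeFourier φ p) ∧
    Integrable (fun q => U q * φ q) ∧
    ∫ p, u p * spacetimeFourier φ p = ∫ q, U q * φ q

/-- `V = |□|^β u`: the space-time Fourier transforms satisfy `Ṽ = |τ² - |ξ|²|^β ũ`. -/
def IsBoxPow {d : ℕ} (β : ℝ) (u V : Spacetime d → ℂ) : Prop :=
  ∃ U : Spacetime d → ℂ, HasSpacetimeFourier u U ∧
    HasSpacetimeFourier V (fun q => ((|q.1 ^ 2 - ‖q.2‖ ^ 2| ^ β : ℝ) : ℂ) * U q)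

/-- Data `fₙ` with integrable Fourier transforms (so that the integral defining `e^{itD} fₙ`
converges absolutely) which approximate `f`: `|f̂ₙ| ≤ |f̂|` and `f̂ₙ → f̂` almost everywhere. -/
structure Approximates {d : ℕ} (fHatSeq : ℕ → Space d → ℂ) (fHat : Space d → ℂ) : Prop where
  integrable : ∀ n, Integrable (fHatSeq n)
  norm_le : ∀ n, ∀ᵐ ξ, ‖fHatSeq n ξ‖ ≤ ‖fHat ξ‖
  tendsto : ∀ᵐ ξ, Tendsto (fun n => fHatSeq n ξ) atTop (𝓝 (fHat ξ))

/-- `V ∈ L²(ℝ^{d+1})` is `|□|^β (e^{itD} f · conj (e^{itD} g))`, for arbitrary measurable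
`f̂`, `ĝ`: it is the `L²` limit of `|□|^β (e^{itD} fₙ · conj (e^{itD} gₙ))` along all approximating
sequences. Such sequences exist (cut off `f̂` where `|ξ|` or `|f̂|` is large), so `V` is unique up to
null sets. If `f̂` and `ĝ` are integrable, constant sequences are allowed, so then
`V = |□|^β u` for the product `u` of the two waves itself. -/
def IsBoxPowProduct {d : ℕ} (β : ℝ) (fHat gHat : Space d → ℂ) (V : Spacetime d → ℂ) : Prop :=
  MemLp V 2 volume ∧
  ∀ fSeq gSeq : ℕ → Space d → ℂ, Approximates fSeq fHat → Approximates gSeq gHat →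
    ∃ W : ℕ → Spacetime d → ℂ,
      (∀ n, MemLp (W n) 2 volume ∧ IsBoxPow β (waveProduct (fSeq n) (gSeq n)) (W n)) ∧
      Tendsto (fun n => eLpNorm (W n - V) 2 volume) atTop (𝓝 0)

/-- The functional `I_β(f, g)`, with values in `[0, ∞]`; here `y' = y / |y|`. -/
def energy {d : ℕ} (β : ℝ) (fHat gHat : Space d → ℂ) : ℝ≥0∞ :=
  ∫⁻ y : Space d × Space d, ENNReal.ofReal
    (‖fHat y.1‖ ^ 2 * ‖gHat y.2‖ ^ 2 *
      (‖y.1‖ * ‖y.2‖) ^ (((d : ℝ) - 1) / 2 + 2 * β) *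
      (1 - inner ℝ (‖y.1‖⁻¹ • y.1) (‖y.2‖⁻¹ • y.2)) ^ (((d : ℝ) - 3) / 2 + 2 * β))

/-- The constant `W(β, d)`. -/
def sharpConst (β : ℝ) (d : ℕ) : ℝ :=
  (2 : ℝ) ^ ((1 - 5 * (d : ℝ) + 4 * β) / 2) * Real.pi ^ ((1 - 5 * (d : ℝ)) / 2) *
    (Real.Gamma (((d : ℝ) - 1) / 2 + 2 * β) / Real.Gamma ((d : ℝ) - 1 + 2 * β))

/-- The threshold `β_d = max {(1-d)/4, (2-d)/2}`. -/
def betaThreshold (d : ℕ) : ℝ := max ((1 - (d : ℝ)) / 4) ((2 - (d : ℝ)) / 2)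

/-- `f̂(ξ) = λ ĝ(ξ) = e^{a|ξ| + b·ξ + c} / |ξ|` (almost everywhere) for some `λ, a, c ∈ ℂ`, `b ∈ ℂ^d`
with `Re a < 0` and `|Re b| < -Re a`. -/
def IsExtremalPair {d : ℕ} (fHat gHat : Space d → ℂ) : Prop :=
  ∃ (l a c : ℂ) (b : Fin d → ℂ),
    a.re < 0 ∧ Real.sqrt (∑ i, (b i).re ^ 2) < -a.re ∧
    (∀ᵐ ξ : Space d, fHat ξ = l * gHat ξ) ∧
    (∀ᵐ ξ : Space d, fHat ξ =
      Complex.exp (a * (‖ξ‖ : ℂ) + ∑ i, b i * (ξ i : ℂ) + c) / (‖ξ‖ : ℂ))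

end HalfWave

end

noncomputable section

namespace HalfWave

open Set

/-! The estimate is a Cauchy–Schwarz inequality whose defect can be written down exactly. The
space-time Fourier transform of the product of the two waves, at a frequency `q`, is an integral
over all pairs of null vectors with difference `q`. Parametrise the future cone over `ℝ^{n+1}` by `u
= |y| - y₀ > 0` and `v = y'/u`; the null vector `(|y|, y)` then has light-cone coordinates `(u,
u|v|², uv)`. A pair over `q` is determined by the direction `v` of its second member (`recoil`,
`coneFst`, `coneSnd`), and `bilin` is the fibre integral of `Φ · conj Ψ`, where `Φ`, `Ψ` are the
data multiplied by `|ξ|`. The density `fibre` disintegrates the invariant measures `dξ/|ξ|` and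
`dη/|η|`.

On each fibre Lagrange's identity (`lintegral_lagrange`) writes `|∫ a conj b|²` as `∫|a|² ∫|b|²`
minus half of `∬ |a(v)b(v') - a(v')b(v)|²`. In the first term only the first vector `y` belonging to
`v` and the second vector `z` belonging to `v'` occur. Using `y`, `z` and the direction `w = v` as
variables (`lintegral_fibre_pair`), the data do not depend on `w`, and the `w`-integral is explicit:
an inversion centred at the direction of `y` turns it into `∫ (A + B|X|²)^{-n-2β} dX`, finite
exactly because `β > (1-d)/4`. The outcome is a constant times the weight of the energy
(`lintegral_exchangeWeight`). So norm plus defect equals `W(β, d)` times energy (`coneDefect_add`,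
`IsBoxPowProduct.sq_eLpNorm_add`), with no inequality used. The same bound with absolute values
inside gives majorants for the `L²` limit defining `|□|^β` on general data.

Equality means that the defect vanishes, which by the same variables says that `Φ(y)Ψ(z)` depends
only on the sum of the null vectors `y` and `z` (`ae_eq_of_coneDefect_eq_zero`). Hence `Φ` and `Ψ`
are proportional. In the coordinates `s = (√u, √u v)` a null vector is quadratic in `s`, so its sum
over a pair is invariant under rotating the pair by `π/4`. Thus `φ(s)φ(t) = φ((s+t)/√2) φ((s-t)/√2)`
almost everywhere, and nonzero measurable solutions are exponentials of quadratic forms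
(`exists_bilinear_of_ae`). Comparing symmetric pairs with opposite `v` forces the quadratic form to
be a multiple of `|v|²` in the `v` variables; the exponent is then linear in `(|ξ|, ξ)`.

Conversely exponentials have zero defect, because their quotient along a fibre depends only on `q`.
Their energy is finite when `|Re b| < -Re a` and `β > (2-d)/2`. When `|Re b| ≥ -Re a`, a rotation
and a comparison reduce to data depending on `u` alone, whose energy diverges by translation
invariance in `v`. -/

variable {n : ℕ}

/-! ### Light-cone coordinates on `ℝ^{n+1}` -/

/-- The identification of `ℝ × ℝ^n` with `ℝ^{n+1}`. -/
def join (y : ℝ × Space n) : Space (n + 1) :=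
  WithLp.toLp 2 (Fin.cons y.1 (fun i => y.2 i))

@[simp] lemma join_zero (y : ℝ × Space n) : join y 0 = y.1 := rfl

@[simp] lemma join_succ (y : ℝ × Space n) (i : Fin n) : join y i.succ = y.2 i := rfl

/-- The last `n` coordinates of a point of `ℝ^{n+1}`. -/
def tail (y : Space (n + 1)) : Space n := WithLp.toLp 2 (fun i => y i.succ)

@[simp] lemma tail_apply (y : Space (n + 1)) (i : Fin n) : tail y i = y i.succ := rfl

@[simp] lemma tail_join (y : ℝ × Space n) : tail (join y) = y.2 := by
  ext i; simp

@[simp] lemma join_tail (y : Space (n + 1)) : join (y 0, tail y) = y := by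
  ext i; refine Fin.cases ?_ (fun i => ?_) i <;> simp

lemma inner_join (y z : ℝ × Space n) :
    inner ℝ (join y) (join z) = y.1 * z.1 + inner ℝ y.2 z.2 := by
  simp [PiLp.inner_apply, Fin.sum_univ_succ, mul_comm]

lemma norm_join_sq (y : ℝ × Space n) : ‖join y‖ ^ 2 = y.1 ^ 2 + ‖y.2‖ ^ 2 := by
  rw [← real_inner_self_eq_norm_sq, inner_join, real_inner_self_eq_norm_sq]; ring

lemma measurePreserving_join : MeasurePreserving (join (n := n)) := by
  have h1 := (volume_preserving_piFinSuccAbove (fun _ : Fin (n + 1) => ℝ) 0).symm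
  have h2 : MeasurePreserving (Prod.map (id : ℝ → ℝ) (@WithLp.ofLp 2 (Fin n → ℝ))) :=
    (MeasurePreserving.id (volume : Measure ℝ)).prod (PiLp.volume_preserving_ofLp (Fin n))
  have h3 := (PiLp.volume_preserving_toLp (Fin (n + 1))).comp (h1.comp h2)
  convert h3 using 1
  funext y
  ext i
  refine Fin.cases ?_ (fun i => ?_) i <;>
    simp [MeasurableEquiv.piFinSuccAbove, Fin.insertNthEquiv]

lemma continuous_join : Continuous (join (n := n)) := by
  refine (PiLp.continuous_toLp 2 _).comp (continuous_pi fun i => ?_)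
  refine Fin.cases ?_ (fun i => ?_) i
  · simpa using continuous_fst
  · simp only [Fin.cons_succ]; fun_prop

@[fun_prop] lemma Measurable.join' {α : Type*} [MeasurableSpace α] {f : α → ℝ × Space n}
    (hf : Measurable f) : Measurable fun a => join (f a) := continuous_join.measurable.comp hf

lemma continuous_tail : Continuous (tail (n := n)) :=
  (PiLp.continuous_toLp 2 _).comp (continuous_pi fun i => by fun_prop)

@[fun_prop] lemma Measurable.tail' {α : Type*} [MeasurableSpace α] {f : α → Space (n + 1)}
    (hf : Measurable f) : Measurable fun a => tail (f a) := continuous_tail.measurable.comp hf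

/-- The light-cone parametrisation of `ℝ^{n+1}`: the point `y` with `|y| - y₀ = u` and
`y' = u v`. -/
def pt (u : ℝ) (v : Space n) : Space (n + 1) := join (u * (‖v‖ ^ 2 - 1) / 2, u • v)

lemma norm_pt {u : ℝ} (hu : 0 ≤ u) (v : Space n) : ‖pt u v‖ = u * (‖v‖ ^ 2 + 1) / 2 := by
  have h : ‖pt u v‖ ^ 2 = (u * (‖v‖ ^ 2 + 1) / 2) ^ 2 := by
    rw [pt, norm_join_sq]; simp only [norm_smul, Real.norm_eq_abs, mul_pow, sq_abs]; ring
  exact (pow_left_inj₀ (norm_nonneg _) (by positivity) two_ne_zero).1 h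

lemma inner_pt (u₁ u₂ : ℝ) (v₁ v₂ : Space n) : inner ℝ (pt u₁ v₁) (pt u₂ v₂) =
    u₁ * u₂ * ((‖v₁‖ ^ 2 - 1) * (‖v₂‖ ^ 2 - 1) / 4 + inner ℝ v₁ v₂) := by
  rw [pt, pt, inner_join]; simp only [inner_smul_left, inner_smul_right, conj_trivial]; ring

/-- The variable `v` is a stereographic coordinate of the direction, and stereographic projection
turns the angular factor of the energy into a Euclidean distance. Translations in `v` thereby become
symmetries of the weight. -/
lemma norm_mul_norm_sub_inner_pt {u₁ u₂ : ℝ} (h₁ : 0 ≤ u₁) (h₂ : 0 ≤ u₂) (v₁ v₂ : Space n) :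
    ‖pt u₁ v₁‖ * ‖pt u₂ v₂‖ - inner ℝ (pt u₁ v₁) (pt u₂ v₂) =
      u₁ * u₂ * ‖v₁ - v₂‖ ^ 2 / 2 := by
  rw [norm_pt h₁, norm_pt h₂, inner_pt, norm_sub_sq_real]; ring

@[fun_prop] lemma Measurable.pt' {α : Type*} [MeasurableSpace α] {f : α → ℝ} {g : α → Space n}
    (hf : Measurable f) (hg : Measurable g) : Measurable fun a => pt (f a) (g a) := by
  unfold pt; fun_prop

lemma lintegral_comp_smul_space {u : ℝ} (hu : 0 < u) (H : Space n → ℝ≥0∞) :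
    ∫⁻ x, H x = ∫⁻ v, ENNReal.ofReal (u ^ n) * H (u • v) := by
  have h := Measure.map_addHaar_smul (volume : Measure (Space n)) hu.ne'
  rw [finrank_euclideanSpace_fin] at h
  have e := (Homeomorph.smulOfNeZero u hu.ne' (α := Space n)).toMeasurableEquiv
  have h2 : ∫⁻ v, H (u • v) = ∫⁻ x, H x ∂(Measure.map (fun v : Space n => u • v) volume) :=
    (lintegral_map_equiv H
      (Homeomorph.smulOfNeZero u hu.ne' (α := Space n)).toMeasurableEquiv).symm
  rw [lintegral_const_mul' _ _ ENNReal.ofReal_ne_top, h2, h, lintegral_smul_measure,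
    abs_of_pos (by positivity), smul_eq_mul, ← mul_assoc, ← ENNReal.ofReal_mul (by positivity),
    mul_inv_cancel₀ (by positivity), ENNReal.ofReal_one, one_mul]

/-- The hyperbolic substitution `y = (X / u - u) / 2`, `u ∈ (0, ∞)`. -/
lemma lintegral_hyperbolic {X : ℝ} (hX : 0 < X) (g : ℝ → ℝ≥0∞) :
    ∫⁻ y, g y = ∫⁻ u in Ioi 0, ENNReal.ofReal ((X / u ^ 2 + 1) / 2) * g ((X / u - u) / 2) := by
  -- The preimage of `y` is `√(y² + X) - y`, which is `|y| - y₀` when `X = |y'|²`.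
  have himg : (fun u : ℝ => (X / u - u) / 2) '' Ioi 0 = univ := by
    refine eq_univ_of_forall fun y => ?_
    have h0 : (0 : ℝ) ≤ y ^ 2 + X := by positivity
    have hlt : |y| < √(y ^ 2 + X) := by
      rw [← Real.sqrt_sq_eq_abs]; exact Real.sqrt_lt_sqrt (sq_nonneg _) (by linarith)
    have hpos : 0 < √(y ^ 2 + X) - y := by linarith [le_abs_self y]
    refine ⟨√(y ^ 2 + X) - y, hpos, ?_⟩
    have hs := Real.sq_sqrt h0
    simp only
    field_simp
    nlinarith
  have hder : ∀ u ∈ Ioi (0 : ℝ), HasDerivWithinAt (fun u : ℝ => (X / u - u) / 2)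
      (-((X / u ^ 2 + 1) / 2)) (Ioi 0) u := by
    intro u hu
    have hu' : u ≠ 0 := (mem_Ioi.1 hu).ne'
    have h := ((((hasDerivAt_inv hu').const_mul X).sub (hasDerivAt_id u)).div_const 2)
    refine (h.congr_deriv ?_).hasDerivWithinAt.congr_of_mem (fun y _ => ?_) hu
    · field_simp; ring
    · simp [div_eq_mul_inv]
  have hinj : InjOn (fun u : ℝ => (X / u - u) / 2) (Ioi 0) := by
    intro a ha b hb hab
    simp only [mem_Ioi] at ha hb hab
    have : (b - a) * (X + a * b) = 0 := by field_simp at hab; linarith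
    rcases mul_eq_zero.1 this with h | h
    · linarith
    · nlinarith [mul_pos ha hb]
  have := lintegral_image_eq_lintegral_abs_deriv_mul measurableSet_Ioi hder hinj g
  rw [himg, setLIntegral_univ] at this
  rw [this]
  refine setLIntegral_congr_fun measurableSet_Ioi fun u hu => ?_
  have : 0 < u := hu
  simp only [abs_neg]
  rw [abs_of_pos (by positivity)]

lemma ae_ne (hn : 1 ≤ n) (v₀ : Space n) : ∀ᵐ v : Space n, v ≠ v₀ := by
  have : Nonempty (Fin n) := ⟨⟨0, hn⟩⟩
  have : Nontrivial (Space n) := inferInstance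
  exact Measure.ae_ne volume v₀

/-- Integration over `ℝ^{n+1}` in light-cone coordinates. -/
lemma lintegral_pt (hn : 1 ≤ n) {H : Space (n + 1) → ℝ≥0∞} (hH : Measurable H) :
    ∫⁻ y, H y = ∫⁻ v : Space n, ∫⁻ u in Ioi (0 : ℝ),
      ENNReal.ofReal (u ^ n * ((‖v‖ ^ 2 + 1) / 2)) * H (pt u v) := by
  have hm : Measurable fun y : ℝ × Space n => H (join y) := by fun_prop
  rw [← measurePreserving_join.lintegral_comp hH, Measure.volume_eq_prod,
    lintegral_prod_symm' _ hm]
  -- For fixed `y' = x` the first coordinate is traded for `u`; then `x = u v` contributes the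
  -- factor `u ^ n`. The point `x = 0`, where the substitution degenerates, is discarded.
  have h1 : ∀ᵐ x : Space n, ∫⁻ y : ℝ, H (join (y, x)) = ∫⁻ u in Ioi (0 : ℝ),
      ENNReal.ofReal ((‖x‖ ^ 2 / u ^ 2 + 1) / 2) * H (join ((‖x‖ ^ 2 / u - u) / 2, x)) := by
    filter_upwards [ae_ne hn 0] with x hx
    exact lintegral_hyperbolic (by positivity) fun y => H (join (y, x))
  rw [lintegral_congr_ae h1, lintegral_lintegral_swap]
  swap
  · exact Measurable.aemeasurable (by fun_prop)
  conv_rhs => rw [lintegral_lintegral_swap (Measurable.aemeasurable (by fun_prop))]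
  refine setLIntegral_congr_fun measurableSet_Ioi fun u hu => ?_
  have hu : 0 < u := hu
  rw [lintegral_comp_smul_space hu]
  refine lintegral_congr fun v => ?_
  rw [← mul_assoc, ← ENNReal.ofReal_mul (by positivity), norm_smul, Real.norm_of_nonneg hu.le, pt]
  congr 3
  · field_simp
  · congr 1
    field_simp

/-! ### One-dimensional Möbius substitutions -/

/-- A Möbius substitution on the half-line. -/
lemma lintegral_mobius {X m c : ℝ} (hW : 0 < X - m * c) (g : ℝ → ℝ≥0∞) :
    ∫⁻ e in {e | 0 < X - m * e ∧ 0 < e - c}, g e = ∫⁻ u in {u | 0 < u ∧ 0 < m + u},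
      ENNReal.ofReal ((X - m * c) / (m + u) ^ 2) * g ((X + u * c) / (m + u)) := by
  set s : Set ℝ := {u | 0 < u ∧ 0 < m + u}
  have hs : MeasurableSet s :=
    (measurableSet_lt measurable_const measurable_id).inter
      (measurableSet_lt measurable_const (measurable_const.add measurable_id))
  have himg : (fun u : ℝ => (X + u * c) / (m + u)) '' s = {e | 0 < X - m * e ∧ 0 < e - c} := by
    ext e
    constructor
    · rintro ⟨u, ⟨hu, hmu⟩, rfl⟩
      -- In the application to the cone, `X - m * e` and `e - c` are `boxQ` and `linL`; their
      -- quotient gives back `u`.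
      have h1 : X - m * ((X + u * c) / (m + u)) = u * (X - m * c) / (m + u) := by
        field_simp; ring
      have h2 : (X + u * c) / (m + u) - c = (X - m * c) / (m + u) := by field_simp; ring
      simp only [mem_ofPred_eq, h1, h2]
      constructor <;> positivity
    · rintro ⟨h1, h2⟩
      have hmu : m + (X - m * e) / (e - c) = (X - m * c) / (e - c) := by field_simp; ring
      refine ⟨(X - m * e) / (e - c), ⟨by positivity, by rw [hmu]; positivity⟩, ?_⟩
      simp only [hmu]
      rw [div_eq_iff (by positivity)]
      field_simp
      ring
  have hder : ∀ u ∈ s, HasDerivWithinAt (fun u : ℝ => (X + u * c) / (m + u))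
      (-((X - m * c) / (m + u) ^ 2)) s u := by
    intro u hu
    have h1 : HasDerivAt (fun u : ℝ => X + u * c) c u := by
      simpa using ((hasDerivAt_id u).mul_const c).const_add X
    have h2 : HasDerivAt (fun u : ℝ => m + u) 1 u := by
      simpa using (hasDerivAt_id u).const_add m
    refine ((h1.div h2 hu.2.ne').congr_deriv ?_).hasDerivWithinAt
    have := hu.2.ne'
    field_simp
    ring
  have hinj : InjOn (fun u : ℝ => (X + u * c) / (m + u)) s := by
    intro a ha b hb hab
    have ha' := ha.2; have hb' := hb.2
    simp only at hab
    rw [div_eq_div_iff ha'.ne' hb'.ne'] at hab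
    have : (b - a) * (X - m * c) = 0 := by linarith
    rcases mul_eq_zero.1 this with h | h <;> linarith
  have := lintegral_image_eq_lintegral_abs_deriv_mul hs hder hinj g
  rw [himg] at this
  rw [this]
  refine setLIntegral_congr_fun hs fun u hu => ?_
  have := hu.2
  simp only [abs_neg]
  rw [abs_of_pos (by positivity)]

/-- A Möbius substitution between a bounded interval and the half-line. -/
lemma lintegral_mobius_bounded {A B c : ℝ} (hA : 0 < A) (hB : 0 < B) (hc : 0 < c)
    (g : ℝ → ℝ≥0∞) :
    ∫⁻ u in {u | 0 < u ∧ 0 < A - u * c}, g u = ∫⁻ t in Ioi 0,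
      ENNReal.ofReal (A * B / (B + t * c) ^ 2) * g (A * t / (B + t * c)) := by
  have hpos : ∀ t ∈ Ioi (0 : ℝ), 0 < B + t * c := fun t ht => by
    have : 0 < t := ht
    positivity
  have himg : (fun t : ℝ => A * t / (B + t * c)) '' Ioi 0 = {u | 0 < u ∧ 0 < A - u * c} := by
    ext u
    constructor
    · rintro ⟨t, ht, rfl⟩
      have h0 : 0 < t := ht
      have h1 := hpos t ht
      have h2 : A - A * t / (B + t * c) * c = A * B / (B + t * c) := by field_simp; ring
      simp only [mem_ofPred_eq, h2]
      constructor <;> positivity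
    · rintro ⟨h1, h2⟩
      have h3 : B + B * u / (A - u * c) * c = A * B / (A - u * c) := by field_simp; ring
      refine ⟨B * u / (A - u * c), mem_Ioi.2 (by positivity), ?_⟩
      simp only [h3]
      field_simp
  have hder : ∀ t ∈ Ioi (0 : ℝ), HasDerivWithinAt (fun t : ℝ => A * t / (B + t * c))
      (A * B / (B + t * c) ^ 2) (Ioi 0) t := by
    intro t ht
    have h1 : HasDerivAt (fun t : ℝ => A * t) A t := by
      simpa using (hasDerivAt_id t).const_mul A
    have h2 : HasDerivAt (fun t : ℝ => B + t * c) c t := by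
      simpa using ((hasDerivAt_id t).mul_const c).const_add B
    refine ((h1.div h2 (hpos t ht).ne').congr_deriv ?_).hasDerivWithinAt
    congr 1
    ring
  have hinj : InjOn (fun t : ℝ => A * t / (B + t * c)) (Ioi 0) := by
    intro a ha b hb hab
    simp only at hab
    rw [div_eq_div_iff (hpos a ha).ne' (hpos b hb).ne'] at hab
    have : (a - b) * (A * B) = 0 := by linarith
    rcases mul_eq_zero.1 this with h | h
    · linarith
    · exact absurd h (by positivity)
  have := lintegral_image_eq_lintegral_abs_deriv_mul measurableSet_Ioi hder hinj g
  rw [himg] at this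
  rw [this]
  refine setLIntegral_congr_fun measurableSet_Ioi fun t ht => ?_
  have := hpos t ht
  rw [abs_of_pos (by positivity)]

/-! ### Changes of variables for differences of null vectors -/

/-- Space-time frequencies `(τ, ζ)` in light-cone coordinates `(τ - ζ₀, τ + ζ₀, ζ')`. -/
abbrev LightCone (n : ℕ) : Type := ℝ × ℝ × Space n

/-- Light-cone coordinates `(u, v)` of a point of `ℝ^{n+1}`. -/
abbrev Cone (n : ℕ) : Type := ℝ × Space n

/-- The measure `du dv` on the half-space `u > 0`. -/
def coneMeasure (n : ℕ) : Measure (Cone n) :=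
  ((volume : Measure ℝ).restrict (Ioi 0)).prod volume

instance : SFinite (coneMeasure n) := by unfold coneMeasure; infer_instance

lemma ae_coneMeasure_pos : ∀ᵐ y ∂coneMeasure n, 0 < y.1 := by
  have : coneMeasure n = volume.restrict (Ioi 0 ×ˢ univ) := by
    rw [coneMeasure, Measure.volume_eq_prod, ← Measure.prod_restrict, Measure.restrict_univ]
  rw [this]
  filter_upwards [ae_restrict_mem (measurableSet_Ioi.prod .univ)] with y hy
  exact hy.1

lemma lintegral_coneMeasure {F : Cone n → ℝ≥0∞} (hF : Measurable F) :
    ∫⁻ y, F y ∂coneMeasure n = ∫⁻ u in Ioi (0 : ℝ), ∫⁻ v, F (u, v) :=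
  lintegral_prod _ hF.aemeasurable

lemma lintegral_coneMeasure_symm {F : Cone n → ℝ≥0∞} (hF : Measurable F) :
    ∫⁻ y, F y ∂coneMeasure n = ∫⁻ v, ∫⁻ u in Ioi (0 : ℝ), F (u, v) :=
  lintegral_prod_symm _ hF.aemeasurable

lemma lintegral_pt_cone (hn : 1 ≤ n) {H : Space (n + 1) → ℝ≥0∞} (hH : Measurable H) :
    ∫⁻ y, H y = ∫⁻ y : Cone n, ENNReal.ofReal (y.1 ^ n * ((‖y.2‖ ^ 2 + 1) / 2)) * H (pt y.1 y.2)
      ∂coneMeasure n := by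
  rw [lintegral_pt hn hH, lintegral_coneMeasure_symm (by fun_prop)]

/-- `|ζ|² - τ²` in light-cone coordinates. -/
def boxQ (q : LightCone n) : ℝ := ‖q.2.2‖ ^ 2 - q.1 * q.2.1

/-- The linear form in the null direction determined by `v`. -/
def linL (q : LightCone n) (v : Space n) : ℝ := q.2.1 - 2 * inner ℝ q.2.2 v + q.1 * ‖v‖ ^ 2

@[fun_prop] lemma measurable_boxQ : Measurable (boxQ (n := n)) := by unfold boxQ; fun_prop

@[fun_prop] lemma Measurable.linL {α : Type*} [MeasurableSpace α] {f : α → LightCone n}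
    {g : α → Space n} (hf : Measurable f) (hg : Measurable g) :
    Measurable fun a => linL (f a) (g a) := by unfold HalfWave.linL; fun_prop

/-- The pairs `(q, v)` such that `q` is the difference of two null vectors, the second one in the
direction determined by `v`. -/
def coneDom (n : ℕ) : Set (LightCone n × Space n) := {p | 0 < boxQ p.1 ∧ 0 < linL p.1 p.2}

lemma measurableSet_coneDom : MeasurableSet (coneDom n) :=
  (measurableSet_lt measurable_const (measurable_boxQ.comp measurable_fst)).inter
    (measurableSet_lt measurable_const (Measurable.linL measurable_fst measurable_snd))

/-- The difference of two null vectors. -/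
def coneDiff (y z : Cone n) : LightCone n :=
  (y.1 - z.1, y.1 * ‖y.2‖ ^ 2 - z.1 * ‖z.2‖ ^ 2, y.1 • y.2 - z.1 • z.2)

@[fun_prop] lemma Measurable.coneDiff {α : Type*} [MeasurableSpace α] {f g : α → Cone n}
    (hf : Measurable f) (hg : Measurable g) : Measurable fun a => coneDiff (f a) (g a) := by
  unfold HalfWave.coneDiff; fun_prop

/-- Null vectors have vanishing Minkowski square, so only the cross term survives. The difference is
therefore never time-like, and the quantity to which `|□|` corresponds is the very factor in the
energy weight. -/
lemma boxQ_coneDiff (y z : Cone n) : boxQ (coneDiff y z) = y.1 * z.1 * ‖y.2 - z.2‖ ^ 2 := by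
  simp only [boxQ, coneDiff, norm_sub_sq_real, norm_smul, Real.norm_eq_abs, mul_pow, sq_abs,
    inner_smul_left, inner_smul_right, conj_trivial]
  ring

/-- The form is linear in `q`, and on a null vector it is the component times the squared distance
of the directions; in particular it vanishes on null vectors of its own direction. -/
lemma linL_coneDiff (y z : Cone n) (v : Space n) :
    linL (coneDiff y z) v = y.1 * ‖y.2 - v‖ ^ 2 - z.1 * ‖z.2 - v‖ ^ 2 := by
  simp only [linL, coneDiff, norm_sub_sq_real, inner_sub_left, inner_smul_left, conj_trivial]
  ring

/-- With `z` fixed, `y` is replaced by two of the three components of the difference, `m` and `x`;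
the third is a function of these and `z`. The factor `y.1 ^ n` is the Jacobian of passing from the
direction of `y` to `x`. -/
lemma lintegral_coneDiff_inner (z : Cone n)
    {G : LightCone n → ℝ≥0∞} (hG : Measurable G) :
    ∫⁻ y, ENNReal.ofReal (y.1 ^ n * ‖y.2 - z.2‖ ^ 2) * G (coneDiff y z) ∂coneMeasure n =
    ∫⁻ m : ℝ, ∫⁻ x : Space n, if 0 < m + z.1 then
      ENNReal.ofReal (‖x - m • z.2‖ ^ 2 / (m + z.1) ^ 2) *
        G (m, (‖x‖ ^ 2 + z.1 * (2 * inner ℝ x z.2 - m * ‖z.2‖ ^ 2)) / (m + z.1), x) else 0 := by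
  rw [lintegral_coneMeasure (by fun_prop), ← lintegral_indicator measurableSet_Ioi,
    ← lintegral_add_right_eq_self _ z.1]
  refine lintegral_congr fun m => ?_
  by_cases h : 0 < m + z.1
  · rw [indicator_of_mem (mem_Ioi.2 h)]
    simp only [h, if_true]
    symm
    rw [← lintegral_sub_right_eq_self _ (z.1 • z.2), lintegral_comp_smul_space h]
    refine lintegral_congr fun v => ?_
    rw [← mul_assoc, ← ENNReal.ofReal_mul (by positivity)]
    have h1 : (m + z.1) • v - z.1 • z.2 - m • z.2 = (m + z.1) • (v - z.2) := by
      module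
    rw [h1, norm_smul, mul_pow, Real.norm_eq_abs, sq_abs, coneDiff]
    congr 3
    · field_simp
    · simp
    · congr 1
      rw [div_eq_iff h.ne']
      simp only [norm_sub_sq_real, norm_smul, Real.norm_eq_abs, mul_pow, sq_abs,
        inner_smul_left, inner_smul_right, conj_trivial, inner_sub_left,
        real_inner_self_eq_norm_sq]
      ring
  · rw [indicator_of_notMem (by simpa using h)]
    simp [h]

/-- Change of variables from `(q, v)` to the pair of null vectors with difference `q`. -/
theorem lintegral_coneDom (hn : 1 ≤ n) {G : LightCone n × Space n → ℝ≥0∞} (hG : Measurable G) :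
    ∫⁻ q : LightCone n, ∫⁻ v, (coneDom n).indicator G (q, v) =
    ∫⁻ y, ∫⁻ z, ENNReal.ofReal (y.1 ^ n * ‖y.2 - z.2‖ ^ 2) * G (coneDiff y z, z.2)
      ∂coneMeasure n ∂coneMeasure n := by
  have hGi : Measurable ((coneDom n).indicator G) := hG.indicator measurableSet_coneDom
  -- the left side, with the integral in `τ + ζ₀` innermost
  have hL : ∫⁻ q : LightCone n, ∫⁻ v, (coneDom n).indicator G (q, v) =
      ∫⁻ v, ∫⁻ m, ∫⁻ x, ∫⁻ e, (coneDom n).indicator G ((m, e, x), v) := by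
    rw [lintegral_lintegral_swap (f := fun q v => (coneDom n).indicator G (q, v))
      hGi.aemeasurable]
    refine lintegral_congr fun v => ?_
    rw [Measure.volume_eq_prod, lintegral_prod _ (Measurable.aemeasurable (by fun_prop))]
    refine lintegral_congr fun m => ?_
    rw [Measure.volume_eq_prod, lintegral_prod_symm _ (Measurable.aemeasurable (by fun_prop))]
  set I : ℝ → Space n → Cone n → ℝ≥0∞ := fun m x z => if 0 < m + z.1 then
      ENNReal.ofReal (‖x - m • z.2‖ ^ 2 / (m + z.1) ^ 2) *
        G ((m, (‖x‖ ^ 2 + z.1 * (2 * inner ℝ x z.2 - m * ‖z.2‖ ^ 2)) / (m + z.1), x), z.2)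
        else 0 with hI
  have hIm : Measurable fun p : ℝ × Space n × Cone n => I p.1 p.2.1 p.2.2 := by
    refine Measurable.ite (measurableSet_lt measurable_const (by fun_prop)) ?_ measurable_const
    fun_prop
  have hIm' : ∀ {α : Type} [MeasurableSpace α] {f : α → ℝ} {g : α → Space n} {h : α → Cone n},
      Measurable f → Measurable g → Measurable h → Measurable fun a => I (f a) (g a) (h a) :=
    fun hf hg hh => hIm.comp (hf.prodMk (hg.prodMk hh))
  have hR : ∫⁻ y, ∫⁻ z, ENNReal.ofReal (y.1 ^ n * ‖y.2 - z.2‖ ^ 2) * G (coneDiff y z, z.2)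
      ∂coneMeasure n ∂coneMeasure n =
      ∫⁻ z, (∫⁻ m : ℝ, ∫⁻ x : Space n, I m x z) ∂coneMeasure n := by
    rw [lintegral_lintegral_swap (Measurable.aemeasurable (by fun_prop))]
    exact lintegral_congr fun z =>
      lintegral_coneDiff_inner z (G := fun q => G (q, z.2)) (by fun_prop)
  have hms : ∀ m c X : ℝ, MeasurableSet {e : ℝ | 0 < X - m * e ∧ 0 < e - c} := fun m c X =>
    (measurableSet_lt measurable_const
      (measurable_const.sub (measurable_const.mul measurable_id))).inter
      (measurableSet_lt measurable_const (measurable_id.sub_const c))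
  have hms' : ∀ m : ℝ, MeasurableSet {u : ℝ | 0 < m + u} := fun m =>
    measurableSet_lt measurable_const (by fun_prop)
  rw [hL, hR, lintegral_coneMeasure_symm]
  swap
  · exact Measurable.lintegral_prod_right' (f := fun p : Cone n × ℝ => ∫⁻ x, I p.2 x p.1)
      (Measurable.lintegral_prod_right' (f := fun p : (Cone n × ℝ) × Space n =>
        I p.1.2 p.2 p.1.1) (hIm' (by fun_prop) (by fun_prop) (by fun_prop)))
  refine lintegral_congr fun v => Eq.symm ?_
  rw [lintegral_lintegral_swap]
  swap
  · exact (Measurable.lintegral_prod_right' (f := fun p : (ℝ × ℝ) × Space n =>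
        I p.1.2 p.2 (p.1.1, v)) (hIm' (by fun_prop) (by fun_prop) (by fun_prop))).aemeasurable
  refine lintegral_congr fun m => ?_
  rw [lintegral_lintegral_swap (hIm' (by fun_prop) (by fun_prop) (by fun_prop)).aemeasurable]
  refine lintegral_congr_ae ?_
  filter_upwards [ae_ne hn (m • v)] with x hx
  have hW : ‖x - m • v‖ ^ 2 = ‖x‖ ^ 2 - m * (2 * inner ℝ x v - m * ‖v‖ ^ 2) := by
    simp only [norm_sub_sq_real, norm_smul, Real.norm_eq_abs, mul_pow, sq_abs, inner_smul_right]
    ring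
  have hWpos : 0 < ‖x - m • v‖ ^ 2 := by have := norm_pos_iff.2 (sub_ne_zero.2 hx); positivity
  -- With `m`, `x` and the direction fixed, the remaining map from `z.1` to `τ + ζ₀` is Möbius. Its
  -- Jacobian is the factor left over in `lintegral_coneDiff_inner`, and its range is the slice of
  -- `coneDom`.
  have key := lintegral_mobius (hW ▸ hWpos) fun e => G ((m, e, x), v)
  rw [← lintegral_indicator (hms _ _ _)] at key
  have e1 : {u : ℝ | 0 < u ∧ 0 < m + u} = {u | 0 < m + u} ∩ Ioi 0 := by
    ext u; simp [and_comm]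
  rw [e1, ← Measure.restrict_restrict (hms' m), ← lintegral_indicator (hms' m)] at key
  convert key.symm using 1
  rotate_left
  · refine lintegral_congr fun e => ?_
    simp only [indicator_apply, coneDom, boxQ, linL, mem_ofPred_eq]
    congr 3
    ring
  · refine lintegral_congr fun u => ?_
    simp only [hI, indicator_apply, mem_ofPred_eq, hW]

/-- The component `z.1` of the null vector in the direction `w` that occurs when the sum of the null
vectors `y` and `z` is written as a sum of two other null vectors. -/
def exchange (y z : Cone n) (w : Space n) : ℝ :=
  y.1 * ‖y.2 - z.2‖ ^ 2 * z.1 / (y.1 * ‖y.2 - w‖ ^ 2 + z.1 * ‖w - z.2‖ ^ 2)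

@[fun_prop] lemma Measurable.exchange {α : Type*} [MeasurableSpace α] {f g : α → Cone n}
    {h : α → Space n} (hf : Measurable f) (hg : Measurable g) (hh : Measurable h) :
    Measurable fun a => exchange (f a) (g a) (h a) := by
  unfold HalfWave.exchange; fun_prop

/-- The Jacobian of the change of variables `lintegral_coneDom_pair`. -/
def exchangeJac (y z : Cone n) (w : Space n) : ℝ :=
  y.1 ^ n * ‖y.2 - w‖ ^ 2 * (y.1 * ‖y.2 - z.2‖ ^ 2 * (y.1 * ‖y.2 - w‖ ^ 2) /
    (y.1 * ‖y.2 - w‖ ^ 2 + z.1 * ‖w - z.2‖ ^ 2) ^ 2)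

@[fun_prop] lemma Measurable.exchangeJac {α : Type*} [MeasurableSpace α] {f g : α → Cone n}
    {h : α → Space n} (hf : Measurable f) (hg : Measurable g) (hh : Measurable h) :
    Measurable fun a => exchangeJac (f a) (g a) (h a) := by
  unfold HalfWave.exchangeJac; fun_prop

/-- Change of variables from `(q, v, v')` to null vectors `y`, `z` and the direction `w = v`: here
`q` is the difference of `y` and a null vector in the direction `v`, and also of a null vector and
`z`, where `z` has the direction `v'`. -/
theorem lintegral_coneDom_pair (hn : 1 ≤ n) {G : LightCone n × Space n × Space n → ℝ≥0∞}
    (hG : Measurable G) :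
    ∫⁻ q : LightCone n, ∫⁻ v, (coneDom n).indicator (fun p => ∫⁻ v',
      (coneDom n).indicator (fun r => G (p.1, p.2, r.2)) (p.1, v')) (q, v) =
    ∫⁻ y, ∫⁻ z, (∫⁻ w, ENNReal.ofReal (exchangeJac y z w) *
      G (coneDiff y (exchange y z w, w), w, z.2)) ∂coneMeasure n ∂coneMeasure n := by
  obtain ⟨J, hJ⟩ : ∃ J : LightCone n → Space n → Space n → ℝ≥0∞, J = fun q v v' =>
    (coneDom n).indicator (fun r => G (q, v, r.2)) (q, v') := ⟨_, rfl⟩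
  have hJm : Measurable fun p : LightCone n × Space n × Space n => J p.1 p.2.1 p.2.2 := by
    have : MeasurableSet ((fun p : LightCone n × Space n × Space n => (p.1, p.2.2)) ⁻¹' coneDom n) :=
      measurableSet_coneDom.preimage (by fun_prop)
    rw [hJ]
    exact hG.indicator this
  have hJm' : ∀ {α : Type} [MeasurableSpace α] {f : α → LightCone n} {g h : α → Space n},
      Measurable f → Measurable g → Measurable h → Measurable fun a => J (f a) (g a) (h a) :=
    fun hf hg hh => hJm.comp (hf.prodMk (hg.prodMk hh))
  have hJi : Measurable fun p : LightCone n × Space n => ∫⁻ v', J p.1 p.2 v' :=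
    Measurable.lintegral_prod_right' (f := fun p : (LightCone n × Space n) × Space n =>
      J p.1.1 p.1.2 p.2) (hJm' (by fun_prop) (by fun_prop) (by fun_prop))
  have hstart := lintegral_coneDom hn hJi
  simp only [hJ] at hstart
  rw [hstart]
  simp only [← congrFun (congrFun (congrFun hJ _) _) _]
  refine lintegral_congr_ae ?_
  filter_upwards [ae_coneMeasure_pos] with y hy
  have hm1 : Measurable fun p : Cone n × Space n =>
      ENNReal.ofReal (y.1 ^ n * ‖y.2 - p.1.2‖ ^ 2) * J (coneDiff y p.1) p.1.2 p.2 :=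
    Measurable.mul (by fun_prop) (hJm' (by fun_prop) (by fun_prop) (by fun_prop))
  have hm2 : Measurable fun p : Cone n × Space n => ENNReal.ofReal (exchangeJac y p.1 p.2) *
      G (coneDiff y (exchange y p.1 p.2, p.2), p.2, p.1.2) := by fun_prop
  calc _ = ∫⁻ z, (∫⁻ v', ENNReal.ofReal (y.1 ^ n * ‖y.2 - z.2‖ ^ 2) * J (coneDiff y z) z.2 v')
        ∂coneMeasure n :=
        lintegral_congr fun z => (lintegral_const_mul _
          (hJm' (by fun_prop) (by fun_prop) (by fun_prop))).symm
    _ = ∫⁻ v', ∫⁻ w, ∫⁻ u in Ioi 0, ENNReal.ofReal (y.1 ^ n * ‖y.2 - w‖ ^ 2) *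
          J (coneDiff y (u, w)) w v' := by
        rw [lintegral_lintegral_swap hm1.aemeasurable]
        exact lintegral_congr fun v' => lintegral_coneMeasure_symm
          (hm1.comp (f := fun z : Cone n => (z, v')) (by fun_prop))
    _ = ∫⁻ v', ∫⁻ w, ∫⁻ u in Ioi 0, ENNReal.ofReal (exchangeJac y (u, v') w) *
          G (coneDiff y (exchange y (u, v') w, w), w, v') := by
        refine lintegral_congr_ae ?_
        filter_upwards [ae_ne hn y.2] with v' hv'
        refine lintegral_congr_ae ?_
        filter_upwards [ae_ne hn y.2, ae_ne hn v'] with w hw hw'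
        have ha : 0 < ‖y.2 - v'‖ := norm_pos_iff.2 (sub_ne_zero.2 hv'.symm)
        have hb : 0 < ‖y.2 - w‖ := norm_pos_iff.2 (sub_ne_zero.2 hw.symm)
        have hc : 0 < ‖w - v'‖ := norm_pos_iff.2 (sub_ne_zero.2 hw')
        -- Membership of `(q, v')` in `coneDom` bounds the component `u` of the vector in direction
        -- `w`. The new parameter of the substitution is `boxQ / linL` in the direction `v'`, so it
        -- is the component of the second null vector `z`.
        have key := lintegral_mobius_bounded (A := y.1 * ‖y.2 - v'‖ ^ 2)
          (B := y.1 * ‖y.2 - w‖ ^ 2) (c := ‖w - v'‖ ^ 2) (by positivity) (by positivity)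
          (by positivity)
          (fun u => ENNReal.ofReal (y.1 ^ n * ‖y.2 - w‖ ^ 2) * G (coneDiff y (u, w), w, v'))
        have hms : MeasurableSet {u : ℝ | 0 < y.1 * ‖y.2 - v'‖ ^ 2 - u * ‖w - v'‖ ^ 2} :=
          measurableSet_lt measurable_const (by fun_prop)
        have e1 : {u : ℝ | 0 < u ∧ 0 < y.1 * ‖y.2 - v'‖ ^ 2 - u * ‖w - v'‖ ^ 2} =
            {u | 0 < y.1 * ‖y.2 - v'‖ ^ 2 - u * ‖w - v'‖ ^ 2} ∩ Ioi 0 := by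
          ext u; simp [and_comm]
        rw [e1, ← Measure.restrict_restrict hms, ← lintegral_indicator hms] at key
        convert key using 1
        · refine setLIntegral_congr_fun measurableSet_Ioi fun u hu => ?_
          have hu : 0 < u := hu
          have hq : 0 < y.1 * u * ‖y.2 - w‖ ^ 2 := by positivity
          simp only [hJ, indicator_apply, coneDom, mem_ofPred_eq, boxQ_coneDiff, linL_coneDiff, hq,
            true_and]
          split_ifs <;> simp
        · refine lintegral_congr fun u => ?_
          rw [← mul_assoc, ← ENNReal.ofReal_mul (by positivity)]
          simp only [exchangeJac, exchange]
          congr 2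
          ring
    _ = _ := by
        rw [lintegral_coneMeasure_symm (Measurable.lintegral_prod_right' hm2)]
        refine lintegral_congr fun v' => ?_
        rw [lintegral_lintegral_swap]
        exact (hm2.comp (f := fun p : Space n × ℝ => ((p.2, v'), p.1)) (by fun_prop)).aemeasurable

/-! ### Explicit integrals: Gamma, Gauss and inversion -/

/-- A nonzero Bochner integral certifies integrability, so known integral values transfer to lower
integrals without a separate proof of convergence. -/
lemma lintegral_ofReal_of_integral_pos {α : Type*} [MeasurableSpace α] {μ : Measure α} {f : α → ℝ}
    {c : ℝ} (h0 : 0 ≤ᵐ[μ] f) (h : ∫ x, f x ∂μ = c) (hc : 0 < c) :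
    ∫⁻ x, ENNReal.ofReal (f x) ∂μ = ENNReal.ofReal c := by
  have hi : Integrable f μ := by
    by_contra hn
    rw [integral_undef hn] at h
    exact hc.ne h
  rw [← h, ofReal_integral_eq_lintegral_ofReal hi h0]

lemma lintegral_gamma {a r : ℝ} (ha : 0 < a) (hr : 0 < r) :
    ∫⁻ t in Ioi (0 : ℝ), ENNReal.ofReal (t ^ (a - 1) * Real.exp (-(r * t))) =
      ENNReal.ofReal (r ^ (-a) * Real.Gamma a) := by
  refine lintegral_ofReal_of_integral_pos ?_ ?_
    (mul_pos (Real.rpow_pos_of_pos hr _) (Real.Gamma_pos_of_pos ha))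
  · filter_upwards [ae_restrict_mem measurableSet_Ioi] with t ht
    have : (0 : ℝ) < t := ht
    simp only [Pi.zero_apply]
    positivity
  · rw [Real.integral_rpow_mul_exp_neg_mul_Ioi ha hr, one_div, Real.inv_rpow hr.le,
      Real.rpow_neg hr.le]

lemma lintegral_gaussian {b : ℝ} (hb : 0 < b) :
    ∫⁻ x : Space n, ENNReal.ofReal (Real.exp (-b * ‖x‖ ^ 2)) =
      ENNReal.ofReal ((Real.pi / b) ^ ((n : ℝ) / 2)) := by
  refine lintegral_ofReal_of_integral_pos (ae_of_all _ fun x => (Real.exp_pos _).le) ?_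
    (Real.rpow_pos_of_pos (div_pos Real.pi_pos hb) _)
  rw [GaussianFourier.integral_rexp_neg_mul_sq_norm hb, finrank_euclideanSpace_fin]

/-- The integral of `(A + B |x|²)^{-s}` over `ℝ^n`. -/
lemma lintegral_rpow_quadratic {A B s : ℝ} (hA : 0 < A) (hB : 0 < B) (hs : (n : ℝ) / 2 < s) :
    ∫⁻ x : Space n, ENNReal.ofReal ((A + B * ‖x‖ ^ 2) ^ (-s)) =
      ENNReal.ofReal (Real.pi ^ ((n : ℝ) / 2) * Real.Gamma (s - n / 2) / Real.Gamma s *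
        (A ^ ((n : ℝ) / 2 - s) * B ^ (-((n : ℝ) / 2)))) := by
  have hs0 : 0 < s := lt_of_le_of_lt (by positivity) hs
  have hG := Real.Gamma_pos_of_pos hs0
  -- The Gamma integral turns the power into a superposition of Gaussians in `x`. After the Gaussian
  -- integration the exponent of `t` is `s - n/2 - 1`, so `s > n/2` is the condition for convergence
  -- at `t = 0`.
  have hpt : ∀ x : Space n, ENNReal.ofReal ((A + B * ‖x‖ ^ 2) ^ (-s)) =
      ENNReal.ofReal (Real.Gamma s)⁻¹ * ∫⁻ t in Ioi (0 : ℝ),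
        ENNReal.ofReal (t ^ (s - 1) * Real.exp (-((A + B * ‖x‖ ^ 2) * t))) := by
    intro x
    rw [lintegral_gamma hs0 (by positivity), ← ENNReal.ofReal_mul (by positivity)]
    congr 1
    field_simp
  simp_rw [hpt]
  rw [lintegral_const_mul' _ _ ENNReal.ofReal_ne_top,
    lintegral_lintegral_swap (Measurable.aemeasurable (by fun_prop))]
  have hin : ∀ t ∈ Ioi (0 : ℝ), ∫⁻ x : Space n,
      ENNReal.ofReal (t ^ (s - 1) * Real.exp (-((A + B * ‖x‖ ^ 2) * t))) =
      ENNReal.ofReal ((Real.pi / B) ^ ((n : ℝ) / 2)) *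
        ENNReal.ofReal (t ^ (s - n / 2 - 1) * Real.exp (-(A * t))) := by
    intro t ht
    have ht : 0 < t := ht
    have h1 : ∀ x : Space n, ENNReal.ofReal (t ^ (s - 1) * Real.exp (-((A + B * ‖x‖ ^ 2) * t))) =
        ENNReal.ofReal (t ^ (s - 1) * Real.exp (-(A * t))) *
          ENNReal.ofReal (Real.exp (-(B * t) * ‖x‖ ^ 2)) := by
      intro x
      rw [← ENNReal.ofReal_mul (by positivity), mul_assoc, ← Real.exp_add]
      congr 3; ring
    simp_rw [h1]
    rw [lintegral_const_mul' _ _ ENNReal.ofReal_ne_top, lintegral_gaussian (by positivity),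
      ← ENNReal.ofReal_mul (by positivity), ← ENNReal.ofReal_mul (by positivity)]
    congr 1
    rw [← div_div, Real.div_rpow (by positivity) ht.le, show s - (n : ℝ) / 2 - 1 = s - 1 - n / 2 by
      ring, Real.rpow_sub ht (s - 1)]
    ring
  rw [setLIntegral_congr_fun measurableSet_Ioi hin, lintegral_const_mul' _ _ ENNReal.ofReal_ne_top,
    lintegral_gamma (by linarith) hA, ← ENNReal.ofReal_mul (by positivity),
    ← ENNReal.ofReal_mul (by positivity)]
  congr 1
  rw [Real.div_rpow Real.pi_pos.le hB.le, Real.rpow_neg hB.le, neg_sub]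
  field_simp

/-- The change of variables `w = c + X / |X|²`. -/
lemma lintegral_inversion (hn : 1 ≤ n) (c : Space n) {H : Space n → ℝ≥0∞} :
    ∫⁻ w, H w = ∫⁻ X, ENNReal.ofReal (‖X‖⁻¹ ^ (2 * n)) * H (c + (‖X‖ ^ 2)⁻¹ • X) := by
  have hs : MeasurableSet ({c}ᶜ : Set (Space n)) := (measurableSet_singleton c).compl
  have hae : ({c}ᶜ : Set (Space n)) =ᵐ[volume] univ := by
    filter_upwards [ae_ne hn c] with x hx
    simp only [eq_iff_iff]
    exact ⟨fun _ => trivial, fun _ => hx⟩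
  have himg : EuclideanGeometry.inversion c 1 '' ({c}ᶜ : Set (Space n)) = {c}ᶜ := by
    rw [image_eq_preimage_of_inverse
      (EuclideanGeometry.inversion_inversion c one_ne_zero)
      (EuclideanGeometry.inversion_inversion c one_ne_zero)]
    ext x
    simp
  have key := lintegral_image_eq_lintegral_abs_det_fderiv_mul volume hs
    (fun x hx => (EuclideanGeometry.hasFDerivAt_inversion (R := 1) hx).hasFDerivWithinAt)
    (EuclideanGeometry.inversion_injective c one_ne_zero).injOn H
  rw [himg, Measure.restrict_congr_set hae, Measure.restrict_univ] at key
  rw [key, ← lintegral_add_right_eq_self _ c]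
  refine lintegral_congr fun X => ?_
  have hd : dist (X + c) c = ‖X‖ := by simp
  have hinv : EuclideanGeometry.inversion c 1 (X + c) = c + (‖X‖ ^ 2)⁻¹ • X := by
    rw [EuclideanGeometry.inversion, hd]
    simp [add_comm]
  rw [hinv, hd]
  congr 2
  -- The derivative of the inversion is `‖X‖⁻²` times a reflection, and a reflection has determinant
  -- of modulus one.
  rw [ContinuousLinearMap.det, ContinuousLinearMap.toLinearMap_smul, LinearMap.det_smul,
    finrank_euclideanSpace_fin, abs_mul]
  have := Submodule.det_reflection (𝕜 := ℝ) (ℝ ∙ (X + c - c))ᗮ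
  erw [this]
  rw [abs_pow (-1 : ℝ), abs_neg, abs_one, one_pow, mul_one, one_div, abs_of_nonneg (by positivity),
    ← pow_mul]

/-- The constant `∫ (1 + |x|²)^{-n-2β} dx`. -/
def coneConst (n : ℕ) (β : ℝ) : ℝ :=
  Real.pi ^ ((n : ℝ) / 2) * Real.Gamma (n / 2 + 2 * β) / Real.Gamma (n + 2 * β)

lemma coneConst_pos {β : ℝ} (hβ : -(n : ℝ) / 4 < β) (hn : 1 ≤ n) : 0 < coneConst n β := by
  have hn' : (1 : ℝ) ≤ n := by exact_mod_cast hn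
  have h1 := Real.Gamma_pos_of_pos (s := n / 2 + 2 * β) (by linarith)
  have h2 := Real.Gamma_pos_of_pos (s := n + 2 * β) (by linarith)
  unfold coneConst
  positivity

/-- Inversion at `y.2` sends one of the two singular centres to infinity. The powers of `‖X‖` from
the Jacobian and from the two factors cancel, and what remains is a translate of the integrand of
`lintegral_rpow_quadratic` with exponent `n + 2 * β`. The hypothesis on `β` is the convergence
condition there. -/
lemma lintegral_exchange (hn : 1 ≤ n) {β : ℝ} (hβ : -(n : ℝ) / 4 < β) {y z : Cone n}
    (hy : 0 < y.1) (hz : 0 < z.1) (hyz : y.2 ≠ z.2) :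
    ∫⁻ w, ENNReal.ofReal ((‖y.2 - w‖ ^ 2) ^ (2 * β) *
      (y.1 * ‖y.2 - w‖ ^ 2 + z.1 * ‖w - z.2‖ ^ 2) ^ (-(n + 2 * β))) =
    ENNReal.ofReal (coneConst n β *
      (y.1 ^ (-(n : ℝ) / 2 - 2 * β) * (z.1 * ‖y.2 - z.2‖ ^ 2) ^ (-((n : ℝ) / 2)))) := by
  have ha : 0 < ‖y.2 - z.2‖ := norm_pos_iff.2 (sub_ne_zero.2 hyz)
  have hn' : (1 : ℝ) ≤ n := by exact_mod_cast hn
  have key := lintegral_rpow_quadratic (n := n) (A := y.1) (B := z.1 * ‖y.2 - z.2‖ ^ 2)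
    (s := n + 2 * β) hy (by positivity) (by linarith)
  rw [show (n : ℝ) + 2 * β - n / 2 = n / 2 + 2 * β by ring,
    show (n : ℝ) / 2 - (n + 2 * β) = -(n : ℝ) / 2 - 2 * β by ring] at key
  rw [coneConst, ← key, lintegral_inversion hn y.2]
  symm
  -- The translation vector is the position of `z.2` after the inversion.
  rw [← lintegral_sub_right_eq_self _ ((‖y.2 - z.2‖ ^ 2)⁻¹ • (z.2 - y.2))]
  symm
  refine lintegral_congr_ae ?_
  filter_upwards [ae_ne hn 0] with X hX
  have hX : 0 < ‖X‖ := norm_pos_iff.2 hX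
  rw [← ENNReal.ofReal_mul (by positivity)]
  congr 1
  have e1 : ‖y.2 - (y.2 + (‖X‖ ^ 2)⁻¹ • X)‖ ^ 2 = (‖X‖ ^ 2)⁻¹ := by
    rw [sub_add_cancel_left, norm_neg, norm_smul, Real.norm_of_nonneg (by positivity)]
    field_simp
  have e2 : y.1 * (‖X‖ ^ 2)⁻¹ + z.1 * ‖y.2 + (‖X‖ ^ 2)⁻¹ • X - z.2‖ ^ 2 =
      (‖X‖ ^ 2)⁻¹ * (y.1 + z.1 * ‖y.2 - z.2‖ ^ 2 *
        ‖X - (‖y.2 - z.2‖ ^ 2)⁻¹ • (z.2 - y.2)‖ ^ 2) := by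
    have h1 : y.2 + (‖X‖ ^ 2)⁻¹ • X - z.2 = (‖X‖ ^ 2)⁻¹ • X - (z.2 - y.2) := by abel
    rw [h1, norm_sub_sq_real X, norm_sub_sq_real ((‖X‖ ^ 2)⁻¹ • X), norm_smul, norm_smul,
      Real.norm_of_nonneg (by positivity), Real.norm_of_nonneg (by positivity), inner_smul_left,
      inner_smul_right, conj_trivial, norm_sub_rev z.2 y.2]
    field_simp
    ring
  rw [e1, e2, Real.mul_rpow (by positivity) (by positivity), ← mul_assoc, ← mul_assoc]
  have e3 : ‖X‖⁻¹ ^ (2 * n) * (‖X‖ ^ 2)⁻¹ ^ (2 * β) * (‖X‖ ^ 2)⁻¹ ^ (-((n : ℝ) + 2 * β)) = 1 := by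
    rw [pow_mul, inv_pow, ← Real.rpow_natCast, ← Real.rpow_add (by positivity),
      ← Real.rpow_add (by positivity)]
    ring_nf
    exact Real.rpow_zero _
  rw [e3, one_mul]

/-! ### Lagrange's identity -/

/-- Lagrange's identity in `L²`: the defect in the Cauchy–Schwarz inequality. -/
theorem lintegral_lagrange {α : Type*} [MeasurableSpace α] (κ : Measure α) [SFinite κ]
    {a b : α → ℂ} (ha : Measurable a) (hb : Measurable b)
    (hfin : (∫⁻ v, ‖a v‖ₑ ^ 2 ∂κ) * ∫⁻ v, ‖b v‖ₑ ^ 2 ∂κ ≠ ∞) :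
    (∫⁻ v, ∫⁻ v', ‖a v * b v' - a v' * b v‖ₑ ^ 2 ∂κ ∂κ) +
      2 * ‖∫ v, a v * starRingEnd ℂ (b v) ∂κ‖ₑ ^ 2 =
    2 * ((∫⁻ v, ‖a v‖ₑ ^ 2 ∂κ) * ∫⁻ v, ‖b v‖ₑ ^ 2 ∂κ) := by
  have hz : ∀ {f : α → ℂ}, Measurable f → ∫⁻ v, ‖f v‖ₑ ^ 2 ∂κ = 0 → ∀ᵐ v ∂κ, f v = 0 := by
    intro f hf h
    rw [lintegral_eq_zero_iff (by fun_prop)] at h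
    filter_upwards [h] with v hv
    simpa using hv
  -- A finite product allows one factor to be infinite when the other is zero. In that case all
  -- terms vanish; otherwise both factors are finite and the functions are in `L²`.
  by_cases ha0 : ∫⁻ v, ‖a v‖ₑ ^ 2 ∂κ = 0
  · have h := hz ha ha0
    have h1 : ∫ v, a v * starRingEnd ℂ (b v) ∂κ = 0 := by
      rw [integral_eq_zero_of_ae]
      filter_upwards [h] with v hv
      simp [hv]
    have h2 : ∫⁻ v, ∫⁻ v', ‖a v * b v' - a v' * b v‖ₑ ^ 2 ∂κ ∂κ = 0 := by
      rw [lintegral_congr_ae (g := fun _ => 0), lintegral_zero]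
      filter_upwards [h] with v hv
      rw [lintegral_congr_ae (g := fun _ => 0), lintegral_zero]
      filter_upwards [h] with v' hv'
      simp [hv, hv']
    simp [h1, h2, ha0]
  by_cases hb0 : ∫⁻ v, ‖b v‖ₑ ^ 2 ∂κ = 0
  · have h := hz hb hb0
    have h1 : ∫ v, a v * starRingEnd ℂ (b v) ∂κ = 0 := by
      rw [integral_eq_zero_of_ae]
      filter_upwards [h] with v hv
      simp [hv]
    have h2 : ∫⁻ v, ∫⁻ v', ‖a v * b v' - a v' * b v‖ₑ ^ 2 ∂κ ∂κ = 0 := by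
      rw [lintegral_congr_ae (g := fun _ => 0), lintegral_zero]
      filter_upwards [h] with v hv
      rw [lintegral_congr_ae (g := fun _ => 0), lintegral_zero]
      filter_upwards [h] with v' hv'
      simp [hv, hv']
    simp [h1, h2, hb0]
  have haf : ∫⁻ v, ‖a v‖ₑ ^ 2 ∂κ ≠ ∞ := fun h => hfin (by rw [h, ENNReal.top_mul hb0])
  have hbf : ∫⁻ v, ‖b v‖ₑ ^ 2 ∂κ ≠ ∞ := fun h => hfin (by rw [h, ENNReal.mul_top ha0])
  have hL2 : ∀ {f : α → ℂ}, Measurable f → ∫⁻ v, ‖f v‖ₑ ^ 2 ∂κ ≠ ∞ → MemLp f 2 κ := by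
    intro f hf h
    refine ⟨hf.aestronglyMeasurable, ?_⟩
    rw [eLpNorm_lt_top_iff_lintegral_rpow_enorm_lt_top two_ne_zero ENNReal.ofNat_ne_top]
    simpa using h.lt_top
  have haL := hL2 ha haf
  have hbL := hL2 hb hbf
  have hconv : ∀ {β : Type _} [MeasurableSpace β] {μ : Measure β} {f : β → ℂ}, Measurable f →
      Integrable (fun v => ‖f v‖ ^ 2) μ →
      ∫⁻ v, ‖f v‖ₑ ^ 2 ∂μ = ENNReal.ofReal (∫ v, ‖f v‖ ^ 2 ∂μ) := by
    intro β _ μ f hf hi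
    rw [ofReal_integral_eq_lintegral_ofReal hi (ae_of_all _ fun _ => by positivity)]
    refine lintegral_congr fun v => ?_
    rw [ENNReal.ofReal_pow (norm_nonneg _), ofReal_norm]
  have hai : Integrable (fun v => ‖a v‖ ^ 2) κ :=
    (memLp_two_iff_integrable_sq_norm ha.aestronglyMeasurable).1 haL
  have hbi : Integrable (fun v => ‖b v‖ ^ 2) κ :=
    (memLp_two_iff_integrable_sq_norm hb.aestronglyMeasurable).1 hbL
  have hab : Integrable (fun v => a v * starRingEnd ℂ (b v)) κ :=
    haL.integrable_mul (q := 2) hbL.star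
  set S : ℂ := ∫ v, a v * starRingEnd ℂ (b v) ∂κ with hS
  have hbS : ∫ v, starRingEnd ℂ (a v * starRingEnd ℂ (b v)) ∂κ = starRingEnd ℂ S := integral_conj
  have hp1 : Integrable (fun p : α × α => ‖a p.1‖ ^ 2 * ‖b p.2‖ ^ 2) (κ.prod κ) := hai.mul_prod hbi
  have hp2 : Integrable (fun p : α × α => ‖b p.1‖ ^ 2 * ‖a p.2‖ ^ 2) (κ.prod κ) := hbi.mul_prod hai
  have hp3 : Integrable (fun p : α × α => (a p.1 * starRingEnd ℂ (b p.1)) *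
      starRingEnd ℂ (a p.2 * starRingEnd ℂ (b p.2))) (κ.prod κ) := by
    refine hab.mul_prod (g := fun v => starRingEnd ℂ (a v * starRingEnd ℂ (b v))) ?_
    exact (Complex.conjCLE.toContinuousLinearMap.integrable_comp hab)
  -- In the square of the `2 × 2` determinant the cross term is a product of a function of `p.1` and
  -- the conjugate of the same function of `p.2`; its integral is `‖S‖²`.
  have hpt : ∀ p : α × α, ‖a p.1 * b p.2 - a p.2 * b p.1‖ ^ 2 =
      ‖a p.1‖ ^ 2 * ‖b p.2‖ ^ 2 + ‖b p.1‖ ^ 2 * ‖a p.2‖ ^ 2 -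
      2 * ((a p.1 * starRingEnd ℂ (b p.1)) *
      starRingEnd ℂ (a p.2 * starRingEnd ℂ (b p.2))).re := by
    intro p
    simp only [← Complex.normSq_eq_norm_sq, Complex.normSq_apply, Complex.mul_re, Complex.mul_im,
      Complex.sub_re, Complex.sub_im, Complex.conj_re, Complex.conj_im, map_mul,
      Complex.conj_conj]
    ring
  have hp4 : Integrable (fun p : α × α => ‖a p.1 * b p.2 - a p.2 * b p.1‖ ^ 2) (κ.prod κ) := by
    simp_rw [hpt]
    exact (hp1.add hp2).sub (hp3.re.const_mul 2)
  have hval : ∫ p : α × α, ‖a p.1 * b p.2 - a p.2 * b p.1‖ ^ 2 ∂(κ.prod κ) =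
      2 * ((∫ v, ‖a v‖ ^ 2 ∂κ) * ∫ v, ‖b v‖ ^ 2 ∂κ) - 2 * ‖S‖ ^ 2 := by
    have h3 : ∫ p : α × α, ((a p.1 * starRingEnd ℂ (b p.1)) *
      starRingEnd ℂ (a p.2 * starRingEnd ℂ (b p.2))).re ∂(κ.prod κ) = ‖S‖ ^ 2 := by
      have h4 := integral_prod_mul (μ := κ) (ν := κ) (fun v => a v * starRingEnd ℂ (b v))
        (fun v => starRingEnd ℂ (a v * starRingEnd ℂ (b v)))
      rw [hbS, ← hS, Complex.mul_conj, Complex.normSq_eq_norm_sq] at h4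
      have h5 := Complex.reCLM.integral_comp_comm hp3
      simp only [Complex.reCLM_apply] at h5
      rw [h5, h4, Complex.ofReal_re]
    have h6 := integral_sub (hp1.add hp2) (hp3.re.const_mul 2)
    have h7 := integral_add hp1 hp2
    simp only [Pi.add_apply, RCLike.re_to_complex] at h6 h7
    simp_rw [hpt]
    rw [h6, h7, integral_const_mul, h3, integral_prod_mul (fun v => ‖a v‖ ^ 2) (fun v => ‖b v‖ ^ 2),
      integral_prod_mul (fun v => ‖b v‖ ^ 2) (fun v => ‖a v‖ ^ 2)]
    ring
  have hD : ∫⁻ v, ∫⁻ v', ‖a v * b v' - a v' * b v‖ₑ ^ 2 ∂κ ∂κ =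
      ENNReal.ofReal (2 * ((∫ v, ‖a v‖ ^ 2 ∂κ) * ∫ v, ‖b v‖ ^ 2 ∂κ) - 2 * ‖S‖ ^ 2) := by
    rw [← lintegral_prod (fun p : α × α => ‖a p.1 * b p.2 - a p.2 * b p.1‖ₑ ^ 2)
      (Measurable.aemeasurable (by fun_prop)), hconv (by fun_prop) hp4, hval]
  have hnn : 0 ≤ 2 * ((∫ v, ‖a v‖ ^ 2 ∂κ) * ∫ v, ‖b v‖ ^ 2 ∂κ) - 2 * ‖S‖ ^ 2 := by
    rw [← hval]
    exact integral_nonneg fun _ => by positivity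
  have h2 : (2 : ℝ≥0∞) = ENNReal.ofReal 2 := by simp
  rw [hD, hconv ha hai, hconv hb hbi, ← ENNReal.ofReal_mul (integral_nonneg fun _ => by positivity),
    ← ofReal_norm, ← ENNReal.ofReal_pow (norm_nonneg _), h2,
    ← ENNReal.ofReal_mul zero_le_two, ← ENNReal.ofReal_mul zero_le_two,
    ← ENNReal.ofReal_add hnn (by positivity)]
  congr 1
  ring

/-! ### Fibres over a frequency and the exchange identity -/

/-- The component `u` of the second null vector, in the direction `v`, of a pair with
difference `q`. -/
def recoil (q : LightCone n) (v : Space n) : ℝ := boxQ q / linL q v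

/-- The first null vector of a pair with difference `q`. -/
def coneFst (q : LightCone n) (v : Space n) : Cone n :=
  (recoil q v + q.1, (recoil q v + q.1)⁻¹ • (q.2.2 + recoil q v • v))

/-- The second null vector of a pair with difference `q`. -/
def coneSnd (q : LightCone n) (v : Space n) : Cone n := (recoil q v, v)

/-- The density on the fibre over `q`. -/
def fibre (q : LightCone n) (v : Space n) : ℝ :=
  (coneDom n).indicator (fun p => recoil p.1 p.2 ^ n / boxQ p.1) (q, v)

lemma fibre_nonneg (q : LightCone n) (v : Space n) : 0 ≤ fibre q v := by
  refine indicator_apply_nonneg fun h => ?_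
  have h1 := h.1
  have h2 := h.2
  unfold recoil
  simp only at h1 h2 ⊢
  positivity

@[fun_prop] lemma Measurable.recoil {α : Type*} [MeasurableSpace α] {f : α → LightCone n}
    {g : α → Space n} (hf : Measurable f) (hg : Measurable g) :
    Measurable fun a => recoil (f a) (g a) := by unfold HalfWave.recoil; fun_prop

@[fun_prop] lemma Measurable.coneFst {α : Type*} [MeasurableSpace α] {f : α → LightCone n}
    {g : α → Space n} (hf : Measurable f) (hg : Measurable g) :
    Measurable fun a => coneFst (f a) (g a) := by unfold HalfWave.coneFst; fun_prop

@[fun_prop] lemma Measurable.coneSnd {α : Type*} [MeasurableSpace α] {f : α → LightCone n}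
    {g : α → Space n} (hf : Measurable f) (hg : Measurable g) :
    Measurable fun a => coneSnd (f a) (g a) := by unfold HalfWave.coneSnd; fun_prop

@[fun_prop] lemma Measurable.fibre {α : Type*} [MeasurableSpace α] {f : α → LightCone n}
    {g : α → Space n} (hf : Measurable f) (hg : Measurable g) :
    Measurable fun a => fibre (f a) (g a) := by
  have h : Measurable (fun p : LightCone n × Space n => HalfWave.recoil p.1 p.2 ^ n / boxQ p.1) := by
    fun_prop
  exact (h.indicator measurableSet_coneDom).comp (hf.prodMk hg)

/-- Adding to `q` the null vector with component `u` and direction `v` changes `boxQ` by `-u * linL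
q v`, so the condition that the sum be null is linear in `u` and has the single solution `recoil`.
-/
lemma recoil_coneDiff {y z : Cone n} (hy : 0 < y.1) (hyz : y.2 ≠ z.2) :
    recoil (coneDiff y z) z.2 = z.1 := by
  have ha : 0 < ‖y.2 - z.2‖ := norm_pos_iff.2 (sub_ne_zero.2 hyz)
  rw [recoil, boxQ_coneDiff, linL_coneDiff]
  simp only [sub_self, norm_zero]
  field_simp
  ring

lemma coneFst_eq {q : LightCone n} {v : Space n} {y z : Cone n} (hq : q = coneDiff y z)
    (hv : z.2 = v) (hy : 0 < y.1) (hr : recoil q v = z.1) : coneFst q v = y := by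
  subst hv
  subst hq
  rw [coneFst, hr]
  simp only [coneDiff, add_sub_cancel]
  rw [sub_add_cancel, smul_smul, inv_mul_cancel₀ hy.ne', one_smul]

lemma coneFst_coneDiff {y z : Cone n} (hy : 0 < y.1) (hyz : y.2 ≠ z.2) :
    coneFst (coneDiff y z) z.2 = y := coneFst_eq rfl rfl hy (recoil_coneDiff hy hyz)

lemma coneSnd_coneDiff {y z : Cone n} (hy : 0 < y.1) (hyz : y.2 ≠ z.2) :
    coneSnd (coneDiff y z) z.2 = z := by
  rw [coneSnd, recoil_coneDiff hy hyz]

lemma exchange_pos {y z : Cone n} {w : Space n} (hy : 0 < y.1) (hz : 0 < z.1) (hyz : y.2 ≠ z.2)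
    (hw : y.2 ≠ w) : 0 < exchange y z w := by
  have ha : 0 < ‖y.2 - z.2‖ := norm_pos_iff.2 (sub_ne_zero.2 hyz)
  have hb : 0 < ‖y.2 - w‖ := norm_pos_iff.2 (sub_ne_zero.2 hw)
  unfold exchange
  positivity

/-- The sum `y + z` splits a second time, with one part in the direction `w` and component `exchange
y z w`. Subtracting that part from `y` gives the same vector as subtracting `z` from the other part,
so `z` is the second vector of a pair over this difference. -/
lemma recoil_exchange {y z : Cone n} {w : Space n} (hy : 0 < y.1) (hz : 0 < z.1)
    (hyz : y.2 ≠ z.2) (hw : y.2 ≠ w) :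
    recoil (coneDiff y (exchange y z w, w)) z.2 = z.1 := by
  have ha : 0 < ‖y.2 - z.2‖ := norm_pos_iff.2 (sub_ne_zero.2 hyz)
  have hb : 0 < ‖y.2 - w‖ := norm_pos_iff.2 (sub_ne_zero.2 hw)
  have hD : 0 < y.1 * ‖y.2 - w‖ ^ 2 + z.1 * ‖w - z.2‖ ^ 2 := by positivity
  have h1 : y.1 * ‖y.2 - z.2‖ ^ 2 - exchange y z w * ‖w - z.2‖ ^ 2 =
      y.1 * ‖y.2 - z.2‖ ^ 2 * (y.1 * ‖y.2 - w‖ ^ 2) /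
        (y.1 * ‖y.2 - w‖ ^ 2 + z.1 * ‖w - z.2‖ ^ 2) := by
    rw [exchange]; field_simp; ring
  rw [recoil, boxQ_coneDiff, linL_coneDiff, h1, exchange]
  field_simp

/-- The density of the exchange measure in the variables `y`, `z`, `w`. -/
def exchangeWeight (y z : Cone n) (w : Space n) : ℝ :=
  exchangeJac y z w * (exchange y z w ^ n / boxQ (coneDiff y (exchange y z w, w))) *
    (z.1 ^ n / boxQ (coneDiff y (exchange y z w, w)))

@[fun_prop] lemma Measurable.exchangeWeight {α : Type*} [MeasurableSpace α] {f g : α → Cone n}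
    {h : α → Space n} (hf : Measurable f) (hg : Measurable g) (hh : Measurable h) :
    Measurable fun a => exchangeWeight (f a) (g a) (h a) := by
  unfold HalfWave.exchangeWeight; fun_prop

lemma exchangeJac_pos {y z : Cone n} {w : Space n} (hy : 0 < y.1) (hz : 0 < z.1)
    (hyz : y.2 ≠ z.2) (hw : y.2 ≠ w) : 0 < exchangeJac y z w := by
  have ha : 0 < ‖y.2 - z.2‖ := norm_pos_iff.2 (sub_ne_zero.2 hyz)
  have hb : 0 < ‖y.2 - w‖ := norm_pos_iff.2 (sub_ne_zero.2 hw)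
  unfold exchangeJac; positivity

lemma boxQ_exchange_pos {y z : Cone n} {w : Space n} (hy : 0 < y.1) (hz : 0 < z.1)
    (hyz : y.2 ≠ z.2) (hw : y.2 ≠ w) : 0 < boxQ (coneDiff y (exchange y z w, w)) := by
  have hb : 0 < ‖y.2 - w‖ := norm_pos_iff.2 (sub_ne_zero.2 hw)
  have := exchange_pos hy hz hyz hw
  rw [boxQ_coneDiff]
  simp only
  positivity

lemma exchangeWeight_pos {y z : Cone n} {w : Space n} (hy : 0 < y.1) (hz : 0 < z.1)
    (hyz : y.2 ≠ z.2) (hw : y.2 ≠ w) : 0 < exchangeWeight y z w := by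
  have h1 := exchangeJac_pos hy hz hyz hw
  have h2 := boxQ_exchange_pos hy hz hyz hw
  have h3 := exchange_pos hy hz hyz hw
  unfold exchangeWeight
  positivity

lemma ae_cone_snd_ne (hn : 1 ≤ n) (v : Space n) : ∀ᵐ z ∂coneMeasure n, v ≠ z.2 := by
  have h : Measure.QuasiMeasurePreserving (Prod.snd : Cone n → Space n) (coneMeasure n) volume :=
    Measure.quasiMeasurePreserving_snd
  filter_upwards [h.ae (ae_ne hn v)] with z hz
  exact hz.symm

/-- The exchange identity: integrating over pairs in the fibres amounts to integrating over null
vectors `y`, `z` and a direction `w`. -/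
theorem lintegral_fibre_pair (hn : 1 ≤ n) {G : LightCone n × Space n × Space n → ℝ≥0∞}
    (hG : Measurable G) :
    ∫⁻ q : LightCone n, ∫⁻ v, ENNReal.ofReal (fibre q v) *
      ∫⁻ v', ENNReal.ofReal (fibre q v') * G (q, v, v') =
    ∫⁻ y, ∫⁻ z, (∫⁻ w, ENNReal.ofReal (exchangeWeight y z w) *
      G (coneDiff y (exchange y z w, w), w, z.2)) ∂coneMeasure n ∂coneMeasure n := by
  have hG' : Measurable fun p : LightCone n × Space n × Space n =>
      ENNReal.ofReal (recoil p.1 p.2.1 ^ n / boxQ p.1) *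
        (ENNReal.ofReal (recoil p.1 p.2.2 ^ n / boxQ p.1) * G p) := by fun_prop
  have key := lintegral_coneDom_pair hn hG'
  convert key using 1
  · refine lintegral_congr fun q => lintegral_congr fun v => ?_
    by_cases h : (q, v) ∈ coneDom n
    · simp only [fibre, indicator_of_mem h]
      rw [← lintegral_const_mul' _ _ ENNReal.ofReal_ne_top]
      refine lintegral_congr fun v' => ?_
      by_cases h' : (q, v') ∈ coneDom n
      · simp [indicator_of_mem h']
      · simp [indicator_of_notMem h']
    · simp [fibre, indicator_of_notMem h]
  · refine lintegral_congr_ae ?_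
    filter_upwards [ae_coneMeasure_pos] with y hy
    refine lintegral_congr_ae ?_
    filter_upwards [ae_coneMeasure_pos, ae_cone_snd_ne hn y.2] with z hz hyz
    refine lintegral_congr_ae ?_
    filter_upwards [ae_ne hn y.2] with w hw
    have h1 := exchangeJac_pos hy hz hyz hw.symm
    have h2 := boxQ_exchange_pos hy hz hyz hw.symm
    have h3 := exchange_pos hy hz hyz hw.symm
    rw [exchangeWeight, recoil_exchange hy hz hyz hw.symm,
      recoil_coneDiff (z := (exchange y z w, w)) hy hw.symm, ENNReal.ofReal_mul (by positivity),
      ENNReal.ofReal_mul (by positivity)]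
    ring

/-- After collecting powers, `w` occurs only through the integrand of `lintegral_exchange`. -/
lemma exchangeWeight_mul_rpow {β : ℝ} {y z : Cone n} {w : Space n} (hy : 0 < y.1) (hz : 0 < z.1)
    (hyz : y.2 ≠ z.2) (hw : y.2 ≠ w) :
    exchangeWeight y z w * boxQ (coneDiff y (exchange y z w, w)) ^ (2 * β) =
      y.1 ^ (2 * n + 4 * β - 2) * z.1 ^ (2 * n + 2 * β - 2) *
        (‖y.2 - z.2‖ ^ 2) ^ (n + 2 * β - 1) * ((‖y.2 - w‖ ^ 2) ^ (2 * β) *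
      (y.1 * ‖y.2 - w‖ ^ 2 + z.1 * ‖w - z.2‖ ^ 2) ^ (-(n + 2 * β))) := by
  have ha : 0 < ‖y.2 - z.2‖ := norm_pos_iff.2 (sub_ne_zero.2 hyz)
  have hb : 0 < ‖y.2 - w‖ := norm_pos_iff.2 (sub_ne_zero.2 hw)
  have hD : 0 < y.1 * ‖y.2 - w‖ ^ 2 + z.1 * ‖w - z.2‖ ^ 2 := by positivity
  rw [exchangeWeight, boxQ_coneDiff, exchangeJac, exchange]
  simp only
  have ha2 := pow_pos ha 2
  have hb2 := pow_pos hb 2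
  generalize y.1 * ‖y.2 - w‖ ^ 2 + z.1 * ‖w - z.2‖ ^ 2 = D at *
  generalize ‖y.2 - w‖ ^ 2 = b at *
  generalize ‖y.2 - z.2‖ ^ 2 = a at *
  generalize y.1 = s at *
  generalize z.1 = t at *
  -- Writing every positive quantity as an exponential reduces the identity of powers to a linear
  -- identity between exponents.
  obtain ⟨D, rfl⟩ : ∃ x, D = Real.exp x := ⟨_, (Real.exp_log hD).symm⟩
  obtain ⟨a, rfl⟩ : ∃ x, a = Real.exp x := ⟨_, (Real.exp_log ha2).symm⟩
  obtain ⟨b, rfl⟩ : ∃ x, b = Real.exp x := ⟨_, (Real.exp_log hb2).symm⟩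
  obtain ⟨s, rfl⟩ : ∃ x, s = Real.exp x := ⟨_, (Real.exp_log hy).symm⟩
  obtain ⟨t, rfl⟩ : ∃ x, t = Real.exp x := ⟨_, (Real.exp_log hz).symm⟩
  simp only [← Real.exp_mul, ← Real.exp_nat_mul, ← Real.exp_add, ← Real.exp_sub]
  congr 1
  push_cast
  ring

/-! ### The bilinear identity on the cone -/

/-- The weight of the energy in light-cone coordinates. -/
def coneWeight (β : ℝ) (y z : Cone n) : ℝ :=
  y.1 ^ ((n : ℝ) - 1) * z.1 ^ ((n : ℝ) - 1) *
    (y.1 * z.1 * ‖y.2 - z.2‖ ^ 2) ^ ((n : ℝ) / 2 - 1 + 2 * β)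

@[fun_prop] lemma Measurable.coneWeight {α : Type*} [MeasurableSpace α] {f g : α → Cone n}
    {β : ℝ} (hf : Measurable f) (hg : Measurable g) :
    Measurable fun a => coneWeight β (f a) (g a) := by
  unfold HalfWave.coneWeight; fun_prop

/-- The sharp constant originates here: integrating out the free direction leaves the weight of the
energy up to a factor that does not depend on `y` and `z`. -/
lemma lintegral_exchangeWeight (hn : 1 ≤ n) {β : ℝ} (hβ : -(n : ℝ) / 4 < β) {y z : Cone n}
    (hy : 0 < y.1) (hz : 0 < z.1) (hyz : y.2 ≠ z.2) :
    ∫⁻ w, ENNReal.ofReal (exchangeWeight y z w *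
      boxQ (coneDiff y (exchange y z w, w)) ^ (2 * β)) =
    ENNReal.ofReal (coneConst n β) * ENNReal.ofReal (coneWeight β y z) := by
  have ha : 0 < ‖y.2 - z.2‖ := norm_pos_iff.2 (sub_ne_zero.2 hyz)
  have hC := coneConst_pos hβ hn
  have h1 : ∀ᵐ w : Space n, ENNReal.ofReal (exchangeWeight y z w *
      boxQ (coneDiff y (exchange y z w, w)) ^ (2 * β)) =
      ENNReal.ofReal (y.1 ^ (2 * n + 4 * β - 2) * z.1 ^ (2 * n + 2 * β - 2) *
        (‖y.2 - z.2‖ ^ 2) ^ (n + 2 * β - 1)) * ENNReal.ofReal ((‖y.2 - w‖ ^ 2) ^ (2 * β) *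
      (y.1 * ‖y.2 - w‖ ^ 2 + z.1 * ‖w - z.2‖ ^ 2) ^ (-(n + 2 * β))) := by
    filter_upwards [ae_ne hn y.2] with w hw
    rw [exchangeWeight_mul_rpow hy hz hyz hw.symm, ENNReal.ofReal_mul (by positivity)]
  rw [lintegral_congr_ae h1, lintegral_const_mul' _ _ ENNReal.ofReal_ne_top,
    lintegral_exchange hn hβ hy hz hyz, ← ENNReal.ofReal_mul (by positivity),
    ← ENNReal.ofReal_mul hC.le, mul_left_comm, coneWeight]
  congr 2
  have ha2 := pow_pos ha 2
  generalize ‖y.2 - z.2‖ ^ 2 = a at *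
  generalize y.1 = s at *
  generalize z.1 = t at *
  obtain ⟨a, rfl⟩ : ∃ x, a = Real.exp x := ⟨_, (Real.exp_log ha2).symm⟩
  obtain ⟨s, rfl⟩ : ∃ x, s = Real.exp x := ⟨_, (Real.exp_log hy).symm⟩
  obtain ⟨t, rfl⟩ : ∃ x, t = Real.exp x := ⟨_, (Real.exp_log hz).symm⟩
  simp only [← Real.exp_mul, ← Real.exp_add]
  congr 1
  ring

/-- The fibre integral: the density of the product of two waves on the Fourier side. -/
def bilin (Φ Ψ : Cone n → ℂ) (q : LightCone n) : ℂ :=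
  ∫ v, (fibre q v : ℂ) * (Φ (coneFst q v) * starRingEnd ℂ (Ψ (coneSnd q v)))

/-- The energy in light-cone coordinates. -/
def coneEnergy (β : ℝ) (Φ Ψ : Cone n → ℂ) : ℝ≥0∞ :=
  ∫⁻ y, ∫⁻ z, ‖Φ y‖ₑ ^ 2 * ‖Ψ z‖ₑ ^ 2 * ENNReal.ofReal (coneWeight β y z)
    ∂coneMeasure n ∂coneMeasure n

/-- The defect in the bilinear estimate. -/
def coneDefect (β : ℝ) (Φ Ψ : Cone n → ℂ) : ℝ≥0∞ :=
  ∫⁻ q : LightCone n, ∫⁻ v, ENNReal.ofReal (fibre q v) * ∫⁻ v', ENNReal.ofReal (fibre q v') *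
    (ENNReal.ofReal (boxQ q ^ (2 * β)) *
      ‖Φ (coneFst q v) * Ψ (coneSnd q v') - Φ (coneFst q v') * Ψ (coneSnd q v)‖ₑ ^ 2)

lemma measurable_bilin {Φ Ψ : Cone n → ℂ} (hΦ : Measurable Φ) (hΨ : Measurable Ψ) :
    Measurable (bilin Φ Ψ) := by
  have h : Measurable fun p : LightCone n × Space n => (fibre p.1 p.2 : ℂ) *
      (Φ (coneFst p.1 p.2) * starRingEnd ℂ (Ψ (coneSnd p.1 p.2))) := by fun_prop
  exact (h.stronglyMeasurable.integral_prod_right' (ν := volume)).measurable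

lemma lintegral_withDensity_fibre (q : LightCone n) {f : Space n → ℝ≥0∞} (hf : Measurable f) :
    ∫⁻ v, f v ∂(volume.withDensity fun v => ENNReal.ofReal (fibre q v)) =
      ∫⁻ v, ENNReal.ofReal (fibre q v) * f v :=
  lintegral_withDensity_eq_lintegral_mul _ (by fun_prop) hf

lemma bilin_eq_withDensity (Φ Ψ : Cone n → ℂ) (q : LightCone n) :
    bilin Φ Ψ q = ∫ v, Φ (coneFst q v) * starRingEnd ℂ (Ψ (coneSnd q v))
      ∂(volume.withDensity fun v => ENNReal.ofReal (fibre q v)) := by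
  rw [integral_withDensity_eq_integral_toReal_smul (by fun_prop)
    (ae_of_all _ fun _ => ENNReal.ofReal_lt_top), bilin]
  refine integral_congr_ae (ae_of_all _ fun v => ?_)
  simp [ENNReal.toReal_ofReal (fibre_nonneg q v)]

/-- In the exchange variables the first vector for `v` is `y` and the second vector for `v'` is `z`;
the data are constant in `w` and come out of the inner integral. -/
lemma lintegral_fibre_energy (hn : 1 ≤ n) {β : ℝ} (hβ : -(n : ℝ) / 4 < β) {Φ Ψ : Cone n → ℂ}
    (hΦ : Measurable Φ) (hΨ : Measurable Ψ) :
    ∫⁻ q : LightCone n, ∫⁻ v, ENNReal.ofReal (fibre q v) * ∫⁻ v', ENNReal.ofReal (fibre q v') *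
      (ENNReal.ofReal (boxQ q ^ (2 * β)) * (‖Φ (coneFst q v)‖ₑ ^ 2 * ‖Ψ (coneSnd q v')‖ₑ ^ 2)) =
    ENNReal.ofReal (coneConst n β) * coneEnergy β Φ Ψ := by
  have key := lintegral_fibre_pair hn (G := fun p => ENNReal.ofReal (boxQ p.1 ^ (2 * β)) *
    (‖Φ (coneFst p.1 p.2.1)‖ₑ ^ 2 * ‖Ψ (coneSnd p.1 p.2.2)‖ₑ ^ 2)) (by fun_prop)
  rw [key, coneEnergy, ← lintegral_const_mul' _ _ ENNReal.ofReal_ne_top]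
  refine lintegral_congr_ae ?_
  filter_upwards [ae_coneMeasure_pos] with y hy
  rw [← lintegral_const_mul' _ _ ENNReal.ofReal_ne_top]
  refine lintegral_congr_ae ?_
  filter_upwards [ae_coneMeasure_pos, ae_cone_snd_ne hn y.2] with z hz hyz
  have h1 : ∀ᵐ w : Space n, ENNReal.ofReal (exchangeWeight y z w) *
      (ENNReal.ofReal (boxQ (coneDiff y (exchange y z w, w)) ^ (2 * β)) *
        (‖Φ (coneFst (coneDiff y (exchange y z w, w)) w)‖ₑ ^ 2 *
          ‖Ψ (coneSnd (coneDiff y (exchange y z w, w)) z.2)‖ₑ ^ 2)) =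
      ENNReal.ofReal (exchangeWeight y z w * boxQ (coneDiff y (exchange y z w, w)) ^ (2 * β)) *
        (‖Φ y‖ₑ ^ 2 * ‖Ψ z‖ₑ ^ 2) := by
    filter_upwards [ae_ne hn y.2] with w hw
    rw [coneFst_coneDiff (z := (exchange y z w, w)) hy hw.symm, coneSnd,
      recoil_exchange hy hz hyz hw.symm,
      ENNReal.ofReal_mul (exchangeWeight_pos hy hz hyz hw.symm).le, mul_assoc]
  rw [lintegral_congr_ae h1, lintegral_mul_const _ (by fun_prop),
    lintegral_exchangeWeight hn hβ hy hz hyz]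
  ring

/-- The bilinear identity in light-cone coordinates. -/
theorem coneDefect_add (hn : 1 ≤ n) {β : ℝ} (hβ : -(n : ℝ) / 4 < β) {Φ Ψ : Cone n → ℂ}
    (hΦ : Measurable Φ) (hΨ : Measurable Ψ) (hfin : coneEnergy β Φ Ψ ≠ ∞) :
    coneDefect β Φ Ψ + 2 * ∫⁻ q, ENNReal.ofReal (boxQ q ^ (2 * β)) * ‖bilin Φ Ψ q‖ₑ ^ 2 =
      2 * (ENNReal.ofReal (coneConst n β) * coneEnergy β Φ Ψ) := by
  have hE := lintegral_fibre_energy hn hβ hΦ hΨ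
  have hbm := measurable_bilin hΦ hΨ
  have hA : Measurable fun q : LightCone n =>
      ∫⁻ v, ENNReal.ofReal (fibre q v) * ‖Φ (coneFst q v)‖ₑ ^ 2 :=
    Measurable.lintegral_prod_right' (f := fun p : LightCone n × Space n =>
      ENNReal.ofReal (fibre p.1 p.2) * ‖Φ (coneFst p.1 p.2)‖ₑ ^ 2) (by fun_prop)
  have hB : Measurable fun q : LightCone n =>
      ∫⁻ v, ENNReal.ofReal (fibre q v) * ‖Ψ (coneSnd q v)‖ₑ ^ 2 :=
    Measurable.lintegral_prod_right' (f := fun p : LightCone n × Space n =>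
      ENNReal.ofReal (fibre p.1 p.2) * ‖Ψ (coneSnd p.1 p.2)‖ₑ ^ 2) (by fun_prop)
  have hE1 : ∀ q : LightCone n, ∫⁻ v, ENNReal.ofReal (fibre q v) *
      ∫⁻ v', ENNReal.ofReal (fibre q v') *
      (ENNReal.ofReal (boxQ q ^ (2 * β)) * (‖Φ (coneFst q v)‖ₑ ^ 2 * ‖Ψ (coneSnd q v')‖ₑ ^ 2)) =
      ENNReal.ofReal (boxQ q ^ (2 * β)) * ((∫⁻ v, ENNReal.ofReal (fibre q v) *
        ‖Φ (coneFst q v)‖ₑ ^ 2) * ∫⁻ v, ENNReal.ofReal (fibre q v) * ‖Ψ (coneSnd q v)‖ₑ ^ 2) := by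
    intro q
    rw [← lintegral_mul_const _ (by fun_prop), ← lintegral_const_mul' _ _ ENNReal.ofReal_ne_top]
    refine lintegral_congr fun v => ?_
    rw [mul_left_comm, mul_assoc, ← lintegral_const_mul _ (by fun_prop),
      ← lintegral_const_mul _ (by fun_prop), ← lintegral_const_mul _ (by fun_prop),
      ← lintegral_const_mul _ (by fun_prop)]
    refine lintegral_congr fun v' => ?_
    ring
  simp_rw [hE1] at hE
  have hfin' : ∀ᵐ q : LightCone n, ENNReal.ofReal (boxQ q ^ (2 * β)) *
      ((∫⁻ v, ENNReal.ofReal (fibre q v) * ‖Φ (coneFst q v)‖ₑ ^ 2) *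
        ∫⁻ v, ENNReal.ofReal (fibre q v) * ‖Ψ (coneSnd q v)‖ₑ ^ 2) < ∞ :=
    ae_lt_top (by fun_prop) (by rw [hE]; exact ENNReal.mul_ne_top ENNReal.ofReal_ne_top hfin)
  rw [← hE, coneDefect, ← lintegral_const_mul' _ _ ENNReal.ofNat_ne_top,
    ← lintegral_const_mul' _ _ ENNReal.ofNat_ne_top, ← lintegral_add_right _ (by fun_prop)]
  refine lintegral_congr_ae ?_
  filter_upwards [hfin'] with q hq
  have hpull : ∫⁻ v, ENNReal.ofReal (fibre q v) * ∫⁻ v', ENNReal.ofReal (fibre q v') *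
      (ENNReal.ofReal (boxQ q ^ (2 * β)) *
      ‖Φ (coneFst q v) * Ψ (coneSnd q v') - Φ (coneFst q v') * Ψ (coneSnd q v)‖ₑ ^ 2) =
      ENNReal.ofReal (boxQ q ^ (2 * β)) * ∫⁻ v, ENNReal.ofReal (fibre q v) *
        ∫⁻ v', ENNReal.ofReal (fibre q v') *
      ‖Φ (coneFst q v) * Ψ (coneSnd q v') - Φ (coneFst q v') * Ψ (coneSnd q v)‖ₑ ^ 2 := by
    rw [← lintegral_const_mul' _ _ ENNReal.ofReal_ne_top]
    refine lintegral_congr fun v => ?_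
    rw [mul_left_comm]
    congr 1
    rw [← lintegral_const_mul' _ _ ENNReal.ofReal_ne_top]
    refine lintegral_congr fun v' => ?_
    ring
  rw [hpull]
  -- For space-like `q` the weight is positive, so finiteness of the weighted product passes to the
  -- fibre integrals and Lagrange's identity applies to the fibre measure. For other `q` the fibre
  -- is empty.
  by_cases hQ : 0 < boxQ q
  · have hQp : ENNReal.ofReal (boxQ q ^ (2 * β)) ≠ 0 := by
      rw [Ne, ENNReal.ofReal_eq_zero, not_le]; positivity
    have hlag := lintegral_lagrange (volume.withDensity fun v => ENNReal.ofReal (fibre q v))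
      (a := fun v => Φ (coneFst q v)) (b := fun v => Ψ (coneSnd q v)) (by fun_prop) (by fun_prop)
      (by
        rw [lintegral_withDensity_fibre q (by fun_prop), lintegral_withDensity_fibre q (by fun_prop)]
        intro h
        rw [h, ENNReal.mul_top hQp] at hq
        exact lt_irrefl _ hq)
    rw [← bilin_eq_withDensity, lintegral_withDensity_fibre q (by fun_prop),
      lintegral_withDensity_fibre q (by fun_prop),
      lintegral_withDensity_fibre q (by fun_prop)] at hlag
    have h2 : ∀ v, ∫⁻ v', ‖Φ (coneFst q v) * Ψ (coneSnd q v') -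
        Φ (coneFst q v') * Ψ (coneSnd q v)‖ₑ ^ 2
          ∂(volume.withDensity fun v => ENNReal.ofReal (fibre q v)) =
        ∫⁻ v', ENNReal.ofReal (fibre q v') * ‖Φ (coneFst q v) * Ψ (coneSnd q v') -
        Φ (coneFst q v') * Ψ (coneSnd q v)‖ₑ ^ 2 := fun v =>
      lintegral_withDensity_fibre q (by fun_prop)
    simp_rw [h2] at hlag
    rw [mul_left_comm 2, ← mul_add, hlag, mul_left_comm]
  · have h0 : ∀ v, fibre q v = 0 := fun v =>
      indicator_of_notMem (fun h => hQ h.1) _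
    simp [h0, bilin]

/-! ### The space-time Fourier transform: inversion, uniqueness, Plancherel -/

section

open scoped FourierTransform ContDiff

variable {d : ℕ}

/-- Space-time with its Euclidean norm. -/
abbrev EuclSpacetime (d : ℕ) : Type := WithLp 2 (ℝ × Space d)

/-- The identity from the Euclidean to the product norm. -/
def eucl (d : ℕ) : EuclSpacetime d ≃L[ℝ] Spacetime d :=
  WithLp.prodContinuousLinearEquiv 2 ℝ ℝ (Space d)

/-- Rescaling by `1/(2π)`, from the product to the Euclidean norm. -/
def scaleEucl (d : ℕ) : Spacetime d ≃L[ℝ] EuclSpacetime d :=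
  (eucl d).symm.trans (ContinuousLinearEquiv.smulLeft (Units.mk0 (2 * Real.pi)⁻¹ (by positivity)))

lemma scaleEucl_apply (p : Spacetime d) :
    scaleEucl d p = (2 * Real.pi)⁻¹ • (WithLp.toLp 2 p : EuclSpacetime d) := rfl

lemma measurePreserving_eucl : MeasurePreserving (eucl d) :=
  WithLp.volume_preserving_ofLp ℝ (Space d)

lemma finrank_euclSpacetime : Module.finrank ℝ (EuclSpacetime d) = d + 1 := by
  rw [(eucl d).toLinearEquiv.finrank_eq, Module.finrank_prod]
  simp [add_comm]

lemma map_scaleEucl : Measure.map (scaleEucl d) volume =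
    ENNReal.ofReal ((2 * Real.pi) ^ (d + 1)) • (volume : Measure (EuclSpacetime d)) := by
  have h := Measure.map_addHaar_smul (volume : Measure (EuclSpacetime d))
    (r := (2 * Real.pi)⁻¹) (by positivity)
  rw [finrank_euclSpacetime, inv_pow, inv_inv, abs_of_pos (by positivity)] at h
  rw [← h, ← (WithLp.volume_preserving_toLp ℝ (Space d)).map_eq,
    Measure.map_map (by fun_prop) (WithLp.volume_preserving_toLp ℝ (Space d)).measurable]
  rfl

/-- A Schwartz function on space-time, as a function on Euclidean space. -/
def toEucl (φ : 𝓢(Spacetime d, ℂ)) : 𝓢(EuclSpacetime d, ℂ) :=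
  SchwartzMap.compCLMOfContinuousLinearEquiv ℂ (eucl d) φ

lemma toEucl_apply (φ : 𝓢(Spacetime d, ℂ)) (z : EuclSpacetime d) : toEucl φ z = φ (eucl d z) := rfl

/-- The Fourier transform of a Schwartz function on space-time, as a function on Euclidean space. -/
def euclFourier (φ : 𝓢(Spacetime d, ℂ)) : 𝓢(EuclSpacetime d, ℂ) := 𝓕 (toEucl φ)

/-- The space-time Fourier transform of Schwartz functions. -/
def schwartzFourier (φ : 𝓢(Spacetime d, ℂ)) : 𝓢(Spacetime d, ℂ) :=
  SchwartzMap.compCLMOfContinuousLinearEquiv ℂ (scaleEucl d) (euclFourier φ)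

lemma schwartzFourier_apply (φ : 𝓢(Spacetime d, ℂ)) (q : Spacetime d) :
    schwartzFourier φ q = euclFourier φ (scaleEucl d q) := rfl

/-- The norm of `ℝ × Space d` is not Euclidean and the exponent carries no `2π`; passing to
`EuclSpacetime` and rescaling by `1/(2π)` accounts for both and makes the theory of `𝓕` available.
-/
lemma spacetimeFourier_eq (φ : 𝓢(Spacetime d, ℂ)) : spacetimeFourier φ = schwartzFourier φ := by
  funext q
  rw [schwartzFourier_apply, euclFourier, SchwartzMap.fourier_coe, Real.fourier_eq',
    spacetimeFourier,
    ← measurePreserving_eucl.integral_comp (eucl d).toHomeomorph.measurableEmbedding]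
  refine integral_congr_ae (ae_of_all _ fun z => ?_)
  simp only [toEucl_apply, smul_eq_mul]
  congr 2
  have : inner ℝ z (scaleEucl d q) =
      (2 * Real.pi)⁻¹ * ((eucl d z).1 * q.1 + inner ℝ (eucl d z).2 q.2) := by
    rw [scaleEucl_apply, inner_smul_right, WithLp.prod_inner_apply]
    congr 2
    exact mul_comm _ _
  rw [this]
  push_cast
  field_simp

/-- Needed for injectivity: testing against transforms of Schwartz functions is the same as testing
against all Schwartz functions. -/
lemma schwartzFourier_surjective : Function.Surjective (schwartzFourier (d := d)) := by
  intro ψ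
  refine ⟨SchwartzMap.compCLMOfContinuousLinearEquiv ℂ (eucl d).symm
    (𝓕⁻ (SchwartzMap.compCLMOfContinuousLinearEquiv ℂ (scaleEucl d).symm ψ)), ?_⟩
  have h1 : toEucl (SchwartzMap.compCLMOfContinuousLinearEquiv ℂ (eucl d).symm
    (𝓕⁻ (SchwartzMap.compCLMOfContinuousLinearEquiv ℂ (scaleEucl d).symm ψ))) =
    𝓕⁻ (SchwartzMap.compCLMOfContinuousLinearEquiv ℂ (scaleEucl d).symm ψ) := by
    ext x; simp [toEucl_apply]
  rw [schwartzFourier, euclFourier, h1, FourierTransform.fourier_fourierInv_eq]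
  ext x; simp

lemma integral_comp_scaleEucl (F : EuclSpacetime d → ℂ) :
    ∫ p, F (scaleEucl d p) = ((2 * Real.pi) ^ (d + 1) : ℝ) * ∫ z, F z := by
  have h2 := integral_map_equiv (scaleEucl d).toHomeomorph.toMeasurableEquiv (μ := volume) F
  have h3 : Measure.map (scaleEucl d).toHomeomorph.toMeasurableEquiv volume = _ := map_scaleEucl
  rw [h3, integral_smul_measure] at h2
  refine h2.symm.trans ?_
  rw [ENNReal.toReal_ofReal (by positivity), Complex.real_smul]

/-- Fourier inversion in space-time. -/
lemma integral_exp_mul_spacetimeFourier (φ : 𝓢(Spacetime d, ℂ)) (q : Spacetime d) :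
    ∫ p : Spacetime d, Complex.exp (Complex.I * ((p.1 * q.1 + inner ℝ p.2 q.2 : ℝ) : ℂ)) *
      spacetimeFourier φ p = ((2 * Real.pi) ^ (d + 1) : ℝ) * φ q := by
  have h1 : ∀ p : Spacetime d, Complex.exp (Complex.I * ((p.1 * q.1 + inner ℝ p.2 q.2 : ℝ) : ℂ)) *
      spacetimeFourier φ p = (fun z : EuclSpacetime d =>
        Complex.exp (((2 * Real.pi * inner ℝ z ((eucl d).symm q) : ℝ) : ℂ) * Complex.I) •
        euclFourier φ z) (scaleEucl d p) := by
    intro p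
    rw [spacetimeFourier_eq, schwartzFourier_apply]
    simp only [smul_eq_mul]
    congr 2
    have : inner ℝ (scaleEucl d p) ((eucl d).symm q) =
        (2 * Real.pi)⁻¹ * (p.1 * q.1 + inner ℝ p.2 q.2) := by
      rw [scaleEucl_apply, inner_smul_left, WithLp.prod_inner_apply, conj_trivial]
      congr 2
      exact mul_comm _ _
    rw [this]
    push_cast
    field_simp
  refine (integral_congr_ae (ae_of_all _ h1)).trans ((integral_comp_scaleEucl (fun z =>
    Complex.exp (((2 * Real.pi * inner ℝ z ((eucl d).symm q) : ℝ) : ℂ) * Complex.I) •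
      euclFourier φ z)).trans ?_)
  rw [← Real.fourierInv_eq', ← SchwartzMap.fourierInv_coe, euclFourier,
    FourierTransform.fourierInv_fourier_eq]
  simp [toEucl_apply]

lemma memLp_two_comp_scaleEucl {h : EuclSpacetime d → ℂ} (hh : MemLp h 2) :
    MemLp (fun p => h (scaleEucl d p)) 2 ∧
      eLpNorm (fun p => h (scaleEucl d p)) 2 volume ^ 2 =
        ENNReal.ofReal ((2 * Real.pi) ^ (d + 1)) * eLpNorm h 2 volume ^ 2 := by
  have hm : Measure.map (scaleEucl d) volume = _ := map_scaleEucl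
  have hh' : MemLp h 2 (Measure.map (scaleEucl d) volume) := by
    rw [hm]; exact hh.smul_measure ENNReal.ofReal_ne_top
  have hA : AEMeasurable (scaleEucl d) volume := by fun_prop
  refine ⟨(memLp_map_measure_iff hh'.1 hA).1 hh', ?_⟩
  have h1 := eLpNorm_map_measure (p := 2) hh'.1 hA
  rw [hm, eLpNorm_smul_measure_of_ne_top ENNReal.ofNat_ne_top] at h1
  change eLpNorm (h ∘ scaleEucl d) 2 volume ^ 2 = _
  rw [← h1, smul_eq_mul, mul_pow, ← ENNReal.rpow_natCast, ← ENNReal.rpow_mul]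
  simp

instance : (volume : Measure (Spacetime d)).IsAddHaarMeasure := by
  rw [Measure.volume_eq_prod]; infer_instance

lemma integrable_mul_schwartz {V : Spacetime d → ℂ} (hV : MemLp V 2) (φ : 𝓢(Spacetime d, ℂ)) :
    Integrable fun p => V p * φ p :=
  hV.integrable_mul (q := 2) (φ.memLp 2)

/-- Every `L²` function is the Fourier transform of an `L²` function. -/
theorem exists_hasSpacetimeFourier {G : Spacetime d → ℂ} (hG : MemLp G 2) :
    ∃ V : Spacetime d → ℂ, MemLp V 2 ∧ HasSpacetimeFourier V G ∧
      ENNReal.ofReal ((2 * Real.pi) ^ (d + 1)) * eLpNorm V 2 volume ^ 2 =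
        eLpNorm G 2 volume ^ 2 := by
  have hG' : MemLp (fun z => G (eucl d z)) 2 := hG.comp_measurePreserving measurePreserving_eucl
  set g : Lp ℂ 2 (volume : Measure (EuclSpacetime d)) := hG'.toLp with hg
  set h : Lp ℂ 2 (volume : Measure (EuclSpacetime d)) := 𝓕⁻ g with hh
  obtain ⟨hm, hnorm⟩ := memLp_two_comp_scaleEucl (Lp.memLp h)
  have hc : (0 : ℝ) < (2 * Real.pi) ^ (d + 1) := by positivity
  have hV : MemLp (fun p => (((2 * Real.pi) ^ (d + 1))⁻¹ : ℝ) • h (scaleEucl d p)) 2 :=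
    hm.const_smul (((2 * Real.pi) ^ (d + 1))⁻¹ : ℝ)
  -- The factor `(2π)^{-(d+1)}` is the normalisation of the inverse transform when the forward one
  -- has none; it compensates the Jacobian of `scaleEucl`.
  refine ⟨fun p => (((2 * Real.pi) ^ (d + 1))⁻¹ : ℝ) • h (scaleEucl d p), hV, ?_, ?_⟩
  · intro φ
    refine ⟨?_, integrable_mul_schwartz hG φ, ?_⟩
    · rw [spacetimeFourier_eq]
      exact integrable_mul_schwartz hV _
    · have h1 := DFunLike.congr_fun (Lp.fourier_toTemperedDistribution_eq h) (toEucl φ)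
      rw [TemperedDistribution.fourier_apply, Lp.toTemperedDistribution_apply,
        Lp.toTemperedDistribution_apply, hh, FourierTransform.fourier_fourierInv_eq, ← hh] at h1
      have h2 : ∫ q, G q * φ q = ∫ z, toEucl φ z • g z := by
        rw [← measurePreserving_eucl.integral_comp (eucl d).toHomeomorph.measurableEmbedding]
        refine integral_congr_ae ?_
        filter_upwards [hG'.coeFn_toLp] with z hz
        rw [toEucl_apply, hg, hz, smul_eq_mul, mul_comm]
      rw [h2, ← h1, spacetimeFourier_eq]
      have h3 := integral_comp_scaleEucl (d := d) fun z =>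
        ((((2 * Real.pi) ^ (d + 1))⁻¹ : ℝ) • h z) * euclFourier φ z
      simp only [schwartzFourier_apply]
      rw [h3, ← integral_const_mul]
      refine integral_congr_ae (ae_of_all _ fun z => ?_)
      simp only [Complex.real_smul, smul_eq_mul, euclFourier]
      push_cast
      field_simp
  · have h4 : eLpNorm (fun p => (((2 * Real.pi) ^ (d + 1))⁻¹ : ℝ) • h (scaleEucl d p)) 2 volume =
        ‖(((2 * Real.pi) ^ (d + 1))⁻¹ : ℝ)‖ₑ * eLpNorm (fun p => h (scaleEucl d p)) 2 volume :=
      eLpNorm_const_smul (((2 * Real.pi) ^ (d + 1))⁻¹ : ℝ) (fun p => h (scaleEucl d p)) 2 volume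
    have h5 : eLpNorm h 2 volume = eLpNorm G 2 volume := by
      have h6 : ‖h‖ = ‖g‖ := by
        rw [hh, ← Lp.norm_fourier_eq, FourierTransform.fourier_fourierInv_eq]
      rw [Lp.norm_def, Lp.norm_def, ENNReal.toReal_eq_toReal_iff' (Lp.eLpNorm_ne_top h)
        (Lp.eLpNorm_ne_top g)] at h6
      rw [h6, hg, eLpNorm_congr_ae hG'.coeFn_toLp]
      exact eLpNorm_comp_measurePreserving hG.1 measurePreserving_eucl
    rw [h4, mul_pow (M := ℝ≥0∞), hnorm, h5, ← ofReal_norm, Real.norm_of_nonneg (by positivity),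
      ← ENNReal.ofReal_pow (by positivity), ← mul_assoc, ← mul_assoc, ← ENNReal.ofReal_mul hc.le,
      ← ENNReal.ofReal_mul (by positivity)]
    have : (2 * Real.pi) ^ (d + 1) * ((2 * Real.pi) ^ (d + 1))⁻¹ ^ 2 * (2 * Real.pi) ^ (d + 1) =
        1 := by field_simp
    rw [this, ENNReal.ofReal_one, one_mul]

/-- A function that annihilates all Schwartz functions vanishes. -/
theorem ae_eq_zero_of_forall_schwartz {F : Spacetime d → ℂ}
    (h : ∀ φ : 𝓢(Spacetime d, ℂ), Integrable (fun q => F q * φ q) ∧ ∫ q, F q * φ q = 0) :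
    F =ᵐ[volume] 0 := by
  have hs : ∀ g : Spacetime d → ℝ, ContDiff ℝ ∞ g → HasCompactSupport g →
      ∃ φ : 𝓢(Spacetime d, ℂ), ∀ q, φ q = g q := by
    intro g hg hc
    have hg₁ : HasCompactSupport (Complex.ofRealCLM ∘ g) := hc.comp_left rfl
    have hg₂ : ContDiff ℝ ∞ (Complex.ofRealCLM ∘ g) := by fun_prop
    exact ⟨hg₁.toSchwartzMap hg₂, fun q => rfl⟩
  have hloc : LocallyIntegrable F volume := by
    intro x
    -- A bump equal to one near `x` turns integrability against test functions into local
    -- integrability of `F`.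
    let b : ContDiffBump x := ⟨1, 2, one_pos, one_lt_two⟩
    obtain ⟨φ, hφ⟩ := hs b b.contDiff b.hasCompactSupport
    refine ⟨Metric.closedBall x 1, Metric.closedBall_mem_nhds x one_pos, ?_⟩
    refine ((h φ).1.integrableOn (s := Metric.closedBall x 1)).congr_fun (fun q hq => ?_)
      Metric.isClosed_closedBall.measurableSet
    simp only [hφ, b.one_of_mem_closedBall hq, Complex.ofReal_one, mul_one]
  refine ae_eq_zero_of_integral_contDiff_smul_eq_zero hloc fun g hg hc => ?_
  obtain ⟨φ, hφ⟩ := hs g hg hc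
  rw [← (h φ).2]
  refine integral_congr_ae (ae_of_all _ fun q => ?_)
  simp only [hφ, Complex.real_smul, mul_comm]

/-- Uniqueness of the Fourier transform. -/
theorem HasSpacetimeFourier.unique {u U U' : Spacetime d → ℂ} (h : HasSpacetimeFourier u U)
    (h' : HasSpacetimeFourier u U') : U =ᵐ[volume] U' := by
  have : (fun q => U q - U' q) =ᵐ[volume] 0 := by
    refine ae_eq_zero_of_forall_schwartz fun φ => ?_
    obtain ⟨-, h1, h2⟩ := h φ
    obtain ⟨-, h1', h2'⟩ := h' φ
    simp only [sub_mul]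
    exact ⟨h1.sub h1', by rw [integral_sub h1 h1', ← h2, ← h2', sub_self]⟩
  filter_upwards [this] with q hq
  exact sub_eq_zero.1 hq

/-- Injectivity of the Fourier transform. -/
theorem HasSpacetimeFourier.injective {u u' U U' : Spacetime d → ℂ} (h : HasSpacetimeFourier u U)
    (h' : HasSpacetimeFourier u' U') (hU : U =ᵐ[volume] U') : u =ᵐ[volume] u' := by
  have : (fun q => u q - u' q) =ᵐ[volume] 0 := by
    refine ae_eq_zero_of_forall_schwartz fun ψ => ?_
    obtain ⟨φ, rfl⟩ := schwartzFourier_surjective ψ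
    obtain ⟨h1, -, h2⟩ := h φ
    obtain ⟨h1', -, h2'⟩ := h' φ
    simp only [← spacetimeFourier_eq, sub_mul]
    refine ⟨h1.sub h1', ?_⟩
    rw [integral_sub h1 h1', h2, h2', sub_eq_zero]
    refine integral_congr_ae ?_
    filter_upwards [hU] with q hq
    rw [hq]
  filter_upwards [this] with q hq
  exact sub_eq_zero.1 hq

/-- Plancherel's theorem in space-time. -/
theorem HasSpacetimeFourier.plancherel {V G : Spacetime d → ℂ} (h : HasSpacetimeFourier V G)
    (hG : MemLp G 2) : MemLp V 2 ∧ ENNReal.ofReal ((2 * Real.pi) ^ (d + 1)) *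
      eLpNorm V 2 volume ^ 2 = eLpNorm G 2 volume ^ 2 := by
  obtain ⟨V', hV', hF, hn⟩ := exists_hasSpacetimeFourier hG
  have he := h.injective hF (ae_eq_refl G)
  exact ⟨(memLp_congr_ae he).2 hV', by rw [eLpNorm_congr_ae he, hn]⟩

theorem HasSpacetimeFourier.sub {u u' U U' : Spacetime d → ℂ} (h : HasSpacetimeFourier u U)
    (h' : HasSpacetimeFourier u' U') : HasSpacetimeFourier (u - u') (U - U') := by
  intro φ
  obtain ⟨h1, h2, h3⟩ := h φ
  obtain ⟨h1', h2', h3'⟩ := h' φ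
  simp only [Pi.sub_apply, sub_mul]
  exact ⟨h1.sub h1', h2.sub h2', by rw [integral_sub h1 h1', integral_sub h2 h2', h3, h3']⟩

end

/-! ### Energy and Fourier transform of a product in light-cone coordinates -/

/-- Light-cone coordinates of a space-time frequency. -/
def toLC (q : Spacetime (n + 1)) : LightCone n := (q.1 - q.2 0, q.1 + q.2 0, tail q.2)

/-- The space-time frequency with given light-cone coordinates. -/
def ofLC (q : LightCone n) : Spacetime (n + 1) :=
  ((q.1 + q.2.1) / 2, join ((q.2.1 - q.1) / 2, q.2.2))

@[simp] lemma ofLC_toLC (q : Spacetime (n + 1)) : ofLC (toLC q) = q := by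
  have h1 : (q.1 - q.2 0 + (q.1 + q.2 0)) / 2 = q.1 := by ring
  have h2 : (q.1 + q.2 0 - (q.1 - q.2 0)) / 2 = q.2 0 := by ring
  simp only [ofLC, toLC, h1, h2, join_tail]

@[fun_prop] lemma measurable_toLC : Measurable (toLC (n := n)) := by unfold toLC; fun_prop

@[fun_prop] lemma measurable_ofLC : Measurable (ofLC (n := n)) := by unfold ofLC; fun_prop

lemma boxQ_toLC (q : Spacetime (n + 1)) : boxQ (toLC q) = ‖q.2‖ ^ 2 - q.1 ^ 2 := by
  have h := norm_join_sq (q.2 0, tail q.2)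
  rw [join_tail] at h
  simp only [boxQ, toLC, h]
  ring

/-- The map `(τ, ζ₀) ↦ (τ - ζ₀, τ + ζ₀)` has determinant two; it is handled as two translations and
a dilation in one variable at a time. -/
lemma lintegral_toLC {H : LightCone n → ℝ≥0∞} (hH : Measurable H) :
    ∫⁻ q, H (toLC q) = ENNReal.ofReal (1 / 2) * ∫⁻ m, H m := by
  have h1 : ∫⁻ q, H (toLC q) = ∫⁻ x : Space n, ∫⁻ t : ℝ, ∫⁻ s : ℝ, H (t - s, t + s, x) := by
    rw [Measure.volume_eq_prod, lintegral_prod _ (Measurable.aemeasurable (by fun_prop)),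
      lintegral_lintegral_swap (f := fun (x : Space n) (t : ℝ) => ∫⁻ s : ℝ, H (t - s, t + s, x))
        (Measurable.aemeasurable (by fun_prop))]
    refine lintegral_congr fun t => ?_
    rw [← measurePreserving_join.lintegral_comp (by fun_prop), Measure.volume_eq_prod,
      lintegral_prod_symm _ (Measurable.aemeasurable (by fun_prop))]
    simp [toLC]
  have h2 : ∫⁻ m, H m = ∫⁻ x : Space n, ∫⁻ s : ℝ, ∫⁻ t : ℝ, H (t, s, x) := by
    rw [Measure.volume_eq_prod, lintegral_prod _ (Measurable.aemeasurable (by fun_prop)),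
      lintegral_lintegral_swap (Measurable.aemeasurable (by fun_prop)), Measure.volume_eq_prod,
      lintegral_prod_symm _ (Measurable.aemeasurable (by fun_prop))]
  rw [h1, h2, ← lintegral_const_mul' _ _ ENNReal.ofReal_ne_top]
  refine lintegral_congr fun x => ?_
  rw [lintegral_lintegral_swap (f := fun t s : ℝ => H (t - s, t + s, x))
      (Measurable.aemeasurable (by fun_prop)),
    lintegral_lintegral_swap (f := fun s t : ℝ => H (t, s, x))
      (Measurable.aemeasurable (by fun_prop))]
  have h3 : ∀ s : ℝ, ∫⁻ t : ℝ, H (t - s, t + s, x) = ∫⁻ t : ℝ, H (t, t + 2 * s, x) := by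
    intro s
    rw [← lintegral_add_right_eq_self _ s]
    refine lintegral_congr fun t => ?_
    congr 2
    · ring
    · congr 1; ring
  simp_rw [h3]
  rw [lintegral_lintegral_swap (Measurable.aemeasurable (by fun_prop)),
    ← lintegral_const_mul' _ _ ENNReal.ofReal_ne_top]
  refine lintegral_congr fun t => ?_
  have h4 := Real.smul_map_volume_mul_left (two_ne_zero (α := ℝ))
  have h5 : ∫⁻ s : ℝ, H (t, t + 2 * s, x) = ∫⁻ s, H (t, t + s, x) ∂(Measure.map (2 * ·) volume) := by
    rw [lintegral_map (by fun_prop) (by fun_prop)]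
  rw [h5, Real.map_volume_mul_left two_ne_zero, lintegral_smul_measure, smul_eq_mul,
    abs_of_pos (by norm_num), lintegral_add_left_eq_self (fun s => H (t, s, x)) t, one_div]

lemma map_toLC : Measure.map (toLC (n := n)) volume = ENNReal.ofReal (1 / 2) • volume := by
  refine Measure.ext_of_lintegral _ fun H hH => ?_
  rw [lintegral_map hH (by fun_prop), lintegral_toLC hH, lintegral_smul_measure, smul_eq_mul]

/-- A datum, multiplied by `|ξ|`, in light-cone coordinates. -/
def lift (f : Space (n + 1) → ℂ) (y : Cone n) : ℂ := (‖pt y.1 y.2‖ : ℂ) * f (pt y.1 y.2)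

@[fun_prop] lemma measurable_lift {f : Space (n + 1) → ℂ} (hf : Measurable f) :
    Measurable (lift f) := by unfold lift; fun_prop

lemma rpow_factor {N K : ℝ} (hN : 0 < N) (hK : 0 ≤ K) (γ : ℝ) :
    N ^ (γ + 1) * (K / N) ^ γ = N * K ^ γ := by
  rw [Real.div_rpow hK hN.le, Real.rpow_add hN, Real.rpow_one]
  have := Real.rpow_pos_of_pos hN γ
  field_simp

/-- With `K = |y||z| - y·z` and `γ` the exponent of the angular factor, `(|y||z|)^{γ+1}
(K/(|y||z|))^γ = |y||z| K^γ`. One more factor `|y||z|` comes from `dy = u^{n-1} |y| du dv`; together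
they make up the squares of the factors in `lift`. The power of two comes from `K = u₁ u₂ |v₁ - v₂|²
/ 2`. -/
lemma energy_eq (hn : 1 ≤ n) {β : ℝ} {f g : Space (n + 1) → ℂ} (hf : Measurable f)
    (hg : Measurable g) :
    energy β f g = ENNReal.ofReal (2 ^ (-((n : ℝ) / 2 - 1 + 2 * β))) *
      coneEnergy β (lift f) (lift g) := by
  rw [energy, coneEnergy, Measure.volume_eq_prod,
    lintegral_prod _ (Measurable.aemeasurable (by fun_prop)),
    lintegral_pt_cone hn (by fun_prop), ← lintegral_const_mul' _ _ ENNReal.ofReal_ne_top]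
  refine lintegral_congr_ae ?_
  filter_upwards [ae_coneMeasure_pos] with y hy
  rw [← lintegral_const_mul' _ _ ENNReal.ofReal_ne_top, lintegral_pt_cone hn (by fun_prop),
    ← lintegral_const_mul' _ _ ENNReal.ofReal_ne_top]
  refine lintegral_congr_ae ?_
  filter_upwards [ae_coneMeasure_pos] with z hz
  have hy' : 0 < ‖pt y.1 y.2‖ := by rw [norm_pt hy.le]; positivity
  have hz' : 0 < ‖pt z.1 z.2‖ := by rw [norm_pt hz.le]; positivity
  have hK : 1 - inner ℝ (‖pt y.1 y.2‖⁻¹ • pt y.1 y.2) (‖pt z.1 z.2‖⁻¹ • pt z.1 z.2) =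
      (y.1 * z.1 * ‖y.2 - z.2‖ ^ 2 / 2) / (‖pt y.1 y.2‖ * ‖pt z.1 z.2‖) := by
    rw [← norm_mul_norm_sub_inner_pt hy.le hz.le, inner_smul_left, inner_smul_right, conj_trivial]
    field_simp
  have he : ∀ x : ℂ, ‖x‖ₑ ^ 2 = ENNReal.ofReal (‖x‖ ^ 2) := fun x => by
    rw [ENNReal.ofReal_pow (norm_nonneg _), ofReal_norm]
  rw [hK, he, he, ← ENNReal.ofReal_mul (by positivity), ← ENNReal.ofReal_mul (by positivity),
    ← ENNReal.ofReal_mul (by positivity), ← ENNReal.ofReal_mul (by positivity),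
    ← ENNReal.ofReal_mul (by positivity)]
  congr 1
  simp only [lift, norm_mul, Complex.norm_real, norm_norm, coneWeight]
  have h1 := rpow_factor (N := ‖pt y.1 y.2‖ * ‖pt z.1 z.2‖)
    (K := y.1 * z.1 * ‖y.2 - z.2‖ ^ 2 / 2) (by positivity) (by positivity)
    ((n : ℝ) / 2 - 1 + 2 * β)
  have e1 : (((n + 1 : ℕ) : ℝ) - 1) / 2 + 2 * β = (n : ℝ) / 2 - 1 + 2 * β + 1 := by
    push_cast; ring
  have e2 : (((n + 1 : ℕ) : ℝ) - 3) / 2 + 2 * β = (n : ℝ) / 2 - 1 + 2 * β := by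
    push_cast; ring
  rw [e1, e2, mul_assoc _ (_ ^ (_ + 1)), h1, Real.div_rpow (by positivity) zero_le_two,
    Real.rpow_neg zero_le_two]
  have hpy : ∀ {u : ℝ}, 0 < u → u ^ n = u * u ^ ((n : ℝ) - 1) := by
    intro u hu
    rw [← Real.rpow_natCast, Real.rpow_sub hu, Real.rpow_one]
    field_simp
  have hny := norm_pt hy.le y.2
  have hnz := norm_pt hz.le z.2
  have e3 : y.1 ^ n * ((‖y.2‖ ^ 2 + 1) / 2) = y.1 ^ ((n : ℝ) - 1) * ‖pt y.1 y.2‖ := by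
    rw [hpy hy, hny]; ring
  have e4 : z.1 ^ n * ((‖z.2‖ ^ 2 + 1) / 2) = z.1 ^ ((n : ℝ) - 1) * ‖pt z.1 z.2‖ := by
    rw [hpy hz, hnz]; ring
  rw [e3, e4]
  ring

/-- Disintegration of pairs of null vectors over their difference. -/
theorem lintegral_fibre (hn : 1 ≤ n) {G : LightCone n × Cone n × Cone n → ℝ≥0∞}
    (hG : Measurable G) :
    ∫⁻ q : LightCone n, ∫⁻ v, ENNReal.ofReal (fibre q v) * G (q, coneFst q v, coneSnd q v) =
    ∫⁻ y, ∫⁻ z, ENNReal.ofReal (y.1 ^ ((n : ℝ) - 1) * z.1 ^ ((n : ℝ) - 1)) *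
      G (coneDiff y z, y, z) ∂coneMeasure n ∂coneMeasure n := by
  have h := lintegral_coneDom hn (G := fun p => ENNReal.ofReal (recoil p.1 p.2 ^ n / boxQ p.1) *
    G (p.1, coneFst p.1 p.2, coneSnd p.1 p.2)) (by fun_prop)
  have hl : ∀ (q : LightCone n) v, (coneDom n).indicator (fun p =>
      ENNReal.ofReal (recoil p.1 p.2 ^ n / boxQ p.1) *
        G (p.1, coneFst p.1 p.2, coneSnd p.1 p.2)) (q, v) =
      ENNReal.ofReal (fibre q v) * G (q, coneFst q v, coneSnd q v) := by
    intro q v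
    by_cases h : (q, v) ∈ coneDom n <;> simp [fibre, h]
  simp_rw [hl] at h
  rw [h]
  refine lintegral_congr_ae ?_
  filter_upwards [ae_coneMeasure_pos] with y hy
  refine lintegral_congr_ae ?_
  filter_upwards [ae_coneMeasure_pos, ae_cone_snd_ne hn y.2] with z hz hyz
  have hd : 0 < ‖y.2 - z.2‖ := norm_pos_iff.2 (sub_ne_zero.2 hyz)
  rw [coneFst_coneDiff hy hyz, coneSnd_coneDiff hy hyz, recoil_coneDiff hy hyz, boxQ_coneDiff,
    ← mul_assoc, ← ENNReal.ofReal_mul (by positivity)]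
  congr 2
  rw [Real.rpow_sub hy, Real.rpow_sub hz, Real.rpow_one, Real.rpow_one, Real.rpow_natCast,
    Real.rpow_natCast]
  field_simp

/-- The pair of frequencies determined by their difference and a direction. -/
def pairPt (p : LightCone n × Space n) : Space (n + 1) × Space (n + 1) :=
  (pt (coneFst p.1 p.2).1 (coneFst p.1 p.2).2, pt (coneSnd p.1 p.2).1 (coneSnd p.1 p.2).2)

@[fun_prop] lemma measurable_pairPt : Measurable (pairPt (n := n)) := by unfold pairPt; fun_prop

/-- The density of the measure `dξ dη` in the coordinates `pairPt`. -/
def pairDensity (p : LightCone n × Space n) : ℝ :=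
  fibre p.1 p.2 * (‖(pairPt p).1‖ * ‖(pairPt p).2‖)

@[fun_prop] lemma measurable_pairDensity : Measurable (pairDensity (n := n)) := by
  unfold pairDensity; fun_prop

lemma pairDensity_nonneg (p : LightCone n × Space n) : 0 ≤ pairDensity p :=
  mul_nonneg (fibre_nonneg _ _) (by positivity)

/-- The space-time frequency of the product of the waves of frequencies `ξ` and `η`. -/
def freqDiff (p : Space (n + 1) × Space (n + 1)) : Spacetime (n + 1) := (‖p.1‖ - ‖p.2‖, p.1 - p.2)

lemma join_sub (a b : ℝ × Space n) : join a - join b = join (a - b) := by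
  ext i
  refine Fin.cases ?_ (fun j => ?_) i <;> simp [join]

lemma freqDiff_pt {y z : Cone n} (hy : 0 < y.1) (hz : 0 < z.1) :
    freqDiff (pt y.1 y.2, pt z.1 z.2) = ofLC (coneDiff y z) := by
  rw [freqDiff, ofLC, norm_pt hy.le, norm_pt hz.le, pt, pt, join_sub, coneDiff, Prod.mk_sub_mk]
  congr 1
  · ring
  · congr 2; ring

lemma lintegral_pairPt (hn : 1 ≤ n) {H : Space (n + 1) × Space (n + 1) → ℝ≥0∞}
    (hH : Measurable H) :
    ∫⁻ p, H p = ∫⁻ p : LightCone n × Space n, ENNReal.ofReal (pairDensity p) * H (pairPt p) := by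
  rw [Measure.volume_eq_prod, lintegral_prod _ (Measurable.aemeasurable (by fun_prop)),
    Measure.volume_eq_prod, lintegral_prod _ (Measurable.aemeasurable (by fun_prop)),
    lintegral_pt_cone hn (by fun_prop)]
  have h := lintegral_fibre hn (G := fun p => ENNReal.ofReal
    (‖pt p.2.1.1 p.2.1.2‖ * ‖pt p.2.2.1 p.2.2.2‖) * H (pt p.2.1.1 p.2.1.2, pt p.2.2.1 p.2.2.2))
    (by fun_prop)
  have hl : ∀ (q : LightCone n) v, ENNReal.ofReal (pairDensity (q, v)) * H (pairPt (q, v)) =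
      ENNReal.ofReal (fibre q v) * (ENNReal.ofReal
        (‖pt (coneFst q v).1 (coneFst q v).2‖ * ‖pt (coneSnd q v).1 (coneSnd q v).2‖) *
        H (pt (coneFst q v).1 (coneFst q v).2, pt (coneSnd q v).1 (coneSnd q v).2)) := by
    intro q v
    rw [pairDensity, ENNReal.ofReal_mul (fibre_nonneg _ _), mul_assoc]
    rfl
  simp_rw [hl, h]
  refine lintegral_congr_ae ?_
  filter_upwards [ae_coneMeasure_pos] with y hy
  rw [lintegral_pt_cone hn (by fun_prop), ← lintegral_const_mul' _ _ ENNReal.ofReal_ne_top]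
  refine lintegral_congr_ae ?_
  filter_upwards [ae_coneMeasure_pos] with z hz
  rw [← mul_assoc, ← mul_assoc, ← ENNReal.ofReal_mul (by positivity),
    ← ENNReal.ofReal_mul (by positivity)]
  congr 2
  rw [norm_pt hy.le, norm_pt hz.le, Real.rpow_sub hy, Real.rpow_sub hz, Real.rpow_one,
    Real.rpow_one, Real.rpow_natCast, Real.rpow_natCast]
  field_simp

/-- The measure `dξ dη` in the coordinates `pairPt`. -/
def pairMeasure (n : ℕ) : Measure (LightCone n × Space n) :=
  volume.withDensity fun p => ENNReal.ofReal (pairDensity p)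

lemma measurePreserving_pairPt (hn : 1 ≤ n) :
    MeasurePreserving (pairPt (n := n)) (pairMeasure n) volume := by
  refine ⟨by fun_prop, Measure.ext_of_lintegral _ fun H hH => ?_⟩
  rw [lintegral_map hH (by fun_prop), pairMeasure,
    lintegral_withDensity_eq_lintegral_mul _ (by fun_prop) (by fun_prop), lintegral_pairPt hn hH]
  rfl

/-- The identity may fail where a component is not positive. The integral of the indicator of the
failure set is carried by `lintegral_fibre` to pairs of genuine points of the cone, where
`freqDiff_pt` applies. -/
lemma ae_freqDiff_pairPt (hn : 1 ≤ n) :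
    ∀ᵐ p ∂pairMeasure n, freqDiff (pairPt p) = ofLC p.1 := by
  have hm : Measurable (freqDiff (n := n)) := by unfold freqDiff; fun_prop
  have hT : MeasurableSet {p : LightCone n × Cone n × Cone n |
      freqDiff (pt p.2.1.1 p.2.1.2, pt p.2.2.1 p.2.2.2) = ofLC p.1} :=
    measurableSet_eq_fun (by fun_prop) (by fun_prop)
  obtain ⟨J, hJ⟩ : ∃ J : LightCone n × Cone n × Cone n → ℝ≥0∞, J =
    {p : LightCone n × Cone n × Cone n |
      freqDiff (pt p.2.1.1 p.2.1.2, pt p.2.2.1 p.2.2.2) = ofLC p.1}ᶜ.indicator 1 := ⟨_, rfl⟩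
  have hJm : Measurable J := hJ ▸ measurable_one.indicator hT.compl
  have h := lintegral_fibre hn hJm
  have hr : ∫⁻ y, ∫⁻ z, ENNReal.ofReal (y.1 ^ ((n : ℝ) - 1) * z.1 ^ ((n : ℝ) - 1)) *
      J (coneDiff y z, y, z) ∂coneMeasure n ∂coneMeasure n = (0 : ℝ≥0∞) := by
    rw [← lintegral_zero (μ := coneMeasure n)]
    refine lintegral_congr_ae ?_
    filter_upwards [ae_coneMeasure_pos] with y hy
    rw [← lintegral_zero (μ := coneMeasure n)]
    refine lintegral_congr_ae ?_
    filter_upwards [ae_coneMeasure_pos] with z hz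
    rw [hJ, indicator_of_notMem, mul_zero]
    simpa using freqDiff_pt hy hz
  rw [hr, ← lintegral_prod (μ := volume) (ν := volume)
    (fun p : LightCone n × Space n => ENNReal.ofReal (fibre p.1 p.2) *
      J (p.1, coneFst p.1 p.2, coneSnd p.1 p.2)) (Measurable.aemeasurable (by fun_prop)),
    lintegral_eq_zero_iff (by fun_prop)] at h
  rw [pairMeasure, ae_withDensity_iff (by fun_prop)]
  filter_upwards [h] with p hp hd
  by_contra hne
  have h1 : ENNReal.ofReal (fibre p.1 p.2) ≠ 0 := by
    intro h0
    apply hd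
    rw [pairDensity, ENNReal.ofReal_mul (fibre_nonneg _ _), h0, zero_mul]
  refine (mul_ne_zero h1 ?_) hp
  rw [hJ, indicator_of_mem]
  · simp
  · exact hne

lemma integral_pairMeasure (F : LightCone n × Space n → ℂ) :
    ∫ p, F p ∂pairMeasure n = ∫ p, (pairDensity p : ℂ) * F p := by
  rw [pairMeasure, integral_withDensity_eq_integral_toReal_smul (by fun_prop)
    (ae_of_all _ fun _ => ENNReal.ofReal_lt_top)]
  refine integral_congr_ae (ae_of_all _ fun p => ?_)
  simp only [ENNReal.toReal_ofReal (pairDensity_nonneg p), Complex.real_smul]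

lemma integrable_pairMeasure_iff (F : LightCone n × Space n → ℂ) :
    Integrable F (pairMeasure n) ↔ Integrable fun p => (pairDensity p : ℂ) * F p := by
  rw [pairMeasure, integrable_withDensity_iff_integrable_smul' (by fun_prop)
    (ae_of_all _ fun _ => ENNReal.ofReal_lt_top)]
  refine integrable_congr (ae_of_all _ fun p => ?_)
  simp only [ENNReal.toReal_ofReal (pairDensity_nonneg p), Complex.real_smul]

lemma bilin_lift_eq (f g : Space (n + 1) → ℂ) (q : LightCone n) :
    bilin (lift f) (lift g) q = ∫ v, (pairDensity (q, v) : ℂ) *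
      (f (pairPt (q, v)).1 * starRingEnd ℂ (g (pairPt (q, v)).2)) := by
  refine integral_congr_ae (ae_of_all _ fun v => ?_)
  simp only [lift, pairDensity, pairPt, map_mul, Complex.conj_ofReal]
  push_cast
  ring

lemma integrable_mul_conj_prod {f g : Space (n + 1) → ℂ} (hf : Integrable f) (hg : Integrable g)
    {χ : Spacetime (n + 1) → ℂ} (hχ : Continuous χ) {C : ℝ} (hC : ∀ q, ‖χ q‖ ≤ C) :
    Integrable (fun p : Space (n + 1) × Space (n + 1) =>
      f p.1 * starRingEnd ℂ (g p.2) * χ (freqDiff p)) := by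
  have hg' : Integrable fun x => starRingEnd ℂ (g x) :=
    (Complex.conjCLE.integrable_comp_iff (φ := g)).2 hg
  have hfg : Integrable fun p : Space (n + 1) × Space (n + 1) => f p.1 * starRingEnd ℂ (g p.2) := by
    rw [Measure.volume_eq_prod]; exact hf.mul_prod hg'
  have hfc : Continuous (freqDiff (n := n)) := by unfold freqDiff; fun_prop
  exact hfg.mul_bdd (c := C) (hχ.comp hfc).aestronglyMeasurable (ae_of_all _ fun p => hC _)

lemma integral_comp_pairPt (hn : 1 ≤ n) {F : Space (n + 1) × Space (n + 1) → ℂ}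
    (hF : Integrable F) : Integrable (fun p => F (pairPt p)) (pairMeasure n) ∧
      ∫ p, F p = ∫ p, F (pairPt p) ∂pairMeasure n := by
  have hmp := measurePreserving_pairPt hn
  refine ⟨hmp.integrable_comp_of_integrable hF, ?_⟩
  have := hF.aestronglyMeasurable
  rw [← hmp.map_eq] at this ⊢
  rw [integral_map (by fun_prop) this]

/-- The density of the image of `f̂(ξ) conj(ĝ(η)) dξ dη` under the frequency difference. -/
theorem integral_freqDiff (hn : 1 ≤ n) {f g : Space (n + 1) → ℂ} (hf : Integrable f)
    (hg : Integrable g) {χ : Spacetime (n + 1) → ℂ} (hχ : Continuous χ) {C : ℝ}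
    (hC : ∀ q, ‖χ q‖ ≤ C) :
    Integrable (fun q => bilin (lift f) (lift g) q * χ (ofLC q)) ∧
    ∫ p : Space (n + 1) × Space (n + 1), f p.1 * starRingEnd ℂ (g p.2) * χ (freqDiff p) =
      ∫ q, bilin (lift f) (lift g) q * χ (ofLC q) := by
  have hInt := integrable_mul_conj_prod hf hg hχ hC
  obtain ⟨h2, h2'⟩ := integral_comp_pairPt hn hInt
  have he : (fun p => f (pairPt p).1 * starRingEnd ℂ (g (pairPt p).2) *
      χ (freqDiff (pairPt p))) =ᵐ[pairMeasure n] fun p => f (pairPt p).1 *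
        starRingEnd ℂ (g (pairPt p).2) * χ (ofLC p.1) := by
    filter_upwards [ae_freqDiff_pairPt hn] with p hp
    rw [hp]
  have h3 := h2.congr he
  rw [integrable_pairMeasure_iff, Measure.volume_eq_prod] at h3
  have h4 : (fun q : LightCone n => bilin (lift f) (lift g) q * χ (ofLC q)) = fun q =>
      ∫ v, (pairDensity (q, v) : ℂ) * (f (pairPt (q, v)).1 * starRingEnd ℂ (g (pairPt (q, v)).2) *
        χ (ofLC q)) := by
    funext q
    rw [bilin_lift_eq, ← integral_mul_const]
    refine integral_congr_ae (ae_of_all _ fun v => ?_)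
    ring
  rw [h4]
  refine ⟨h3.integral_prod_left, ?_⟩
  rw [h2', integral_congr_ae he, integral_pairMeasure,
    Measure.volume_eq_prod, integral_prod _ h3]

/-- The character `e^{i(tτ + x·ξ)}`. -/
def charFn {d : ℕ} (p q : Spacetime d) : ℂ :=
  Complex.exp (Complex.I * ((p.1 * q.1 + inner ℝ p.2 q.2 : ℝ) : ℂ))

lemma norm_charFn {d : ℕ} (p q : Spacetime d) : ‖charFn p q‖ = 1 := by
  rw [charFn, mul_comm, Complex.norm_exp_ofReal_mul_I]

lemma continuous_charFn {d : ℕ} : Continuous fun r : Spacetime d × Spacetime d =>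
    charFn r.1 r.2 := by unfold charFn; fun_prop

lemma continuous_freqDiff : Continuous (freqDiff (n := n)) := by unfold freqDiff; fun_prop

lemma waveProduct_eq (f g : Space (n + 1) → ℂ) (p : Spacetime (n + 1)) :
    waveProduct f g p = (((((2 * Real.pi) ^ (n + 1))⁻¹) ^ 2 : ℝ) : ℂ) *
      ∫ x : Space (n + 1) × Space (n + 1), f x.1 * starRingEnd ℂ (g x.2) *
        charFn p (freqDiff x) := by
  have h : (fun x : Space (n + 1) × Space (n + 1) => f x.1 * starRingEnd ℂ (g x.2) *
      charFn p (freqDiff x)) = fun x =>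
      (Complex.exp (Complex.I * ((inner ℝ p.2 x.1 + p.1 * ‖x.1‖ : ℝ) : ℂ)) * f x.1) *
      starRingEnd ℂ (Complex.exp (Complex.I * ((inner ℝ p.2 x.2 + p.1 * ‖x.2‖ : ℝ) : ℂ)) *
        g x.2) := by
    funext x
    have : charFn p (freqDiff x) =
        Complex.exp (Complex.I * ((inner ℝ p.2 x.1 + p.1 * ‖x.1‖ : ℝ) : ℂ)) *
        starRingEnd ℂ (Complex.exp (Complex.I * ((inner ℝ p.2 x.2 + p.1 * ‖x.2‖ : ℝ) : ℂ))) := by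
      rw [← Complex.exp_conj, ← Complex.exp_add, charFn, freqDiff, inner_sub_right]
      congr 1
      simp only [map_mul, Complex.conj_I, Complex.conj_ofReal]
      push_cast
      ring
    rw [this, map_mul]
    ring
  rw [h, Measure.volume_eq_prod, integral_prod_mul
    (fun x => Complex.exp (Complex.I * ((inner ℝ p.2 x + p.1 * ‖x‖ : ℝ) : ℂ)) * f x)
    (fun x => starRingEnd ℂ (Complex.exp (Complex.I * ((inner ℝ p.2 x + p.1 * ‖x‖ : ℝ) : ℂ)) *
        g x)), integral_conj, waveProduct, halfWave, halfWave, map_mul, map_inv₀,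
    Complex.conj_ofReal]
  push_cast
  ring

/-- The constant in the Fourier transform of a product of waves. -/
def amp (d : ℕ) : ℝ := (((2 * Real.pi) ^ d)⁻¹) ^ 2 * (2 * Real.pi) ^ (d + 1) * 2

/-- The Fourier transform of the product of two waves. -/
def prodFourier (f g : Space (n + 1) → ℂ) (q : Spacetime (n + 1)) : ℂ :=
  (amp (n + 1) : ℂ) * bilin (lift f) (lift g) (toLC q)

lemma integral_comp_toLC {F : LightCone n → ℂ} (hF : Integrable F) :
    Integrable (fun q => F (toLC q)) ∧ ∫ q, F (toLC q) = (1 / 2 : ℂ) * ∫ m, F m := by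
  have h1 : Integrable F (Measure.map (toLC (n := n)) volume) := by
    rw [map_toLC]; exact hF.smul_measure ENNReal.ofReal_ne_top
  refine ⟨h1.comp_aemeasurable (by fun_prop), ?_⟩
  rw [← integral_map (Measurable.aemeasurable (by fun_prop)) h1.aestronglyMeasurable, map_toLC,
    integral_smul_measure, ENNReal.toReal_ofReal (by norm_num), Complex.real_smul]
  norm_num

/-- By Fubini and Fourier inversion, pairing with a test function becomes integration of that
function against the image of `f̂(ξ) conj(ĝ(η)) dξ dη` under the frequency difference, which has
density `bilin`. In `amp` the powers of `2π` come from the two half-waves and from inversion, and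
the last factor two from the Jacobian of `toLC`. -/
theorem hasSpacetimeFourier_waveProduct (hn : 1 ≤ n) {f g : Space (n + 1) → ℂ}
    (hf : Integrable f) (hg : Integrable g) :
    HasSpacetimeFourier (waveProduct f g) (prodFourier f g) := by
  intro φ
  obtain ⟨C, hC⟩ : ∃ C, ∀ q, ‖φ q‖ ≤ C := by
    obtain ⟨C, hC⟩ := φ.decay 0 0
    exact ⟨C, fun q => by simpa using hC.2 q⟩
  obtain ⟨h1, h2⟩ := integral_freqDiff hn hf hg φ.continuous hC
  have hprod : Integrable fun x : Space (n + 1) × Space (n + 1) =>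
      f x.1 * starRingEnd ℂ (g x.2) := by
    simpa using integrable_mul_conj_prod hf hg (χ := fun _ => 1) continuous_const (C := 1) (by simp)
  have hφ : Integrable (spacetimeFourier φ) := by
    rw [spacetimeFourier_eq]; exact (schwartzFourier φ).integrable
  have hF : Integrable (fun r : Spacetime (n + 1) × (Space (n + 1) × Space (n + 1)) =>
      (spacetimeFourier φ r.1 * (f r.2.1 * starRingEnd ℂ (g r.2.2))) * charFn r.1 (freqDiff r.2))
      (volume.prod volume) := by
    refine (hφ.mul_prod hprod).mul_bdd (c := 1) ?_ (ae_of_all _ fun r => (norm_charFn _ _).le)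
    exact (continuous_charFn.comp (continuous_fst.prodMk
      (continuous_freqDiff.comp continuous_snd))).aestronglyMeasurable
  have hu : (fun p => waveProduct f g p * spacetimeFourier φ p) = fun p =>
      (((((2 * Real.pi) ^ (n + 1))⁻¹) ^ 2 : ℝ) : ℂ) *
        ∫ x : Space (n + 1) × Space (n + 1),
          (spacetimeFourier φ p * (f x.1 * starRingEnd ℂ (g x.2))) * charFn p (freqDiff x) := by
    funext p
    rw [waveProduct_eq, mul_assoc, mul_comm (integral _ _), ← integral_const_mul]
    simp only [mul_assoc]
  have hbil := integral_comp_toLC h1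
  simp only [ofLC_toLC] at hbil
  refine ⟨?_, ?_, ?_⟩
  · rw [hu]
    exact hF.integral_prod_left.const_mul _
  · simpa only [prodFourier, mul_assoc] using hbil.1.const_mul _
  · rw [hu, integral_const_mul, integral_integral_swap hF]
    have hin : ∀ x : Space (n + 1) × Space (n + 1), ∫ p, (spacetimeFourier φ p *
        (f x.1 * starRingEnd ℂ (g x.2))) * charFn p (freqDiff x) =
        (((2 * Real.pi) ^ (n + 1 + 1) : ℝ) : ℂ) *
          (f x.1 * starRingEnd ℂ (g x.2) * φ (freqDiff x)) := by
      intro x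
      have := integral_exp_mul_spacetimeFourier φ (freqDiff x)
      rw [mul_left_comm, ← this, ← integral_const_mul]
      refine integral_congr_ae (ae_of_all _ fun p => ?_)
      simp only [charFn]
      ring
    simp_rw [hin, prodFourier, mul_assoc]
    rw [integral_const_mul, integral_const_mul, hbil.2]
    simp only [← mul_assoc]
    rw [h2, amp]
    push_cast
    ring

/-! ### Square integrability and convergence on the Fourier side -/

lemma sq_eLpNorm_two {α E : Type*} [MeasurableSpace α] [NormedAddCommGroup E] (μ : Measure α)
    (f : α → E) : eLpNorm f 2 μ ^ 2 = ∫⁻ x, ‖f x‖ₑ ^ 2 ∂μ := by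
  simpa using eLpNorm_nnreal_pow_eq_lintegral (μ := μ) (f := f) (p := 2) two_ne_zero

lemma sq_lintegral_mul_le {α : Type*} [MeasurableSpace α] (μ : Measure α) {f g : α → ℝ≥0∞}
    (hf : AEMeasurable f μ) (hg : AEMeasurable g μ) :
    (∫⁻ a, f a * g a ∂μ) ^ 2 ≤ (∫⁻ a, f a ^ 2 ∂μ) * ∫⁻ a, g a ^ 2 ∂μ := by
  have h := ENNReal.lintegral_mul_le_Lp_mul_Lq μ Real.HolderConjugate.two_two hf hg
  have h2 := pow_le_pow_left' h 2
  have e : ∀ x : ℝ≥0∞, (x ^ (1 / 2 : ℝ)) ^ 2 = x := fun x => by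
    rw [← ENNReal.rpow_natCast, ← ENNReal.rpow_mul]; norm_num
  rw [mul_pow, e, e] at h2
  simpa using h2

/-- The Fourier transform of `|□|^β` applied to the product of two waves. -/
def boxFourier (β : ℝ) (f g : Space (n + 1) → ℂ) (q : Spacetime (n + 1)) : ℂ :=
  ((|q.1 ^ 2 - ‖q.2‖ ^ 2| ^ β : ℝ) : ℂ) * prodFourier f g q

@[fun_prop] lemma measurable_boxFourier {β : ℝ} {f g : Space (n + 1) → ℂ} (hf : Measurable f)
    (hg : Measurable g) : Measurable (boxFourier β f g) := by
  have := measurable_bilin (measurable_lift hf) (measurable_lift hg)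
  unfold boxFourier prodFourier
  fun_prop

lemma fibre_eq_zero {q : LightCone n} (h : boxQ q ≤ 0) (v : Space n) : fibre q v = 0 :=
  indicator_of_notMem (fun hm => absurd hm.1 (not_lt.2 h)) _

lemma bilin_eq_zero {Φ Ψ : Cone n → ℂ} {q : LightCone n} (h : boxQ q ≤ 0) :
    bilin Φ Ψ q = 0 := by
  simp [bilin, fibre_eq_zero h]

lemma amp_pos (d : ℕ) : 0 < amp d := by unfold amp; positivity

lemma abs_rpow_sq {x : ℝ} (hx : 0 < x) (β : ℝ) : (|x| ^ β) ^ 2 = x ^ (2 * β) := by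
  rw [abs_of_pos hx, ← Real.rpow_natCast, ← Real.rpow_mul hx.le]
  congr 1; push_cast; ring

lemma enorm_sq_eq (z : ℂ) : ‖z‖ₑ ^ 2 = ENNReal.ofReal (‖z‖ ^ 2) := by
  rw [ENNReal.ofReal_pow (norm_nonneg _), ofReal_norm]

/-- The weight `|τ² - |ξ|²|^{2β}` in light-cone coordinates, on the support of the product. -/
lemma enorm_box_mul_sq {β : ℝ} (q : Spacetime (n + 1)) {b : ℂ} (hb : boxQ (toLC q) ≤ 0 → b = 0) :
    ‖((|q.1 ^ 2 - ‖q.2‖ ^ 2| ^ β : ℝ) : ℂ) * ((amp (n + 1) : ℂ) * b)‖ₑ ^ 2 =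
      ENNReal.ofReal (amp (n + 1) ^ 2) *
        (ENNReal.ofReal (boxQ (toLC q) ^ (2 * β)) * ‖b‖ₑ ^ 2) := by
  -- For `boxQ ≤ 0` the powers of the two bases need not agree, but both sides vanish.
  rcases le_or_gt (boxQ (toLC q)) 0 with h | h
  · simp [hb h]
  · have h0 := amp_pos (n + 1)
    rw [enorm_sq_eq, enorm_sq_eq, ← ENNReal.ofReal_mul (by positivity),
      ← ENNReal.ofReal_mul (by positivity), ← abs_rpow_sq h, boxQ_toLC, abs_sub_comm]
    congr 1
    simp only [norm_mul, Complex.norm_real, Real.norm_eq_abs, mul_pow, sq_abs]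
    ring

lemma sq_eLpNorm_boxFourier {β : ℝ} {f g : Space (n + 1) → ℂ} (hf : Measurable f)
    (hg : Measurable g) :
    eLpNorm (boxFourier β f g) 2 volume ^ 2 = ENNReal.ofReal (amp (n + 1) ^ 2 / 2) *
      ∫⁻ m, ENNReal.ofReal (boxQ m ^ (2 * β)) * ‖bilin (lift f) (lift g) m‖ₑ ^ 2 := by
  have hb := measurable_bilin (measurable_lift hf) (measurable_lift hg)
  have h : ∀ q, ‖boxFourier β f g q‖ₑ ^ 2 = ENNReal.ofReal (amp (n + 1) ^ 2) *
      (ENNReal.ofReal (boxQ (toLC q) ^ (2 * β)) * ‖bilin (lift f) (lift g) (toLC q)‖ₑ ^ 2) :=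
    fun q => enorm_box_mul_sq q bilin_eq_zero
  rw [sq_eLpNorm_two]
  simp_rw [h]
  rw [lintegral_const_mul' _ _ ENNReal.ofReal_ne_top, lintegral_toLC
    (H := fun m => ENNReal.ofReal (boxQ m ^ (2 * β)) * ‖bilin (lift f) (lift g) m‖ₑ ^ 2)
    (by fun_prop), ← mul_assoc, ← ENNReal.ofReal_mul (by positivity)]
  congr 2
  ring

/-- The integral of absolute values dominating `bilin`. -/
def absBilin (Φ Ψ : Cone n → ℂ) (q : LightCone n) : ℝ≥0∞ :=
  ∫⁻ v, ENNReal.ofReal (fibre q v) * (‖Φ (coneFst q v)‖ₑ * ‖Ψ (coneSnd q v)‖ₑ)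

lemma measurable_absBilin {Φ Ψ : Cone n → ℂ} (hΦ : Measurable Φ) (hΨ : Measurable Ψ) :
    Measurable (absBilin Φ Ψ) := by
  unfold absBilin; fun_prop

lemma sq_absBilin_le {Φ Ψ : Cone n → ℂ} (hΦ : Measurable Φ) (hΨ : Measurable Ψ)
    (q : LightCone n) : absBilin Φ Ψ q ^ 2 ≤
      (∫⁻ v, ENNReal.ofReal (fibre q v) * ‖Φ (coneFst q v)‖ₑ ^ 2) *
        ∫⁻ v, ENNReal.ofReal (fibre q v) * ‖Ψ (coneSnd q v)‖ₑ ^ 2 := by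
  have h := sq_lintegral_mul_le (volume.withDensity fun v => ENNReal.ofReal (fibre q v))
    (f := fun v => ‖Φ (coneFst q v)‖ₑ) (g := fun v => ‖Ψ (coneSnd q v)‖ₑ)
    (Measurable.aemeasurable (by fun_prop)) (Measurable.aemeasurable (by fun_prop))
  rwa [lintegral_withDensity_fibre _ (by fun_prop), lintegral_withDensity_fibre _ (by fun_prop),
    lintegral_withDensity_fibre _ (by fun_prop)] at h

/-- Cauchy–Schwarz on the fibre with absolute values inside: this needs no cancellation and supplies
the majorant for both limit passages. -/
lemma lintegral_absBilin_le (hn : 1 ≤ n) {β : ℝ} (hβ : -(n : ℝ) / 4 < β) {Φ Ψ : Cone n → ℂ}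
    (hΦ : Measurable Φ) (hΨ : Measurable Ψ) :
    ∫⁻ q, ENNReal.ofReal (boxQ q ^ (2 * β)) * absBilin Φ Ψ q ^ 2 ≤
      ENNReal.ofReal (coneConst n β) * coneEnergy β Φ Ψ := by
  rw [← lintegral_fibre_energy hn hβ hΦ hΨ]
  refine lintegral_mono fun q => ?_
  have h : ∀ v, ∫⁻ v', ENNReal.ofReal (fibre q v') * (ENNReal.ofReal (boxQ q ^ (2 * β)) *
      (‖Φ (coneFst q v)‖ₑ ^ 2 * ‖Ψ (coneSnd q v')‖ₑ ^ 2)) =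
      (ENNReal.ofReal (boxQ q ^ (2 * β)) * ‖Φ (coneFst q v)‖ₑ ^ 2) *
        ∫⁻ v', ENNReal.ofReal (fibre q v') * ‖Ψ (coneSnd q v')‖ₑ ^ 2 := by
    intro v
    rw [← lintegral_const_mul _ (by fun_prop)]
    refine lintegral_congr fun v' => ?_
    ring
  simp_rw [h]
  have h2 : ∀ v, ENNReal.ofReal (fibre q v) * (ENNReal.ofReal (boxQ q ^ (2 * β)) *
      ‖Φ (coneFst q v)‖ₑ ^ 2 * ∫⁻ v', ENNReal.ofReal (fibre q v') * ‖Ψ (coneSnd q v')‖ₑ ^ 2) =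
      (ENNReal.ofReal (boxQ q ^ (2 * β)) *
        ∫⁻ v', ENNReal.ofReal (fibre q v') * ‖Ψ (coneSnd q v')‖ₑ ^ 2) *
        (ENNReal.ofReal (fibre q v) * ‖Φ (coneFst q v)‖ₑ ^ 2) := fun v => by ring
  simp_rw [h2]
  rw [lintegral_const_mul _ (by fun_prop), mul_assoc]
  gcongr
  rw [mul_comm]
  exact sq_absBilin_le hΦ hΨ q

lemma ae_absBilin_lt_top (hn : 1 ≤ n) {β : ℝ} (hβ : -(n : ℝ) / 4 < β) {Φ Ψ : Cone n → ℂ}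
    (hΦ : Measurable Φ) (hΨ : Measurable Ψ) (hE : coneEnergy β Φ Ψ ≠ ∞) :
    ∀ᵐ q, absBilin Φ Ψ q < ∞ := by
  have hm := measurable_absBilin hΦ hΨ
  have h1 := ae_lt_top (by fun_prop)
    (ne_top_of_le_ne_top (ENNReal.mul_ne_top ENNReal.ofReal_ne_top hE)
      (lintegral_absBilin_le hn hβ hΦ hΨ))
  filter_upwards [h1] with q hq
  rcases le_or_gt (boxQ q) 0 with h | h
  · simp [absBilin, fibre_eq_zero h]
  · have h0 : ENNReal.ofReal (boxQ q ^ (2 * β)) ≠ 0 := by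
      have := Real.rpow_pos_of_pos h (2 * β)
      simpa using this
    by_contra h2
    rw [not_lt_top_iff.1 h2] at hq
    simp [ENNReal.mul_top h0] at hq

/-- Pairs of frequencies: almost everywhere statements hold almost everywhere on almost every
fibre. -/
lemma ae_ae_fibre (hn : 1 ≤ n) {P Q : Space (n + 1) → Prop} (hP : ∀ᵐ ξ, P ξ) (hQ : ∀ᵐ ξ, Q ξ) :
    ∀ᵐ q : LightCone n, ∀ᵐ v : Space n, pairDensity (q, v) ≠ 0 →
      P (pairPt (q, v)).1 ∧ Q (pairPt (q, v)).2 := by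
  have h1 : ∀ᵐ p : Space (n + 1) × Space (n + 1), P p.1 ∧ Q p.2 := by
    rw [Measure.volume_eq_prod]
    exact (Measure.quasiMeasurePreserving_fst.ae hP).and (Measure.quasiMeasurePreserving_snd.ae hQ)
  have h2 := (measurePreserving_pairPt hn).quasiMeasurePreserving.ae h1
  rw [pairMeasure, ae_withDensity_iff (by fun_prop), Measure.volume_eq_prod] at h2
  filter_upwards [Measure.ae_ae_of_ae_prod h2] with q hq
  filter_upwards [hq] with v hv hne
  exact hv (by simpa using lt_of_le_of_ne (pairDensity_nonneg _) hne.symm)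

lemma absBilin_lift (f g : Space (n + 1) → ℂ) (q : LightCone n) :
    absBilin (lift f) (lift g) q = ∫⁻ v, ‖(pairDensity (q, v) : ℂ) *
      (f (pairPt (q, v)).1 * starRingEnd ℂ (g (pairPt (q, v)).2))‖ₑ := by
  refine lintegral_congr fun v => ?_
  have h : ENNReal.ofReal (fibre q v) = ‖(fibre q v : ℂ)‖ₑ := by
    rw [← ofReal_norm, Complex.norm_real, Real.norm_of_nonneg (fibre_nonneg _ _)]
  rw [h, ← enorm_mul, ← enorm_mul, ← ofReal_norm, ← ofReal_norm]
  congr 1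
  simp only [lift, pairDensity, pairPt, norm_mul, Complex.norm_real, norm_norm, RCLike.norm_conj]
  ring

/-- Dominated convergence on almost every fibre. Almost everywhere statements about the data descend
to fibres by `ae_ae_fibre`, and the majorant is integrable because `absBilin` is finite almost
everywhere. -/
lemma tendsto_bilin (hn : 1 ≤ n) {β : ℝ} (hβ : -(n : ℝ) / 4 < β) {f g : Space (n + 1) → ℂ}
    (hf : Measurable f) (hg : Measurable g) (hE : coneEnergy β (lift f) (lift g) ≠ ∞)
    {F G : ℕ → Space (n + 1) → ℂ} (hF : ∀ k, Measurable (F k)) (hG : ∀ k, Measurable (G k))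
    (hFl : ∀ᵐ ξ, ∀ k, ‖F k ξ‖ ≤ ‖f ξ‖) (hGl : ∀ᵐ ξ, ∀ k, ‖G k ξ‖ ≤ ‖g ξ‖)
    (hFt : ∀ᵐ ξ, Tendsto (fun k => F k ξ) atTop (𝓝 (f ξ)))
    (hGt : ∀ᵐ ξ, Tendsto (fun k => G k ξ) atTop (𝓝 (g ξ))) :
    ∀ᵐ q, absBilin (lift f) (lift g) q < ∞ ∧
      ‖bilin (lift f) (lift g) q‖ₑ ≤ absBilin (lift f) (lift g) q ∧
      (∀ k, ‖bilin (lift (F k)) (lift (G k)) q‖ₑ ≤ absBilin (lift f) (lift g) q) ∧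
      Tendsto (fun k => bilin (lift (F k)) (lift (G k)) q) atTop
        (𝓝 (bilin (lift f) (lift g) q)) := by
  filter_upwards [ae_absBilin_lt_top hn hβ (measurable_lift hf) (measurable_lift hg) hE,
    ae_ae_fibre hn hFl hGl, ae_ae_fibre hn hFt hGt] with q hq hl ht
  have hmm : ∀ {f g : Space (n + 1) → ℂ}, Measurable f → Measurable g → Measurable fun v : Space n =>
      (pairDensity (q, v) : ℂ) * (f (pairPt (q, v)).1 * starRingEnd ℂ (g (pairPt (q, v)).2)) := by
    intro f g hf hg; fun_prop
  have hle : ∀ k, ∀ᵐ v : Space n, ‖(pairDensity (q, v) : ℂ) *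
      (F k (pairPt (q, v)).1 * starRingEnd ℂ (G k (pairPt (q, v)).2))‖ ≤
      ‖(pairDensity (q, v) : ℂ) *
        (f (pairPt (q, v)).1 * starRingEnd ℂ (g (pairPt (q, v)).2))‖ := by
    intro k
    filter_upwards [hl] with v hv
    by_cases h0 : pairDensity (q, v) = 0
    · simp [h0]
    · obtain ⟨h1, h2⟩ := hv h0
      simp only [norm_mul, RCLike.norm_conj]
      gcongr
      exacts [h1 k, h2 k]
  refine ⟨hq, ?_, fun k => ?_, ?_⟩
  · rw [bilin_lift_eq, absBilin_lift]
    exact enorm_integral_le_lintegral_enorm _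
  · rw [bilin_lift_eq, absBilin_lift]
    refine (enorm_integral_le_lintegral_enorm _).trans (lintegral_mono_ae ?_)
    filter_upwards [hle k] with v hv
    rw [← ofReal_norm, ← ofReal_norm]
    exact ENNReal.ofReal_le_ofReal hv
  · simp only [bilin_lift_eq]
    rw [absBilin_lift] at hq
    refine tendsto_integral_of_dominated_convergence _
      (fun k => (hmm (hF k) (hG k)).aestronglyMeasurable)
      (Integrable.norm ⟨(hmm hf hg).aestronglyMeasurable, hq⟩) hle ?_
    filter_upwards [ht] with v hv
    by_cases h0 : pairDensity (q, v) = 0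
    · simp [h0]
    · obtain ⟨h1, h2⟩ := hv h0
      exact tendsto_const_nhds.mul (h1.mul ((Complex.continuous_conj.tendsto _).comp h2))

lemma memLp_boxFourier (hn : 1 ≤ n) {β : ℝ} (hβ : -(n : ℝ) / 4 < β) {f g : Space (n + 1) → ℂ}
    (hf : Measurable f) (hg : Measurable g) (hE : coneEnergy β (lift f) (lift g) ≠ ∞) :
    MemLp (boxFourier β f g) 2 := by
  refine ⟨(measurable_boxFourier hf hg).aestronglyMeasurable, ?_⟩
  have h1 := coneDefect_add hn hβ (measurable_lift hf) (measurable_lift hg) hE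
  have h2 : eLpNorm (boxFourier β f g) 2 volume ^ 2 < ∞ := by
    rw [sq_eLpNorm_boxFourier hf hg]
    refine ENNReal.mul_lt_top ENNReal.ofReal_lt_top (lt_top_iff_ne_top.2 fun h => ?_)
    rw [h, ENNReal.mul_top two_ne_zero, add_top] at h1
    exact ENNReal.mul_ne_top (by simp) (ENNReal.mul_ne_top ENNReal.ofReal_ne_top hE) h1.symm
  by_contra h3
  rw [not_lt_top_iff.1 h3] at h2
  simp at h2

lemma energy_mono {d : ℕ} {β : ℝ} {f g F G : Space d → ℂ} (hFl : ∀ᵐ ξ, ‖F ξ‖ ≤ ‖f ξ‖)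
    (hGl : ∀ᵐ ξ, ‖G ξ‖ ≤ ‖g ξ‖) : energy β F G ≤ energy β f g := by
  refine lintegral_mono_ae ?_
  rw [Measure.volume_eq_prod]
  filter_upwards [Measure.quasiMeasurePreserving_fst.ae hFl,
    Measure.quasiMeasurePreserving_snd.ae hGl] with y h1 h2
  have h3 : 0 ≤ 1 - inner ℝ (‖y.1‖⁻¹ • y.1) (‖y.2‖⁻¹ • y.2) := by
    have h4 : ∀ x : Space d, ‖‖x‖⁻¹ • x‖ ≤ 1 := fun x => by
      rw [norm_smul, norm_inv, norm_norm]
      exact inv_mul_le_one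
    have := real_inner_le_norm (‖y.1‖⁻¹ • y.1) (‖y.2‖⁻¹ • y.2)
    nlinarith [h4 y.1, h4 y.2, norm_nonneg (‖y.1‖⁻¹ • y.1), norm_nonneg (‖y.2‖⁻¹ • y.2)]
  refine ENNReal.ofReal_le_ofReal ?_
  gcongr

lemma coneEnergy_mono (hn : 1 ≤ n) {β : ℝ} {f g F G : Space (n + 1) → ℂ} (hf : Measurable f)
    (hg : Measurable g) (hF : Measurable F) (hG : Measurable G)
    (hFl : ∀ᵐ ξ, ‖F ξ‖ ≤ ‖f ξ‖) (hGl : ∀ᵐ ξ, ‖G ξ‖ ≤ ‖g ξ‖)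
    (hE : coneEnergy β (lift f) (lift g) ≠ ∞) : coneEnergy β (lift F) (lift G) ≠ ∞ := by
  have h1 := energy_mono (β := β) hFl hGl
  have h2 : ENNReal.ofReal (2 ^ (-((n : ℝ) / 2 - 1 + 2 * β))) ≠ 0 := by
    have : (0 : ℝ) < 2 ^ (-((n : ℝ) / 2 - 1 + 2 * β)) := by positivity
    simpa using this
  rw [energy_eq hn hF hG, energy_eq hn hf hg,
    ENNReal.mul_le_mul_iff_right h2 ENNReal.ofReal_ne_top] at h1
  exact ne_top_of_le_ne_top hE h1

/-- A second dominated convergence, now in `q`: both densities are at most `absBilin`, so the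
squared difference is at most four times its square. -/
lemma tendsto_boxFourier (hn : 1 ≤ n) {β : ℝ} (hβ : -(n : ℝ) / 4 < β) {f g : Space (n + 1) → ℂ}
    (hf : Measurable f) (hg : Measurable g) (hE : coneEnergy β (lift f) (lift g) ≠ ∞)
    {F G : ℕ → Space (n + 1) → ℂ} (hF : ∀ k, Measurable (F k)) (hG : ∀ k, Measurable (G k))
    (hFl : ∀ k, ∀ᵐ ξ, ‖F k ξ‖ ≤ ‖f ξ‖) (hGl : ∀ k, ∀ᵐ ξ, ‖G k ξ‖ ≤ ‖g ξ‖)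
    (hFt : ∀ᵐ ξ, Tendsto (fun k => F k ξ) atTop (𝓝 (f ξ)))
    (hGt : ∀ᵐ ξ, Tendsto (fun k => G k ξ) atTop (𝓝 (g ξ))) :
    Tendsto (fun k => eLpNorm (boxFourier β (F k) (G k) - boxFourier β f g) 2 volume ^ 2) atTop
      (𝓝 0) := by
  have hb := measurable_bilin (measurable_lift hf) (measurable_lift hg)
  have hbk := fun k => measurable_bilin (measurable_lift (hF k)) (measurable_lift (hG k))
  have ha := measurable_absBilin (measurable_lift hf) (measurable_lift hg)
  have key : ∀ k q, ‖(boxFourier β (F k) (G k) - boxFourier β f g) q‖ₑ ^ 2 =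
      ENNReal.ofReal (amp (n + 1) ^ 2) * (ENNReal.ofReal (boxQ (toLC q) ^ (2 * β)) *
        ‖bilin (lift (F k)) (lift (G k)) (toLC q) - bilin (lift f) (lift g) (toLC q)‖ₑ ^ 2) := by
    intro k q
    rw [← enorm_box_mul_sq q (fun h => by rw [bilin_eq_zero h, bilin_eq_zero h, sub_zero]),
      Pi.sub_apply, boxFourier, boxFourier, prodFourier, prodFourier]
    congr 2
    ring
  have hk : ∀ k, eLpNorm (boxFourier β (F k) (G k) - boxFourier β f g) 2 volume ^ 2 =
      ENNReal.ofReal (amp (n + 1) ^ 2) * (ENNReal.ofReal (1 / 2) *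
        ∫⁻ m, ENNReal.ofReal (boxQ m ^ (2 * β)) *
          ‖bilin (lift (F k)) (lift (G k)) m - bilin (lift f) (lift g) m‖ₑ ^ 2) := by
    intro k
    have := hbk k
    rw [sq_eLpNorm_two]
    simp_rw [key]
    rw [lintegral_const_mul' _ _ ENNReal.ofReal_ne_top, lintegral_toLC
      (H := fun m => ENNReal.ofReal (boxQ m ^ (2 * β)) *
        ‖bilin (lift (F k)) (lift (G k)) m - bilin (lift f) (lift g) m‖ₑ ^ 2) (by fun_prop)]
  simp_rw [hk]
  have hT := tendsto_bilin hn hβ hf hg hE hF hG (ae_all_iff.2 hFl) (ae_all_iff.2 hGl) hFt hGt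
  have hlim : Tendsto (fun k => ∫⁻ m, ENNReal.ofReal (boxQ m ^ (2 * β)) *
      ‖bilin (lift (F k)) (lift (G k)) m - bilin (lift f) (lift g) m‖ₑ ^ 2) atTop
      (𝓝 (∫⁻ _ : LightCone n, 0)) := by
    refine tendsto_lintegral_of_dominated_convergence (fun m => 4 * (ENNReal.ofReal
      (boxQ m ^ (2 * β)) * absBilin (lift f) (lift g) m ^ 2)) (fun k => ?_) (fun k => ?_) ?_ ?_
    · have := hbk k
      fun_prop
    · filter_upwards [hT] with m hm
      have h1 : ‖bilin (lift (F k)) (lift (G k)) m - bilin (lift f) (lift g) m‖ₑ ≤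
          2 * absBilin (lift f) (lift g) m := by
        rw [two_mul]
        exact enorm_sub_le.trans (add_le_add (hm.2.2.1 k) hm.2.1)
      calc _ ≤ ENNReal.ofReal (boxQ m ^ (2 * β)) * (2 * absBilin (lift f) (lift g) m) ^ 2 := by
            gcongr
        _ = _ := by ring
    · rw [lintegral_const_mul' _ _ (by simp)]
      exact ENNReal.mul_ne_top (by simp) (ne_top_of_le_ne_top
        (ENNReal.mul_ne_top ENNReal.ofReal_ne_top hE)
        (lintegral_absBilin_le hn hβ (measurable_lift hf) (measurable_lift hg)))
    · filter_upwards [hT] with m hm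
      have h1 : Tendsto (fun k => ‖bilin (lift (F k)) (lift (G k)) m -
          bilin (lift f) (lift g) m‖ₑ ^ 2) atTop (𝓝 0) := by
        have h2 := (hm.2.2.2.sub_const (bilin (lift f) (lift g) m)).enorm
        simp only [sub_self, enorm_zero] at h2
        simpa using ENNReal.Tendsto.pow h2 (n := 2)
      simpa using ENNReal.Tendsto.const_mul h1 (Or.inr ENNReal.ofReal_ne_top)
  rw [lintegral_zero] at hlim
  have := ENNReal.Tendsto.const_mul (a := ENNReal.ofReal (amp (n + 1) ^ 2))
    (ENNReal.Tendsto.const_mul (a := ENNReal.ofReal (1 / 2)) hlim (Or.inr ENNReal.ofReal_ne_top))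
    (Or.inr ENNReal.ofReal_ne_top)
  simpa using this

/-! ### Existence and uniqueness of `|□|^β` of a product -/

lemma halfWave_congr {d : ℕ} {f f' : Space d → ℂ} (h : f =ᵐ[volume] f') :
    halfWave f = halfWave f' := by
  funext p
  rw [halfWave, halfWave]
  congr 1
  refine integral_congr_ae ?_
  filter_upwards [h] with ξ hξ
  rw [hξ]

lemma waveProduct_congr {d : ℕ} {f f' g g' : Space d → ℂ} (h : f =ᵐ[volume] f')
    (h' : g =ᵐ[volume] g') : waveProduct f g = waveProduct f' g' := by
  funext p
  rw [waveProduct, waveProduct, halfWave_congr h, halfWave_congr h']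

lemma energy_congr {d : ℕ} {β : ℝ} {f f' g g' : Space d → ℂ} (h : f =ᵐ[volume] f')
    (h' : g =ᵐ[volume] g') : energy β f g = energy β f' g' := by
  refine lintegral_congr_ae ?_
  rw [Measure.volume_eq_prod]
  filter_upwards [Measure.quasiMeasurePreserving_fst.ae h,
    Measure.quasiMeasurePreserving_snd.ae h'] with y h1 h2
  rw [h1, h2]

lemma Approximates.congr {d : ℕ} {F F' : ℕ → Space d → ℂ} {f f' : Space d → ℂ}
    (h : Approximates F f) (hF : ∀ k, F k =ᵐ[volume] F' k) (hf : f =ᵐ[volume] f') :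
    Approximates F' f' where
  integrable k := (h.integrable k).congr (hF k)
  norm_le k := by
    filter_upwards [h.norm_le k, hF k, hf] with ξ h1 h2 h3
    rwa [← h2, ← h3]
  tendsto := by
    filter_upwards [h.tendsto, ae_all_iff.2 hF, hf] with ξ h1 h2 h3
    simpa only [← h2, ← h3] using h1

lemma IsBoxPowProduct.congr {d : ℕ} {β : ℝ} {f f' g g' : Space d → ℂ} {V : Spacetime d → ℂ}
    (h : IsBoxPowProduct β f g V) (hf : f =ᵐ[volume] f') (hg : g =ᵐ[volume] g') :
    IsBoxPowProduct β f' g' V :=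
  ⟨h.1, fun F G hF hG => h.2 F G (hF.congr (fun _ => ae_eq_refl _) hf.symm)
    (hG.congr (fun _ => ae_eq_refl _) hg.symm)⟩

lemma tendsto_zero_of_sq {a : ℕ → ℝ≥0∞} (h : Tendsto (fun k => a k ^ 2) atTop (𝓝 0)) :
    Tendsto a atTop (𝓝 0) := by
  have h1 := (ENNReal.continuous_rpow_const (y := 1 / 2)).tendsto 0 |>.comp h
  rw [ENNReal.zero_rpow_of_pos (by norm_num)] at h1
  refine h1.congr fun k => ?_
  simp only [Function.comp_apply]
  rw [← ENNReal.rpow_natCast, ← ENNReal.rpow_mul]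
  norm_num

/-- The function is constructed as the inverse Fourier transform of `boxFourier`, which makes sense
for all data of finite energy; Plancherel turns the convergence in `tendsto_boxFourier` into the
convergence that the definition demands. -/
theorem exists_isBoxPowProduct (hn : 1 ≤ n) {β : ℝ} (hβ : -(n : ℝ) / 4 < β)
    {f g : Space (n + 1) → ℂ} (hf : Measurable f) (hg : Measurable g)
    (hE : coneEnergy β (lift f) (lift g) ≠ ∞) :
    ∃ V, IsBoxPowProduct β f g V ∧ ENNReal.ofReal ((2 * Real.pi) ^ (n + 1 + 1)) *
      eLpNorm V 2 volume ^ 2 = eLpNorm (boxFourier β f g) 2 volume ^ 2 := by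
  have hmem := memLp_boxFourier hn hβ hf hg hE
  obtain ⟨V, hV, hVF, hVn⟩ := exists_hasSpacetimeFourier hmem
  refine ⟨V, ⟨hV, fun F₀ G₀ hF₀ hG₀ => ?_⟩, hVn⟩
  have hFm := fun k => (hF₀.integrable k).aestronglyMeasurable
  have hGm := fun k => (hG₀.integrable k).aestronglyMeasurable
  -- Approximating data are only almost everywhere measurable, while the changes of variables are
  -- stated for measurable functions; representatives are chosen for all indices.
  obtain ⟨F, hFdef⟩ : ∃ F : ℕ → Space (n + 1) → ℂ, F = fun k => (hFm k).mk := ⟨_, rfl⟩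
  obtain ⟨G, hGdef⟩ : ∃ G : ℕ → Space (n + 1) → ℂ, G = fun k => (hGm k).mk := ⟨_, rfl⟩
  have hFe : ∀ k, F₀ k =ᵐ[volume] F k := fun k => hFdef ▸ (hFm k).ae_eq_mk
  have hGe : ∀ k, G₀ k =ᵐ[volume] G k := fun k => hGdef ▸ (hGm k).ae_eq_mk
  have hFmeas : ∀ k, Measurable (F k) := fun k => hFdef ▸ (hFm k).stronglyMeasurable_mk.measurable
  have hGmeas : ∀ k, Measurable (G k) := fun k => hGdef ▸ (hGm k).stronglyMeasurable_mk.measurable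
  have hF := hF₀.congr hFe (ae_eq_refl f)
  have hG := hG₀.congr hGe (ae_eq_refl g)
  have hmemk := fun k => memLp_boxFourier hn hβ (hFmeas k) (hGmeas k)
    (coneEnergy_mono hn hf hg (hFmeas k) (hGmeas k) (hF.norm_le k) (hG.norm_le k) hE)
  choose W hW hWF _ using fun k => exists_hasSpacetimeFourier (hmemk k)
  refine ⟨W, fun k => ⟨hW k, prodFourier (F k) (G k), ?_, hWF k⟩, tendsto_zero_of_sq ?_⟩
  · rw [waveProduct_congr (hFe k) (hGe k)]
    exact hasSpacetimeFourier_waveProduct hn (hF.integrable k) (hG.integrable k)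
  · have ht := tendsto_boxFourier hn hβ hf hg hE hFmeas hGmeas hF.norm_le hG.norm_le hF.tendsto
      hG.tendsto
    have hpl := fun k => (((hWF k).sub hVF).plancherel ((hmemk k).sub hmem)).2
    have hpos : ENNReal.ofReal ((2 * Real.pi) ^ (n + 1 + 1)) ≠ 0 := by
      have : (0 : ℝ) < (2 * Real.pi) ^ (n + 1 + 1) := by positivity
      simpa using this
    have h2 := ENNReal.Tendsto.const_mul
      (a := (ENNReal.ofReal ((2 * Real.pi) ^ (n + 1 + 1)))⁻¹) ht
      (Or.inr (ENNReal.inv_ne_top.2 hpos))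
    rw [mul_zero] at h2
    refine h2.congr fun k => ?_
    rw [← hpl k, ← mul_assoc, ENNReal.inv_mul_cancel hpos ENNReal.ofReal_ne_top, one_mul]

/-- Approximating sequences exist. -/
lemma exists_approximates {d : ℕ} {f : Space d → ℂ} (hf : Measurable f) :
    ∃ F, Approximates F f := by
  have hS : ∀ k : ℕ, MeasurableSet {ξ : Space d | ‖ξ‖ ≤ k ∧ ‖f ξ‖ ≤ k} := fun k =>
    (measurableSet_le measurable_norm measurable_const).inter
      (measurableSet_le hf.norm measurable_const)
  refine ⟨fun k => {ξ : Space d | ‖ξ‖ ≤ k ∧ ‖f ξ‖ ≤ k}.indicator f, fun k => ?_,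
    fun k => ae_of_all _ fun ξ => norm_indicator_le_norm_self _ _, ae_of_all _ fun ξ => ?_⟩
  · rw [integrable_indicator_iff (hS k)]
    refine Measure.integrableOn_of_bounded (M := k) ?_ hf.aestronglyMeasurable ?_
    · refine ne_top_of_le_ne_top (measure_closedBall_lt_top (x := (0 : Space d)) (r := k)).ne
        (measure_mono fun ξ hξ => ?_)
      simpa using hξ.1
    · filter_upwards [ae_restrict_mem (hS k)] with ξ hξ
      exact hξ.2
  · obtain ⟨N, hN⟩ := exists_nat_ge (max ‖ξ‖ ‖f ξ‖)
    refine tendsto_const_nhds.congr' ?_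
    filter_upwards [eventually_ge_atTop N] with k hk
    have : (N : ℝ) ≤ k := by exact_mod_cast hk
    rw [indicator_of_mem]
    exact ⟨(le_max_left _ _).trans (hN.trans this), (le_max_right _ _).trans (hN.trans this)⟩

lemma HasSpacetimeFourier.ae_eq_of_isBoxPow {d : ℕ} {β : ℝ} {u W W' : Spacetime d → ℂ}
    (h : IsBoxPow β u W) (h' : IsBoxPow β u W') : W =ᵐ[volume] W' := by
  obtain ⟨U, hU, hW⟩ := h
  obtain ⟨U', hU', hW'⟩ := h'
  refine hW.injective hW' ?_
  filter_upwards [hU.unique hU'] with q hq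
  rw [hq]

/-- `|□|^β` of a product of waves is unique. -/
theorem IsBoxPowProduct.ae_eq {d : ℕ} {β : ℝ} {f g : Space d → ℂ} (hf : Measurable f)
    (hg : Measurable g) {V V' : Spacetime d → ℂ} (h : IsBoxPowProduct β f g V)
    (h' : IsBoxPowProduct β f g V') : V =ᵐ[volume] V' := by
  obtain ⟨F, hF⟩ := exists_approximates hf
  obtain ⟨G, hG⟩ := exists_approximates hg
  obtain ⟨W, hW, hWt⟩ := h.2 F G hF hG
  obtain ⟨W', hW', hWt'⟩ := h'.2 F G hF hG
  have hle : ∀ k, eLpNorm (V - V') 2 volume ≤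
      eLpNorm (W k - V) 2 volume + eLpNorm (W' k - V') 2 volume := by
    intro k
    -- For integrable data `|□|^β` of the product is unique, so along a common approximating
    -- sequence `V - V'` is a difference of two errors.
    have he : V - V' =ᵐ[volume] (W' k - V') - (W k - V) := by
      filter_upwards [HasSpacetimeFourier.ae_eq_of_isBoxPow (hW k).2 (hW' k).2] with q hq
      simp only [Pi.sub_apply, hq]
      ring
    rw [eLpNorm_congr_ae he, add_comm]
    exact eLpNorm_sub_le ((hW' k).1.sub h'.1).aestronglyMeasurable
      ((hW k).1.sub h.1).aestronglyMeasurable one_le_two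
  have h0 := le_of_tendsto_of_tendsto' tendsto_const_nhds (hWt.add hWt') hle
  rw [add_zero, le_zero_iff, eLpNorm_eq_zero_iff (h.1.sub h'.1).aestronglyMeasurable
    two_ne_zero] at h0
  filter_upwards [h0] with q hq
  exact sub_eq_zero.1 hq

/-! ### The sharp constant and the identity with defect -/

/-- On the right are the squared amplitude, the Jacobian `1/2` of `toLC`, the Plancherel factor and
the integral over the exchange direction; on the left the power of two is the one in `energy_eq`. -/
lemma sharpConst_eq (β : ℝ) : sharpConst β (n + 1) * 2 ^ (-((n : ℝ) / 2 - 1 + 2 * β)) =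
    amp (n + 1) ^ 2 / 2 / (2 * Real.pi) ^ (n + 1 + 1) * coneConst n β := by
  have e1 : (((n + 1 : ℕ) : ℝ) - 1) / 2 + 2 * β = n / 2 + 2 * β := by push_cast; ring
  have e2 : ((n + 1 : ℕ) : ℝ) - 1 + 2 * β = n + 2 * β := by push_cast; ring
  rw [sharpConst, coneConst, e1, e2, amp]
  have h : (2 : ℝ) ^ ((1 - 5 * ((n + 1 : ℕ) : ℝ) + 4 * β) / 2) *
      Real.pi ^ ((1 - 5 * ((n + 1 : ℕ) : ℝ)) / 2) * 2 ^ (-((n : ℝ) / 2 - 1 + 2 * β)) =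
      ((((2 * Real.pi) ^ (n + 1))⁻¹) ^ 2 * (2 * Real.pi) ^ (n + 1 + 1) * 2) ^ 2 / 2 /
        (2 * Real.pi) ^ (n + 1 + 1) * Real.pi ^ ((n : ℝ) / 2) := by
    obtain ⟨a, ha⟩ : ∃ a, (2 : ℝ) = Real.exp a := ⟨Real.log 2, by rw [Real.exp_log two_pos]⟩
    obtain ⟨b, hb⟩ : ∃ b, Real.pi = Real.exp b :=
      ⟨Real.log Real.pi, by rw [Real.exp_log Real.pi_pos]⟩
    have h4 : ∀ x : ℝ, (2 : ℝ) ^ x = Real.exp (a * x) := fun x => by rw [Real.exp_mul, ← ha]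
    have h5 : ∀ x : ℝ, Real.pi ^ x = Real.exp (b * x) := fun x => by rw [Real.exp_mul, ← hb]
    have h6 : 2 * Real.pi = Real.exp (a + b) := by rw [Real.exp_add, ← ha, ← hb]
    have h7 : ((((2 * Real.pi) ^ (n + 1))⁻¹) ^ 2 * (2 * Real.pi) ^ (n + 1 + 1) * 2) ^ 2 / 2 /
        (2 * Real.pi) ^ (n + 1 + 1) * Real.pi ^ ((n : ℝ) / 2) =
        ((((2 * Real.pi) ^ (n + 1))⁻¹) ^ 2 * (2 * Real.pi) ^ (n + 1 + 1)) ^ 2 * 2 ^ (1 : ℝ) /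
        (2 * Real.pi) ^ (n + 1 + 1) * Real.pi ^ ((n : ℝ) / 2) := by
      rw [Real.rpow_one]; ring
    rw [h7, h4, h4, h4, h5, h5, h6]
    simp only [← Real.exp_nat_mul, ← Real.exp_neg, ← Real.exp_add, ← Real.exp_sub]
    congr 1
    push_cast
    ring
  linear_combination (Real.Gamma (n / 2 + 2 * β) / Real.Gamma (n + 2 * β)) * h

/-- The sharp bilinear identity: the norm and the defect add up to the energy. -/
theorem IsBoxPowProduct.sq_eLpNorm_add (hn : 1 ≤ n) {β : ℝ} (hβ : -(n : ℝ) / 4 < β)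
    {f g : Space (n + 1) → ℂ} (hf : Measurable f) (hg : Measurable g)
    (hE : energy β f g ≠ ∞) {V : Spacetime (n + 1) → ℂ} (hV : IsBoxPowProduct β f g V) :
    eLpNorm V 2 volume ^ 2 +
      ENNReal.ofReal (amp (n + 1) ^ 2 / 2 / (2 * Real.pi) ^ (n + 1 + 1) / 2) *
        coneDefect β (lift f) (lift g) = ENNReal.ofReal (sharpConst β (n + 1)) * energy β f g := by
  have h2 : (0 : ℝ) < 2 ^ (-((n : ℝ) / 2 - 1 + 2 * β)) := by positivity
  have ha := amp_pos (n + 1)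
  rw [energy_eq hn hf hg] at hE ⊢
  have hE' : coneEnergy β (lift f) (lift g) ≠ ∞ := by
    intro h
    rw [h, ENNReal.mul_top (by simpa using h2)] at hE
    exact hE rfl
  obtain ⟨V', hV', hn'⟩ := exists_isBoxPowProduct hn hβ hf hg hE'
  rw [eLpNorm_congr_ae (hV.ae_eq hf hg hV')]
  rw [sq_eLpNorm_boxFourier hf hg] at hn'
  have hid := coneDefect_add hn hβ (measurable_lift hf) (measurable_lift hg) hE'
  have hc := coneConst_pos hβ hn
  have hs : 0 ≤ sharpConst β (n + 1) := by
    have := sharpConst_eq (n := n) β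
    by_contra h
    have h3 : 0 < amp (n + 1) ^ 2 / 2 / (2 * Real.pi) ^ (n + 1 + 1) * coneConst n β := by positivity
    rw [← this] at h3
    nlinarith [mul_pos (neg_pos.2 (not_le.1 h)) h2]
  have hp : (0 : ℝ) < (2 * Real.pi) ^ (n + 1 + 1) := by positivity
  have hp0 : ENNReal.ofReal ((2 * Real.pi) ^ (n + 1 + 1)) ≠ 0 := by simpa using hp
  rw [← mul_assoc, ← ENNReal.ofReal_mul hs, sharpConst_eq,
    ← ENNReal.mul_right_inj hp0 ENNReal.ofReal_ne_top, mul_add, hn', ← mul_assoc, ← mul_assoc,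
    ← ENNReal.ofReal_mul hp.le, ← ENNReal.ofReal_mul hp.le]
  have e1 : (2 * Real.pi) ^ (n + 1 + 1) * (amp (n + 1) ^ 2 / 2 / (2 * Real.pi) ^ (n + 1 + 1) / 2) =
      amp (n + 1) ^ 2 / 4 := by field_simp; norm_num
  have e2 : (2 * Real.pi) ^ (n + 1 + 1) * (amp (n + 1) ^ 2 / 2 / (2 * Real.pi) ^ (n + 1 + 1) *
      coneConst n β) = amp (n + 1) ^ 2 / 4 * (2 * coneConst n β) := by field_simp; ring
  have e3 : amp (n + 1) ^ 2 / 2 = amp (n + 1) ^ 2 / 4 * 2 := by ring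
  rw [e1, e2, e3, ENNReal.ofReal_mul (by positivity), ENNReal.ofReal_mul (by positivity),
    ENNReal.ofReal_mul zero_le_two, mul_assoc, mul_assoc, mul_assoc, ← mul_add]
  have e4 : ENNReal.ofReal 2 = 2 := by simp
  rw [e4, ← hid, add_comm (coneDefect _ _ _)]

/-! ### Continuous solutions of the Gaussian functional equation -/

section Gaussian

variable {E : Type*} [NormedAddCommGroup E] [NormedSpace ℝ E]

/-- A nowhere vanishing continuous function on a vector space has a continuous logarithm. -/
lemma exists_continuous_log {φ : E → ℂ} (hc : Continuous φ) (h0 : ∀ x, φ x ≠ 0) :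
    ∃ l : E → ℂ, Continuous l ∧ ∀ x, Complex.exp (l x) = φ x := by
  have hn : ∀ x, ‖φ x‖ ≠ 0 := fun x => norm_ne_zero_iff.2 (h0 x)
  -- The phase is a map into the circle, which lifts through the covering `Circle.exp` because a
  -- vector space is simply connected.
  let w : C(E, Circle) := ⟨fun x => ⟨φ x / (‖φ x‖ : ℂ), mem_sphere_zero_iff_norm.2 (by
      rw [norm_div, Complex.norm_real, norm_norm, div_self (hn x)])⟩,
    Continuous.subtype_mk (hc.div (by fun_prop) fun x => by exact_mod_cast hn x) _⟩
  obtain ⟨e₀, he₀⟩ : ∃ e₀ : ℝ, Circle.exp e₀ = w 0 := ⟨_, Circle.exp_arg (w 0)⟩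
  obtain ⟨θ, ⟨-, hθ⟩, -⟩ := Circle.isCoveringMap_exp.existsUnique_continuousMap_lifts w 0 e₀ he₀
  refine ⟨fun x => (Real.log ‖φ x‖ : ℂ) + θ x * Complex.I, ?_, fun x => ?_⟩
  · have h1 : Continuous fun x => Real.log ‖φ x‖ := hc.norm.log hn
    exact (Complex.continuous_ofReal.comp h1).add
      ((Complex.continuous_ofReal.comp θ.continuous).mul continuous_const)
  · have h2 : (Circle.exp (θ x) : ℂ) = φ x / (‖φ x‖ : ℂ) := by
      rw [show Circle.exp (θ x) = w x from congrFun hθ x]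
      rfl
    have h3 : ((‖φ x‖ : ℝ) : ℂ) ≠ 0 := by exact_mod_cast hn x
    rw [Complex.exp_add, ← Complex.ofReal_exp, Real.exp_log ((norm_nonneg _).lt_of_ne' (hn x)),
      ← Circle.coe_exp, h2]
    field_simp

/-- A continuous solution of the parallelogram law is a quadratic form. -/
lemma exists_bilinear_of_parallelogram {l : E → ℂ} (hl : Continuous l)
    (hp : ∀ x y, l (x + y) + l (x - y) = 2 * l x + 2 * l y) :
    ∃ D : E →ₗ[ℝ] E →ₗ[ℝ] ℂ, ∀ x, l x = D x x := by
  have h0 : l 0 = 0 := by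
    have := hp 0 0
    simp only [add_zero, sub_zero] at this
    linear_combination -this / 2
  -- Vanishing of the third difference: the polarisation is additive in each variable, and
  -- continuity makes it real linear.
  have h3 : ∀ x y z, l (x + y + z) = l (x + z) + l (y + z) + l (x + y) - l x - l y - l z := by
    intro x y z
    have e1 := hp (x + z) y
    have e2 := hp (y + z) x
    have e3 := hp z (x - y)
    have e4 := hp x y
    rw [show x + z + y = x + y + z by abel, show x + z - y = z + (x - y) by abel] at e1
    rw [show y + z + x = x + y + z by abel, show y + z - x = z - (x - y) by abel] at e2
    linear_combination (e1 + e2 - e3) / 2 - e4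
  have hD : ∀ x, ∃ T : E →L[ℝ] ℂ, ∀ y, T y = (l (x + y) - l x - l y) / 2 := by
    intro x
    refine ⟨AddMonoidHom.toRealLinearMap
      { toFun := fun y => (l (x + y) - l x - l y) / 2
        map_zero' := by simp [h0]
        map_add' := fun y z => ?_ } ?_, fun y => rfl⟩
    · have := h3 y z x
      rw [show x + (y + z) = y + z + x by abel, show x + y = y + x by abel,
        show x + z = z + x by abel, this]
      ring
    · simp only [AddMonoidHom.coe_mk, ZeroHom.coe_mk]
      fun_prop
  choose T hT using hD
  have hsymm : ∀ x y, T x y = T y x := fun x y => by rw [hT, hT, add_comm y x]; ring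
  refine ⟨LinearMap.mk₂ ℝ (fun x y => T x y) (fun x y z => ?_) (fun c x y => ?_)
    (fun x y z => map_add _ _ _) (fun c x y => map_smul _ _ _), fun x => ?_⟩
  · rw [hsymm, map_add, hsymm z, hsymm z]
  · rw [hsymm, map_smul, hsymm y]
  · have := hp x x
    rw [sub_self, h0] at this
    rw [LinearMap.mk₂_apply, hT]
    linear_combination -this / 2

lemma sqrt_two_inv_smul_add (x : E) :
    (√2)⁻¹ • (x + x) = √2 • x := by
  rw [← two_smul ℝ x, smul_smul]
  congr 1
  rw [inv_mul_eq_div, Real.div_sqrt]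

/-- Continuous solutions of the functional equation characterising Gaussians. -/
theorem exists_bilinear_of_continuous {φ : E → ℂ} (hc : Continuous φ)
    (hφ : ∀ s t, φ s * φ t = φ ((√2)⁻¹ • (s + t)) * φ ((√2)⁻¹ • (s - t))) (hne : ∃ s, φ s ≠ 0) :
    ∃ (c : ℂ) (D : E →ₗ[ℝ] E →ₗ[ℝ] ℂ), ∀ s, φ s = Complex.exp (D s s + c) := by
  have hdbl : ∀ s, φ s * φ s = φ (√2 • s) * φ 0 := fun s => by
    have := hφ s s
    rwa [sub_self, smul_zero, sqrt_two_inv_smul_add] at this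
  have h0 : φ 0 ≠ 0 := by
    obtain ⟨s, hs⟩ := hne
    intro h
    have := hdbl s
    rw [h, mul_zero] at this
    exact mul_ne_zero hs hs this
  -- Nonvanishing holds near the origin by continuity and propagates outwards under multiplication
  -- by `√2`, by the case `s = t` of the equation.
  have hnz : ∀ x, φ x ≠ 0 := by
    intro x
    have hit : ∀ k : ℕ, ∀ y, φ y ≠ 0 → φ ((√2) ^ k • y) ≠ 0 := by
      intro k
      induction k with
      | zero => intro y hy; simpa using hy
      | succ k ih =>
        intro y hy
        have h1 := ih y hy
        have h2 := hdbl ((√2) ^ k • y)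
        rw [smul_smul, ← pow_succ'] at h2
        intro h3
        rw [h3, zero_mul] at h2
        exact mul_ne_zero h1 h1 h2
    have ht : Tendsto (fun k : ℕ => ((√2)⁻¹ ^ k) • x) atTop (𝓝 0) := by
      have h1 : (√2)⁻¹ < 1 := inv_lt_one_of_one_lt₀ (by
        rw [Real.lt_sqrt zero_le_one]; norm_num)
      simpa using (tendsto_pow_atTop_nhds_zero_of_lt_one (by positivity) h1).smul_const x
    have hev := (hc.tendsto 0).comp ht |>.eventually (isOpen_ne.mem_nhds h0)
    obtain ⟨k, hk⟩ := hev.exists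
    have := hit k _ hk
    rwa [smul_smul, ← mul_pow, mul_inv_cancel₀ (by positivity), one_pow, one_smul] at this
  obtain ⟨l, hl, hexp⟩ := exists_continuous_log hc hnz
  have hconst : ∀ s t, l s + l t - l ((√2)⁻¹ • (s + t)) - l ((√2)⁻¹ • (s - t)) = 0 := by
    have hcont : Continuous fun p : E × E =>
        l p.1 + l p.2 - l ((√2)⁻¹ • (p.1 + p.2)) - l ((√2)⁻¹ • (p.1 - p.2)) := by fun_prop
    -- The equation for the logarithm holds modulo `2πi`. The integer depends continuously on the
    -- pair, hence is constant, and it is zero at the origin.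
    have hInt : ∀ p : E × E, ∃ k : ℤ, l p.1 + l p.2 - l ((√2)⁻¹ • (p.1 + p.2)) -
        l ((√2)⁻¹ • (p.1 - p.2)) = k * (2 * Real.pi * Complex.I) := by
      intro p
      rw [← Complex.exp_eq_one_iff, sub_sub, Complex.exp_sub, Complex.exp_add, Complex.exp_add,
        hexp, hexp, hexp, hexp, hφ, div_self (mul_ne_zero (hnz _) (hnz _))]
    choose k hk using hInt
    have hkc : Continuous k := by
      have h1 : Continuous fun p => (k p : ℝ) := by
        have h2 : (fun p => (k p : ℝ)) = fun p => ((l p.1 + l p.2 - l ((√2)⁻¹ • (p.1 + p.2)) -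
            l ((√2)⁻¹ • (p.1 - p.2))) / (2 * Real.pi * Complex.I)).re := by
          funext p
          rw [hk p, mul_div_cancel_right₀ _ Complex.two_pi_I_ne_zero, Complex.intCast_re]
        rw [h2]
        exact Complex.continuous_re.comp (hcont.div_const _)
      exact Int.isClosedEmbedding_coe_real.isEmbedding.continuous_iff.2 h1
    intro s t
    have h1 := PreconnectedSpace.constant (inferInstance : PreconnectedSpace (E × E)) hkc
      (x := (s, t)) (y := (0, 0))
    have h2 := hk (0, 0)
    have h3 := hk (s, t)
    simp only [add_zero, sub_zero, smul_zero] at h2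
    simp only at h3
    rw [h3, h1, ← h2]
    ring
  have hl' : ∀ s, l (√2 • s) - l 0 = 2 * (l s - l 0) := fun s => by
    have := hconst s s
    rw [sub_self, smul_zero, sqrt_two_inv_smul_add] at this
    linear_combination -this
  -- Substituting `√2 • x` and `√2 • y` and using the doubling rule `hl'` gives the parallelogram
  -- law for `l - l 0`.
  obtain ⟨D, hD⟩ := exists_bilinear_of_parallelogram (l := fun x => l x - l 0)
    (by fun_prop) (fun x y => by
      have h1 := hconst (√2 • x) (√2 • y)
      rw [← smul_add, ← smul_sub, inv_smul_smul₀ (by positivity), inv_smul_smul₀ (by positivity)]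
        at h1
      linear_combination hl' x + hl' y - h1)
  refine ⟨l 0, D, fun s => ?_⟩
  rw [← hD, sub_add_cancel, hexp]

end Gaussian

/-! ### Measurable solutions of the Gaussian functional equation -/

section Gaussian

variable {E : Type*} [NormedAddCommGroup E] [NormedSpace ℝ E] [FiniteDimensional ℝ E]
  [MeasurableSpace E] [BorelSpace E] {μ : Measure E} [μ.IsAddHaarMeasure]

lemma quasiMeasurePreserving_sqrt_two_inv_smul :
    Measure.QuasiMeasurePreserving (fun x : E => (√2)⁻¹ • x) μ μ := by
  refine ⟨by fun_prop, ?_⟩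
  rw [Measure.map_addHaar_smul μ (by positivity)]
  exact Measure.smul_absolutelyContinuous

/-- A measurable solution of the functional equation of Gaussians is locally bounded. -/
lemma locally_bounded_of_ae {φ : E → ℂ} (hm : Measurable φ)
    (hφ : ∀ᵐ s ∂μ, ∀ᵐ t ∂μ, φ s * φ t = φ ((√2)⁻¹ • (s + t)) * φ ((√2)⁻¹ • (s - t)))
    (hne : ¬ φ =ᵐ[μ] 0) (R : ℝ) : ∃ C : ℝ, ∀ᵐ x ∂μ, ‖x‖ ≤ R → ‖φ x‖ ≤ C := by
  have hsq : (1 : ℝ) ≤ √2 := by rw [Real.one_le_sqrt]; norm_num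
  -- A bounded set of positive measure on which `φ` is bounded below, against which the bounded sets
  -- `{|φ| > M}`, of measure tending to zero, will be compared.
  obtain ⟨k, hk⟩ : ∃ k : ℕ, μ {y | ‖y‖ ≤ k ∧ 1 / ((k : ℝ) + 1) ≤ ‖φ y‖} ≠ 0 := by
    by_contra h
    push Not at h
    apply hne
    have h1 := measure_iUnion_null_iff.2 h
    rw [Filter.EventuallyEq, ae_iff]
    refine measure_mono_null (fun y hy => ?_) h1
    obtain ⟨a, ha⟩ := exists_nat_ge ‖y‖
    obtain ⟨b, hb⟩ := exists_nat_one_div_lt (norm_pos_iff.2 (show φ y ≠ 0 from hy))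
    refine mem_iUnion.2 ⟨max a b, ?_, ?_⟩
    · exact ha.trans (by exact_mod_cast le_max_left a b)
    · refine le_trans ?_ hb.le
      gcongr
      exact_mod_cast le_max_right a b
  obtain ⟨A, hA⟩ : ∃ A, A = {y | ‖y‖ ≤ k ∧ 1 / ((k : ℝ) + 1) ≤ ‖φ y‖} := ⟨_, rfl⟩
  rw [← hA] at hk
  obtain ⟨T, hT⟩ : ∃ T : ℕ → Set E, T = fun M : ℕ => {z | ‖z‖ ≤ R + k ∧ (M : ℝ) < ‖φ z‖} :=
    ⟨_, rfl⟩
  have hTm : ∀ M, MeasurableSet (T M) := fun M => by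
    rw [hT]
    exact (measurableSet_le measurable_norm measurable_const).inter
      (measurableSet_lt measurable_const hm.norm)
  have hT0 : Tendsto (fun M => μ (T M)) atTop (𝓝 0) := by
    have h1 := tendsto_measure_iInter_atTop (μ := μ) (s := T) (fun M => (hTm M).nullMeasurableSet)
      (fun M N hMN z hz => by
        rw [hT] at hz ⊢
        exact ⟨hz.1, lt_of_le_of_lt (by exact_mod_cast hMN) hz.2⟩)
      ⟨0, ne_top_of_le_ne_top (measure_closedBall_lt_top (x := (0 : E)) (r := R + k)).ne
        (measure_mono fun z hz => by
          rw [hT] at hz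
          simpa using hz.1)⟩
    have h2 : ⋂ M, T M = ∅ := by
      refine eq_empty_iff_forall_notMem.2 fun z hz => ?_
      obtain ⟨M, hM⟩ := exists_nat_ge ‖φ z‖
      have := mem_iInter.1 hz M
      rw [hT] at this
      exact absurd this.2 (not_lt.2 hM)
    rw [h2, measure_empty] at h1
    exact h1
  obtain ⟨r, hr⟩ : ∃ r : ℝ≥0∞, r = ENNReal.ofReal |(((√2)⁻¹) ^ Module.finrank ℝ E)⁻¹| := ⟨_, rfl⟩
  have hplus : ∀ (S : Set E) x, μ {y | (√2)⁻¹ • (x + y) ∈ S} = r * μ S := by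
    intro S x
    rw [hr, ← Measure.addHaar_preimage_smul μ (by positivity),
      ← measure_preimage_add μ x ((fun z : E => (√2)⁻¹ • z) ⁻¹' S)]
    rfl
  have hminus : ∀ (S : Set E), MeasurableSet S → ∀ x, μ {y | (√2)⁻¹ • (x - y) ∈ S} = r * μ S := by
    intro S hS x
    rw [hr, ← Measure.addHaar_preimage_smul μ (by positivity),
      ← (Measure.measurePreserving_sub_left μ x).measure_preimage
        ((measurable_const_smul _ hS).nullMeasurableSet)]
    rfl
  obtain ⟨M, hM⟩ : ∃ M, r * μ (T M) + r * μ (T M) < μ A := by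
    have h1 : Tendsto (fun M => r * μ (T M) + r * μ (T M)) atTop (𝓝 0) := by
      have h2 := ENNReal.Tendsto.const_mul (a := r) hT0 (Or.inr (by rw [hr]; simp))
      simpa using h2.add h2
    exact (h1.eventually (gt_mem_nhds (pos_iff_ne_zero.2 hk))).exists
  refine ⟨M * M * (k + 1), ?_⟩
  filter_upwards [hφ] with x hx hxR
  -- The translated and scaled bad sets are too small to cover `A`. So some `y ∈ A` has both
  -- arguments on the right in the region `|φ| ≤ M`, and dividing by `φ y` bounds `φ x`.
  obtain ⟨y, hyA, hy1, hy2, hy3⟩ : ∃ y ∈ A, (√2)⁻¹ • (x + y) ∉ T M ∧ (√2)⁻¹ • (x - y) ∉ T M ∧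
      φ x * φ y = φ ((√2)⁻¹ • (x + y)) * φ ((√2)⁻¹ • (x - y)) := by
    by_contra h
    push Not at h
    refine absurd hM (not_lt.2 ?_)
    calc μ A ≤ μ (({y | (√2)⁻¹ • (x + y) ∈ T M} ∪ {y | (√2)⁻¹ • (x - y) ∈ T M}) ∪
          {y | ¬ (φ x * φ y = φ ((√2)⁻¹ • (x + y)) * φ ((√2)⁻¹ • (x - y)))}) := by
          refine measure_mono fun y hy => ?_
          by_cases h1 : (√2)⁻¹ • (x + y) ∈ T M
          · exact Or.inl (Or.inl h1)
          · by_cases h2 : (√2)⁻¹ • (x - y) ∈ T M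
            · exact Or.inl (Or.inr h2)
            · exact Or.inr (h y hy h1 h2)
      _ ≤ (r * μ (T M) + r * μ (T M)) + 0 := by
          refine (measure_union_le _ _).trans (add_le_add ((measure_union_le _ _).trans ?_) ?_)
          · rw [hplus, hminus _ (hTm M)]
          · exact (ae_iff.1 hx).le
      _ = _ := add_zero _
  rw [hA] at hyA
  have hle : ∀ z : E, ‖z‖ ≤ R + k → ‖(√2)⁻¹ • z‖ ≤ R + k := fun z hz => by
    rw [norm_smul, norm_inv, Real.norm_of_nonneg (by positivity)]
    exact (mul_le_of_le_one_left (norm_nonneg _) (inv_le_one_of_one_le₀ hsq)).trans hz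
  have hb1 : ‖φ ((√2)⁻¹ • (x + y))‖ ≤ M := by
    by_contra h
    apply hy1
    rw [hT]
    exact ⟨hle _ ((norm_add_le _ _).trans (add_le_add hxR hyA.1)), not_le.1 h⟩
  have hb2 : ‖φ ((√2)⁻¹ • (x - y))‖ ≤ M := by
    by_contra h
    apply hy2
    rw [hT]
    exact ⟨hle _ ((norm_sub_le _ _).trans (add_le_add hxR hyA.1)), not_le.1 h⟩
  have h4 : ‖φ x‖ * ‖φ y‖ ≤ M * M := by
    rw [← norm_mul, hy3, norm_mul]
    gcongr
  have h5 : ‖φ x‖ * (1 / ((k : ℝ) + 1)) ≤ M * M :=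
    (mul_le_mul_of_nonneg_left hyA.2 (norm_nonneg _)).trans h4
  rwa [mul_one_div, div_le_iff₀ (by positivity)] at h5

/-- Replacing one factor by a continuous compactly supported function close in `L¹` costs an error
uniform in `a`, since the other factors are bounded; the modified integral is continuous by
domination, even though its first factor is merely measurable. -/
lemma continuous_integral_mul_comp_sub {κ : E → ℂ} (hκ : Integrable κ μ) {C : ℝ}
    (hC : ∀ x, ‖κ x‖ ≤ C) {χ : E → ℝ} (hχ : Continuous χ) {K : ℝ} (hK : ∀ x, ‖χ x‖ ≤ K) :
    Continuous fun a => ∫ c, κ c * κ ((2 : ℝ) • a - c) * χ (c - a) ∂μ := by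
  have hC0 : 0 ≤ C := (norm_nonneg _).trans (hC 0)
  have hK0 : 0 ≤ K := (norm_nonneg _).trans (hK 0)
  refine continuous_of_uniform_approx_of_continuous fun u hu => ?_
  obtain ⟨ε, hε, hεu⟩ := Metric.mem_uniformity_dist.1 hu
  obtain ⟨g, hgc, hg, hgcont, hgint⟩ :=
    hκ.exists_hasCompactSupport_integral_sub_le (ε := ε / 2 / (C * K + 1)) (by positivity)
  obtain ⟨M, hM⟩ := hgc.exists_bound_of_continuous hgcont
  have hbound : ∀ a, Integrable (fun c => κ c * g ((2 : ℝ) • a - c) * χ (c - a)) μ := by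
    intro a
    refine (hκ.mul_bdd (c := M) (hgcont.comp (by fun_prop)).aestronglyMeasurable
      (ae_of_all _ fun c => hM _)).mul_bdd (c := K) ?_ (ae_of_all _ fun c => ?_)
    · exact (Complex.continuous_ofReal.comp (hχ.comp (by fun_prop))).aestronglyMeasurable
    · rw [Complex.norm_real]; exact hK _
  refine ⟨fun a => ∫ c, κ c * g ((2 : ℝ) • a - c) * χ (c - a) ∂μ, ?_, fun a => hεu ?_⟩
  · refine continuous_of_dominated (bound := fun c => ‖κ c‖ * M * K)
      (fun a => (hbound a).aestronglyMeasurable) (fun a => ae_of_all _ fun c => ?_)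
      ((hκ.norm.mul_const _).mul_const _) (ae_of_all _ fun c => by fun_prop)
    rw [norm_mul, norm_mul, Complex.norm_real]
    have hM0 : 0 ≤ M := (norm_nonneg _).trans (hM 0)
    gcongr
    · exact hM _
    · exact hK _
  · have hd : Integrable (fun c => ‖κ ((2 : ℝ) • a - c) - g ((2 : ℝ) • a - c)‖) μ :=
      ((hκ.sub hgint).comp_sub_left ((2 : ℝ) • a)).norm
    have hκ2 : Integrable (fun c => κ c * κ ((2 : ℝ) • a - c) * χ (c - a)) μ := by
      refine ((hκ.comp_sub_left ((2 : ℝ) • a)).bdd_mul (c := C) hκ.aestronglyMeasurable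
        (ae_of_all _ hC)).mul_bdd (c := K) ?_ (ae_of_all _ fun c => ?_)
      · exact (Complex.continuous_ofReal.comp (hχ.comp (by fun_prop))).aestronglyMeasurable
      · rw [Complex.norm_real]; exact hK _
    rw [dist_eq_norm, ← integral_sub hκ2 (hbound a)]
    calc _ ≤ ∫ c, C * K * ‖κ ((2 : ℝ) • a - c) - g ((2 : ℝ) • a - c)‖ ∂μ := by
          refine norm_integral_le_of_norm_le (hd.const_mul _) (ae_of_all _ fun c => ?_)
          rw [← sub_mul, ← mul_sub, norm_mul, norm_mul, Complex.norm_real, mul_right_comm]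
          gcongr
          · exact hC _
          · exact hK _
      _ ≤ C * K * (ε / 2 / (C * K + 1)) := by
          rw [integral_const_mul, integral_sub_left_eq_self (fun c => ‖κ c - g c‖) μ]
          gcongr
      _ < ε := by
          rw [mul_div_assoc', div_lt_iff₀ (by positivity)]
          nlinarith [mul_nonneg hC0 hK0]

/-- Near a given `a₀` only values of `k` on a fixed ball matter, so `k` may be truncated to a
bounded integrable function. -/
lemma continuous_integral_mul_mul {k : E → ℂ} (hk : Measurable k)
    (hb : ∀ R : ℝ, ∃ C : ℝ, ∀ᵐ x ∂μ, ‖x‖ ≤ R → ‖k x‖ ≤ C) {χ : E → ℝ} (hχ : Continuous χ)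
    (hχc : HasCompactSupport χ) :
    Continuous fun a => ∫ b, k (a + b) * k (a - b) * χ b ∂μ := by
  obtain ⟨K, hK⟩ := hχc.exists_bound_of_continuous hχ
  obtain ⟨ρ, hρ⟩ := hχc.isBounded.subset_closedBall (0 : E)
  refine continuous_iff_continuousAt.2 fun a₀ => ?_
  obtain ⟨C, hC⟩ := hb (‖a₀‖ + 1 + ρ)
  have hS : MeasurableSet {x | ‖x‖ ≤ ‖a₀‖ + 1 + ρ ∧ ‖k x‖ ≤ C} :=
    (measurableSet_le measurable_norm measurable_const).inter
      (measurableSet_le hk.norm measurable_const)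
  obtain ⟨κ, hκ⟩ : ∃ κ, κ = {x | ‖x‖ ≤ ‖a₀‖ + 1 + ρ ∧ ‖k x‖ ≤ C}.indicator k := ⟨_, rfl⟩
  have hκb : ∀ x, ‖κ x‖ ≤ |C| := fun x => by
    rw [hκ, norm_indicator_eq_indicator_norm]
    exact indicator_le' (fun y hy => hy.2.trans (le_abs_self C)) (fun y _ => abs_nonneg C) x
  have hκi : Integrable κ μ := by
    rw [hκ, integrable_indicator_iff hS]
    refine Measure.integrableOn_of_bounded (M := C) ?_ hk.aestronglyMeasurable ?_
    · refine ne_top_of_le_ne_top (measure_closedBall_lt_top (x := (0 : E))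
        (r := ‖a₀‖ + 1 + ρ)).ne (measure_mono fun x hx => ?_)
      simpa using hx.1
    · filter_upwards [ae_restrict_mem hS] with x hx
      exact hx.2
  have hκe : ∀ᵐ x ∂μ, ‖x‖ ≤ ‖a₀‖ + 1 + ρ → k x = κ x := by
    filter_upwards [hC] with x hx hxr
    rw [hκ, indicator_of_mem]
    exact ⟨hxr, hx hxr⟩
  have hcont := continuous_integral_mul_comp_sub hκi hκb hχ hK
  refine hcont.continuousAt.congr ?_
  filter_upwards [Metric.ball_mem_nhds a₀ one_pos] with a ha
  have han : ‖a‖ ≤ ‖a₀‖ + 1 := by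
    have h1 : ‖a - a₀‖ < 1 := by rwa [← dist_eq_norm]
    have h2 := norm_add_le (a - a₀) a₀
    rw [sub_add_cancel] at h2
    linarith
  rw [← integral_add_left_eq_self _ a]
  refine integral_congr_ae ?_
  filter_upwards [(measurePreserving_add_left μ a).quasiMeasurePreserving.ae hκe,
    (Measure.measurePreserving_sub_left μ a).quasiMeasurePreserving.ae hκe] with b h1 h2
  rw [show (2 : ℝ) • a - (a + b) = a - b by rw [two_smul]; abel, add_sub_cancel_left]
  by_cases hb0 : χ b = 0
  · simp [hb0]
  · have hbρ : ‖b‖ ≤ ρ := by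
      simpa using hρ (subset_tsupport χ hb0)
    rw [h1 ((norm_add_le _ _).trans (add_le_add han hbρ)),
      h2 ((norm_sub_le _ _).trans (add_le_add han hbρ))]

/-- Measurable solutions of the functional equation are Gaussians. -/
theorem exists_bilinear_of_ae {φ : E → ℂ} (hm : Measurable φ)
    (hφ : ∀ᵐ p ∂μ.prod μ,
      φ p.1 * φ p.2 = φ ((√2)⁻¹ • (p.1 + p.2)) * φ ((√2)⁻¹ • (p.1 - p.2)))
    (hne : ¬ φ =ᵐ[μ] 0) :
    ∃ (c : ℂ) (D : E →ₗ[ℝ] E →ₗ[ℝ] ℂ), ∀ᵐ s ∂μ, φ s = Complex.exp (D s s + c) := by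
  have hφ' := Measure.ae_ae_of_ae_prod hφ
  have hb := locally_bounded_of_ae hm hφ' hne
  have hloc : LocallyIntegrable φ μ := by
    intro x
    obtain ⟨C, hC⟩ := hb (‖x‖ + 1)
    refine ⟨Metric.ball x 1, Metric.ball_mem_nhds x one_pos, ?_⟩
    refine Measure.integrableOn_of_bounded (M := C) measure_ball_lt_top.ne
      hm.aestronglyMeasurable ?_
    filter_upwards [ae_restrict_of_ae hC, ae_restrict_mem measurableSet_ball] with y hy hyx
    refine hy ?_
    have h1 : ‖y - x‖ < 1 := by rwa [← dist_eq_norm]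
    have h2 := norm_add_le (y - x) x
    rw [sub_add_cancel] at h2
    linarith
  -- Integrating the functional equation in `t` against `χ` expresses `φ(s) ∫ χ φ` by an integral
  -- continuous in `s`. As `∫ χ φ ≠ 0`, `φ` agrees almost everywhere with a continuous function,
  -- which satisfies the equation everywhere.
  obtain ⟨χ, hχ, hχc, hχ0⟩ : ∃ χ : E → ℝ, Continuous χ ∧ HasCompactSupport χ ∧
      ∫ x, χ x • φ x ∂μ ≠ 0 := by
    by_contra h
    push Not at h
    exact hne (ae_eq_zero_of_integral_contDiff_smul_eq_zero hloc
      fun g hg hgc => h g hg.continuous hgc)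
  have hkm : Measurable fun x => φ ((√2)⁻¹ • x) := by fun_prop
  have hkb : ∀ R : ℝ, ∃ C : ℝ, ∀ᵐ x ∂μ, ‖x‖ ≤ R → ‖φ ((√2)⁻¹ • x)‖ ≤ C := by
    intro R
    obtain ⟨C, hC⟩ := hb ((√2)⁻¹ * R)
    refine ⟨C, ?_⟩
    filter_upwards [quasiMeasurePreserving_sqrt_two_inv_smul.ae hC] with x hx hxR
    refine hx ?_
    rw [norm_smul, norm_inv, Real.norm_of_nonneg (by positivity)]
    gcongr
  have hG := continuous_integral_mul_mul (μ := μ) hkm hkb hχ hχc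
  obtain ⟨ψ, hψ⟩ : ∃ ψ : E → ℂ, ψ = fun a => (∫ b, φ ((√2)⁻¹ • (a + b)) *
      φ ((√2)⁻¹ • (a - b)) * χ b ∂μ) / ∫ x, χ x • φ x ∂μ := ⟨_, rfl⟩
  have hψc : Continuous ψ := by rw [hψ]; exact hG.div_const _
  have hψe : φ =ᵐ[μ] ψ := by
    filter_upwards [hφ'] with a ha
    rw [hψ, eq_div_iff hχ0, ← integral_const_mul]
    refine integral_congr_ae ?_
    filter_upwards [ha] with b hb
    rw [← hb, Complex.real_smul]
    ring
  have hq1 : Measure.QuasiMeasurePreserving (fun p : E × E => (√2)⁻¹ • (p.1 + p.2))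
      (μ.prod μ) μ :=
    quasiMeasurePreserving_sqrt_two_inv_smul.comp (quasiMeasurePreserving_add μ μ)
  have hq2 : Measure.QuasiMeasurePreserving (fun p : E × E => (√2)⁻¹ • (p.1 - p.2))
      (μ.prod μ) μ :=
    quasiMeasurePreserving_sqrt_two_inv_smul.comp (quasiMeasurePreserving_sub μ μ)
  have hae : (fun p : E × E => ψ p.1 * ψ p.2) =ᵐ[μ.prod μ] fun p =>
      ψ ((√2)⁻¹ • (p.1 + p.2)) * ψ ((√2)⁻¹ • (p.1 - p.2)) := by
    filter_upwards [hφ, Measure.quasiMeasurePreserving_fst.ae hψe,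
      Measure.quasiMeasurePreserving_snd.ae hψe, hq1.ae hψe, hq2.ae hψe] with p h1 h2 h3 h4 h5
    rw [← h2, ← h3, ← h4, ← h5, h1]
  have heq := (Continuous.ae_eq_iff_eq (μ.prod μ) (by fun_prop) (by fun_prop)).1 hae
  obtain ⟨c, D, hD⟩ := exists_bilinear_of_continuous hψc
    (fun s t => congrFun heq (s, t)) (by
      by_contra h
      push Not at h
      exact hne (hψe.trans (ae_of_all _ h)))
  refine ⟨c, D, ?_⟩
  filter_upwards [hψe] with s hs
  rw [hs, hD]

end Gaussian

/-! ### Vanishing defect: reduction to the Gaussian equation -/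

/-- The sum of two null vectors. -/
def coneSum (y z : Cone n) : LightCone n :=
  (y.1 + z.1, y.1 * ‖y.2‖ ^ 2 + z.1 * ‖z.2‖ ^ 2, y.1 • y.2 + z.1 • z.2)

lemma coneSum_comm (y z : Cone n) : coneSum y z = coneSum z y := by
  simp only [coneSum, add_comm]

/-- The component of the null vector in the direction `w` when `p` is written as a sum of two
null vectors. -/
def share (p : LightCone n) (w : Space n) : ℝ := -boxQ p / linL p w

/-- The numerator and the denominator of `exchange` are invariants of the sum of the two null
vectors; this is why the exchange equation sees only that sum. -/
lemma exchange_eq_share (y z : Cone n) (w : Space n) :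
    exchange y z w = share (coneSum y z) w := by
  have h1 : y.1 * ‖y.2 - z.2‖ ^ 2 * z.1 = -boxQ (coneSum y z) := by
    simp only [boxQ, coneSum, norm_sub_sq_real, norm_add_sq_real, norm_smul, Real.norm_eq_abs,
      mul_pow, sq_abs, inner_smul_left, inner_smul_right, conj_trivial]
    ring
  have h2 : y.1 * ‖y.2 - w‖ ^ 2 + z.1 * ‖w - z.2‖ ^ 2 = linL (coneSum y z) w := by
    simp only [linL, coneSum, norm_sub_sq_real, inner_add_left, inner_smul_left, conj_trivial,
      real_inner_comm z.2 w]
    ring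
  rw [exchange, share, h1, h2]

/-- The other null vector when `p` is written as a sum of two null vectors, one of them in the
direction `w`. -/
def remainder (p : LightCone n) (w : Space n) : Cone n :=
  (p.1 - share p w, (p.1 - share p w)⁻¹ • (p.2.2 - share p w • w))

@[fun_prop] lemma Measurable.remainder {α : Type*} [MeasurableSpace α] {f : α → LightCone n}
    {g : α → Space n} (hf : Measurable f) (hg : Measurable g) :
    Measurable fun a => remainder (f a) (g a) := by
  unfold HalfWave.remainder share; fun_prop

@[fun_prop] lemma Measurable.share {α : Type*} [MeasurableSpace α] {f : α → LightCone n}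
    {g : α → Space n} (hf : Measurable f) (hg : Measurable g) :
    Measurable fun a => share (f a) (g a) := by
  unfold HalfWave.share; fun_prop

@[fun_prop] lemma Measurable.coneSum {α : Type*} [MeasurableSpace α] {f g : α → Cone n}
    (hf : Measurable f) (hg : Measurable g) : Measurable fun a => coneSum (f a) (g a) := by
  unfold HalfWave.coneSum; fun_prop

lemma coneFst_exchange {y z : Cone n} {w : Space n} (hy : 0 < y.1) (hz : 0 < z.1)
    (hyz : y.2 ≠ z.2) (hw : y.2 ≠ w) :
    coneFst (coneDiff y (exchange y z w, w)) z.2 = remainder (coneSum y z) w := by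
  rw [coneFst, recoil_exchange hy hz hyz hw, exchange_eq_share, remainder, coneDiff]
  have h1 : z.1 + (y.1 - share (coneSum y z) w) = (coneSum y z).1 - share (coneSum y z) w := by
    simp only [coneSum]; ring
  have h2 : y.1 • y.2 - share (coneSum y z) w • w + z.1 • z.2 =
      (coneSum y z).2.2 - share (coneSum y z) w • w := by
    simp only [coneSum]; abel
  simp only [h1, h2]

/-- If the defect vanishes, then the product depends only on the sum of the null vectors. -/
theorem ae_eq_of_coneDefect_eq_zero (hn : 1 ≤ n) {β : ℝ} {Φ Ψ : Cone n → ℂ} (hΦ : Measurable Φ)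
    (hΨ : Measurable Ψ) (h : coneDefect β Φ Ψ = 0) :
    ∀ᵐ r ∂((coneMeasure n).prod (coneMeasure n)).prod (volume : Measure (Space n)),
      Φ r.1.1 * Ψ r.1.2 = Φ (remainder (coneSum r.1.1 r.1.2) r.2) *
        Ψ (share (coneSum r.1.1 r.1.2) r.2, r.2) := by
  have key := lintegral_fibre_pair hn (G := fun p => ENNReal.ofReal (boxQ p.1 ^ (2 * β)) *
    ‖Φ (coneFst p.1 p.2.1) * Ψ (coneSnd p.1 p.2.2) -
      Φ (coneFst p.1 p.2.2) * Ψ (coneSnd p.1 p.2.1)‖ₑ ^ 2) (by fun_prop)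
  rw [coneDefect] at h
  rw [h] at key
  have hmeas : MeasurableSet {r : (Cone n × Cone n) × Space n |
      Φ r.1.1 * Ψ r.1.2 = Φ (remainder (coneSum r.1.1 r.1.2) r.2) *
        Ψ (share (coneSum r.1.1 r.1.2) r.2, r.2)} :=
    measurableSet_eq_fun (by fun_prop) (by fun_prop)
  rw [Measure.ae_prod_iff_ae_ae hmeas]
  have hm2 : Measurable fun p : Cone n × Cone n =>
      ∫⁻ w, ENNReal.ofReal (exchangeWeight p.1 p.2 w) *
      (ENNReal.ofReal (boxQ (coneDiff p.1 (exchange p.1 p.2 w, w)) ^ (2 * β)) *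
        ‖Φ (coneFst (coneDiff p.1 (exchange p.1 p.2 w, w)) w) *
          Ψ (coneSnd (coneDiff p.1 (exchange p.1 p.2 w, w)) p.2.2) -
        Φ (coneFst (coneDiff p.1 (exchange p.1 p.2 w, w)) p.2.2) *
          Ψ (coneSnd (coneDiff p.1 (exchange p.1 p.2 w, w)) w)‖ₑ ^ 2) := by
    refine Measurable.lintegral_prod_right' (f := fun r : (Cone n × Cone n) × Space n =>
      ENNReal.ofReal (exchangeWeight r.1.1 r.1.2 r.2) *
      (ENNReal.ofReal (boxQ (coneDiff r.1.1 (exchange r.1.1 r.1.2 r.2, r.2)) ^ (2 * β)) *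
        ‖Φ (coneFst (coneDiff r.1.1 (exchange r.1.1 r.1.2 r.2, r.2)) r.2) *
          Ψ (coneSnd (coneDiff r.1.1 (exchange r.1.1 r.1.2 r.2, r.2)) r.1.2.2) -
        Φ (coneFst (coneDiff r.1.1 (exchange r.1.1 r.1.2 r.2, r.2)) r.1.2.2) *
          Ψ (coneSnd (coneDiff r.1.1 (exchange r.1.1 r.1.2 r.2, r.2)) r.2)‖ₑ ^ 2)) ?_
    fun_prop
  rw [← lintegral_prod _ hm2.aemeasurable, eq_comm, lintegral_eq_zero_iff hm2] at key
  have hpos : ∀ᵐ p ∂(coneMeasure n).prod (coneMeasure n),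
      0 < p.1.1 ∧ 0 < p.2.1 ∧ p.1.2 ≠ p.2.2 := by
    have hms : MeasurableSet {p : Cone n × Cone n | 0 < p.1.1 ∧ 0 < p.2.1 ∧ p.1.2 ≠ p.2.2} :=
      (measurableSet_lt measurable_const (measurable_fst.comp measurable_fst)).inter
        ((measurableSet_lt measurable_const (measurable_fst.comp measurable_snd)).inter
          (measurableSet_eq_fun (measurable_snd.comp measurable_fst)
            (measurable_snd.comp measurable_snd)).compl)
    rw [Measure.ae_prod_iff_ae_ae hms]
    filter_upwards [ae_coneMeasure_pos] with y hy
    filter_upwards [ae_coneMeasure_pos, ae_cone_snd_ne hn y.2] with z hz hyz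
    exact ⟨hy, hz, hyz⟩
  filter_upwards [key, hpos] with p hp ⟨hy, hz, hyz⟩
  rw [Pi.zero_apply, lintegral_eq_zero_iff (by fun_prop)] at hp
  filter_upwards [hp, ae_ne hn p.1.2] with w hw hwy
  have hwy' := hwy.symm
  -- Both weights in the defect are strictly positive here, so the determinant itself must vanish.
  have h1 := exchangeWeight_pos hy hz hyz hwy'
  have h2 := Real.rpow_pos_of_pos (boxQ_exchange_pos hy hz hyz hwy') (2 * β)
  simp only [Pi.zero_apply, mul_eq_zero, ENNReal.ofReal_eq_zero, not_le.2 h1, not_le.2 h2,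
    false_or, pow_eq_zero_iff two_ne_zero, enorm_eq_zero, sub_eq_zero] at hw
  rw [coneFst_coneDiff (z := (exchange p.1 p.2 w, w)) hy hwy', coneSnd, coneSnd,
    recoil_exchange hy hz hyz hwy', coneFst_exchange hy hz hyz hwy',
    recoil_coneDiff (z := (exchange p.1 p.2 w, w)) hy hwy', exchange_eq_share] at hw
  exact hw

/-- Square coordinates on the cone. -/
def toCone (s : Cone n) : Cone n := (s.1 ^ 2, s.1⁻¹ • s.2)

/-- The inverse of `toCone` on the half-space. -/
def ofCone (y : Cone n) : Cone n := (√y.1, √y.1 • y.2)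

@[fun_prop] lemma measurable_toCone : Measurable (toCone (n := n)) := by unfold toCone; fun_prop

lemma toCone_ofCone {y : Cone n} (hy : 0 < y.1) : toCone (ofCone y) = y := by
  rw [toCone, ofCone]
  simp only [Real.sq_sqrt hy.le]
  rw [inv_smul_smul₀ (Real.sqrt_pos.2 hy).ne']

lemma ofCone_toCone {s : Cone n} (hs : 0 < s.1) : ofCone (toCone s) = s := by
  rw [toCone, ofCone]
  simp only [Real.sqrt_sq hs.le]
  rw [smul_inv_smul₀ hs.ne']

lemma toCone_neg (s : Cone n) : toCone (-s) = toCone s := by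
  simp [toCone, inv_neg]

lemma coneMeasure_eq : coneMeasure n = volume.restrict (Ioi 0 ×ˢ univ) := by
  rw [coneMeasure, Measure.volume_eq_prod, ← Measure.prod_restrict, Measure.restrict_univ]

lemma ae_coneMeasure_iff {p : Cone n → Prop} :
    (∀ᵐ y ∂coneMeasure n, p y) ↔ ∀ᵐ y : Cone n, 0 < y.1 → p y := by
  rw [coneMeasure_eq, ae_restrict_iff' (measurableSet_Ioi.prod MeasurableSet.univ)]
  simp

/-- Square coordinates cover the cone twice, by `s` and `-s`. The preimage of a null set lies in two
images of null sets under differentiable maps together with the hyperplane `s.1 = 0`. -/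
lemma ae_toCone {p : Cone n → Prop} (h : ∀ᵐ y ∂coneMeasure n, p y) : ∀ᵐ s, p (toCone s) := by
  rw [ae_coneMeasure_iff, ae_iff] at h
  have hd : DifferentiableOn ℝ (ofCone (n := n)) {y | ¬ (0 < y.1 → p y)} := by
    intro y hy
    have hy1 : y.1 ≠ 0 := by
      simp only [mem_ofPred_eq, Classical.not_imp] at hy
      exact hy.1.ne'
    have h1 : DifferentiableAt ℝ (fun y : Cone n => √y.1) y :=
      differentiableAt_fst.sqrt hy1
    exact (h1.prodMk (h1.smul differentiableAt_snd)).differentiableWithinAt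
  have h1 := addHaar_image_eq_zero_of_differentiableOn_of_addHaar_eq_zero volume hd h
  have h2 := addHaar_image_eq_zero_of_differentiableOn_of_addHaar_eq_zero volume hd.neg h
  have h3 : ∀ᵐ s : Cone n, s.1 ≠ 0 := by
    rw [Measure.volume_eq_prod]
    exact Measure.quasiMeasurePreserving_fst.ae (Measure.ae_ne volume 0)
  rw [ae_iff] at h3 ⊢
  refine measure_mono_null (fun s hs => ?_) (measure_union_null (measure_union_null h1 h2) h3)
  rcases lt_trichotomy s.1 0 with h0 | h0 | h0
  · refine Or.inl (Or.inr ⟨toCone s, ?_, ?_⟩)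
    · simp only [mem_ofPred_eq, Classical.not_imp]
      have := h0.ne
      exact ⟨by simp only [toCone]; positivity, hs⟩
    · have := ofCone_toCone (s := -s) (by simpa using h0)
      rw [toCone_neg] at this
      simp only [Pi.neg_apply, this, neg_neg]
  · exact Or.inr (by simpa using h0)
  · refine Or.inl (Or.inl ⟨toCone s, ?_, ofCone_toCone h0⟩)
    simp only [mem_ofPred_eq, Classical.not_imp]
    exact ⟨by simp only [toCone]; positivity, hs⟩

lemma ae_coneMeasure_of_toCone {p : Cone n → Prop} (h : ∀ᵐ s, p (toCone s)) :
    ∀ᵐ y ∂coneMeasure n, p y := by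
  rw [ae_coneMeasure_iff]
  have hd : DifferentiableOn ℝ (toCone (n := n)) {s | 0 < s.1 ∧ ¬ p (toCone s)} := by
    intro s hs
    exact ((differentiableAt_fst.pow 2).prodMk
      ((differentiableAt_fst.inv hs.1.ne').smul differentiableAt_snd)).differentiableWithinAt
  rw [ae_iff] at h ⊢
  have h1 := addHaar_image_eq_zero_of_differentiableOn_of_addHaar_eq_zero volume hd
    (measure_mono_null (fun s hs => hs.2) h)
  refine measure_mono_null (fun y hy => ?_) h1
  simp only [mem_ofPred_eq, Classical.not_imp] at hy
  refine ⟨ofCone y, ⟨Real.sqrt_pos.2 hy.1, ?_⟩, toCone_ofCone hy.1⟩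
  rw [toCone_ofCone hy.1]
  exact hy.2

lemma quasiMeasurePreserving_toCone_prod : Measure.QuasiMeasurePreserving
    (Prod.map (toCone (n := n)) (toCone (n := n))) volume
      ((coneMeasure n).prod (coneMeasure n)) := by
  have h : Measure.map (toCone (n := n)) volume ≪ coneMeasure n := by
    refine Measure.AbsolutelyContinuous.mk fun s hs h0 => ?_
    rw [Measure.map_apply measurable_toCone hs]
    have := ae_toCone (p := fun y => y ∉ s) (by rw [ae_iff]; simpa using h0)
    rw [ae_iff] at this
    change volume {a | toCone a ∈ s} = 0
    simpa using this
  refine ⟨by fun_prop, ?_⟩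
  rw [Measure.volume_eq_prod, ← Measure.map_prod_map _ _ measurable_toCone measurable_toCone]
  exact h.prod h

/-- Every component is a quadratic expression taken at `s` plus the same one taken at `t`, hence is
unchanged when the pair `(s, t)` is rotated. -/
lemma coneSum_toCone {s t : Cone n} (hs : s.1 ≠ 0) (ht : t.1 ≠ 0) :
    coneSum (toCone s) (toCone t) =
      (s.1 ^ 2 + t.1 ^ 2, ‖s.2‖ ^ 2 + ‖t.2‖ ^ 2, s.1 • s.2 + t.1 • t.2) := by
  have h : ∀ {s : Cone n}, s.1 ≠ 0 → s.1 ^ 2 * ‖s.1⁻¹ • s.2‖ ^ 2 = ‖s.2‖ ^ 2 ∧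
      s.1 ^ 2 • s.1⁻¹ • s.2 = s.1 • s.2 := fun {s} hs => by
    refine ⟨?_, ?_⟩
    · rw [norm_smul, norm_inv, mul_pow, inv_pow, Real.norm_eq_abs, sq_abs]
      field_simp
    · rw [smul_smul, sq, mul_assoc, mul_inv_cancel₀ hs, mul_one]
  simp only [coneSum, toCone, (h hs).1, (h hs).2, (h ht).1, (h ht).2]

/-- Rotation by `π/4` of pairs. -/
def rotPair (p : Cone n × Cone n) : Cone n × Cone n :=
  ((√2)⁻¹ • (p.1 + p.2), (√2)⁻¹ • (p.1 - p.2))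

lemma sqrt_two_inv_mul_self : (√2)⁻¹ * (√2)⁻¹ = 1 / 2 := by
  rw [← mul_inv, Real.mul_self_sqrt zero_le_two, one_div]

lemma rotPair_rotPair (p : Cone n × Cone n) : rotPair (rotPair p) = p := by
  simp only [rotPair, ← smul_add, ← smul_sub, smul_smul, sqrt_two_inv_mul_self, one_div]
  refine Prod.ext ?_ ?_
  · rw [show p.1 + p.2 + (p.1 - p.2) = (2 : ℝ) • p.1 by rw [two_smul]; abel,
      inv_smul_smul₀ two_ne_zero]
  · rw [show p.1 + p.2 - (p.1 - p.2) = (2 : ℝ) • p.2 by rw [two_smul]; abel,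
      inv_smul_smul₀ two_ne_zero]

instance : (volume : Measure (Cone n × Cone n)).IsAddHaarMeasure := by
  have h : (volume : Measure (Cone n)).IsAddHaarMeasure := inferInstance
  exact Measure.prod.instIsAddHaarMeasure (volume : Measure (Cone n)) (volume : Measure (Cone n))

lemma ae_rotPair {p : Cone n × Cone n → Prop} (h : ∀ᵐ x, p x) : ∀ᵐ x, p (rotPair x) := by
  rw [ae_iff] at h ⊢
  have hd : DifferentiableOn ℝ (rotPair (n := n)) {x | ¬ p x} := by
    unfold rotPair; fun_prop
  have h1 := addHaar_image_eq_zero_of_differentiableOn_of_addHaar_eq_zero volume hd h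
  refine measure_mono_null (fun x hx => ?_) h1
  exact ⟨rotPair x, hx, rotPair_rotPair x⟩

lemma coneSum_rotPair {p : Cone n × Cone n} (h1 : p.1.1 ≠ 0) (h2 : p.2.1 ≠ 0)
    (h3 : (rotPair p).1.1 ≠ 0) (h4 : (rotPair p).2.1 ≠ 0) :
    coneSum (toCone (rotPair p).1) (toCone (rotPair p).2) =
      coneSum (toCone p.1) (toCone p.2) := by
  rw [coneSum_toCone h1 h2, coneSum_toCone h3 h4]
  have h5 := sqrt_two_inv_mul_self
  simp only [rotPair, Prod.smul_fst, Prod.smul_snd, Prod.fst_add, Prod.snd_add, Prod.fst_sub,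
    Prod.snd_sub, smul_eq_mul, norm_smul, norm_inv, Real.norm_of_nonneg (Real.sqrt_nonneg 2)]
  refine Prod.ext ?_ (Prod.ext ?_ ?_)
  · linear_combination ((p.1.1 + p.2.1) ^ 2 + (p.1.1 - p.2.1) ^ 2) * h5
  · have h6 := norm_add_sq_real p.1.2 p.2.2
    have h7 := norm_sub_sq_real p.1.2 p.2.2
    simp only [mul_pow]
    linear_combination (‖p.1.2 + p.2.2‖ ^ 2 + ‖p.1.2 - p.2.2‖ ^ 2) * h5 + (h6 + h7) / 2
  · have h6 : ∀ (a : ℝ) (x : Space n), ((√2)⁻¹ * a) • (√2)⁻¹ • x = (1 / 2 * a) • x := by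
      intro a x
      rw [smul_smul, mul_right_comm, h5]
    simp only [h6]
    module

/-- The product depends only on a symmetric function of the pair, so exchanging the factors shows
that `Φ` and `Ψ` are proportional; rotation invariance in square coordinates then gives the Gaussian
equation for `Φ` alone. -/
theorem exists_bilinear_of_coneDefect_eq_zero (hn : 1 ≤ n) {β : ℝ} {Φ Ψ : Cone n → ℂ}
    (hΦ : Measurable Φ) (hΨ : Measurable Ψ) (h : coneDefect β Φ Ψ = 0)
    (hΦ0 : ¬ ∀ᵐ y ∂coneMeasure n, Φ y = 0) (hΨ0 : ¬ ∀ᵐ y ∂coneMeasure n, Ψ y = 0) :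
    ∃ (l c : ℂ) (D : Cone n →ₗ[ℝ] Cone n →ₗ[ℝ] ℂ), l ≠ 0 ∧
      (∀ᵐ y ∂coneMeasure n, Φ y = l * Ψ y) ∧
      ∀ᵐ y ∂coneMeasure n, Φ y = Complex.exp (y.1 * D (1, y.2) (1, y.2) + c) := by
  have h1 := ae_eq_of_coneDefect_eq_zero hn hΦ hΨ h
  have hmeas : MeasurableSet {r : (Cone n × Cone n) × Space n |
      Φ r.1.1 * Ψ r.1.2 = Φ (remainder (coneSum r.1.1 r.1.2) r.2) *
        Ψ (share (coneSum r.1.1 r.1.2) r.2, r.2)} :=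
    measurableSet_eq_fun (by fun_prop) (by fun_prop)
  rw [Measure.ae_prod_iff_ae_ae hmeas, Measure.ae_ae_comm hmeas] at h1
  -- One direction `w`, good for almost all pairs, is enough: with it the right side becomes a fixed
  -- function of the sum.
  obtain ⟨w, hw⟩ := h1.exists
  obtain ⟨Λ, hΛ⟩ : ∃ Λ : LightCone n → ℂ, Λ = fun p => Φ (remainder p w) * Ψ (share p w, w) :=
    ⟨_, rfl⟩
  have hst : ∀ᵐ p : Cone n × Cone n,
      Φ (toCone p.1) * Ψ (toCone p.2) = Λ (coneSum (toCone p.1) (toCone p.2)) := by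
    filter_upwards [quasiMeasurePreserving_toCone_prod.ae hw] with p hp
    rw [hΛ]
    exact hp
  have hsw : ∀ᵐ p : Cone n × Cone n,
      Φ (toCone p.1) * Ψ (toCone p.2) = Φ (toCone p.2) * Ψ (toCone p.1) := by
    have h2 := (Measure.measurePreserving_swap (μ := (volume : Measure (Cone n)))
      (ν := (volume : Measure (Cone n)))).quasiMeasurePreserving.ae hst
    filter_upwards [hst, h2] with p hp1 hp2
    rw [hp1, coneSum_comm]
    exact hp2.symm
  have hsw' := Measure.ae_ae_of_ae_prod
    ((Measure.measurePreserving_swap (μ := (volume : Measure (Cone n)))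
      (ν := (volume : Measure (Cone n)))).quasiMeasurePreserving.ae hsw)
  obtain ⟨t, ht, ht0⟩ : ∃ t : Cone n, (∀ᵐ s : Cone n,
      Φ (toCone s) * Ψ (toCone t) = Φ (toCone t) * Ψ (toCone s)) ∧ Ψ (toCone t) ≠ 0 := by
    by_contra hcon
    push Not at hcon
    refine hΨ0 (ae_coneMeasure_of_toCone ?_)
    filter_upwards [hsw'] with t ht
    exact hcon t ht
  have hl : ∀ᵐ s, Φ (toCone s) = Φ (toCone t) / Ψ (toCone t) * Ψ (toCone s) := by
    filter_upwards [ht] with s hs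
    field_simp
    rw [hs]
  have hl0 : Φ (toCone t) / Ψ (toCone t) ≠ 0 := by
    intro h0
    refine hΦ0 (ae_coneMeasure_of_toCone ?_)
    filter_upwards [hl] with s hs
    rw [hs, h0, zero_mul]
  obtain ⟨l, hldef⟩ : ∃ l, l = Φ (toCone t) / Ψ (toCone t) := ⟨_, rfl⟩
  rw [← hldef] at hl hl0
  have hfst : ∀ᵐ s : Cone n, s.1 ≠ 0 := by
    rw [Measure.volume_eq_prod]
    exact Measure.quasiMeasurePreserving_fst.ae (Measure.ae_ne volume 0)
  have hgood : ∀ᵐ p : Cone n × Cone n, p.1.1 ≠ 0 ∧ p.2.1 ≠ 0 ∧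
      Φ (toCone p.2) = l * Ψ (toCone p.2) ∧
      Φ (toCone p.1) * Ψ (toCone p.2) = Λ (coneSum (toCone p.1) (toCone p.2)) := by
    filter_upwards [hst, Measure.quasiMeasurePreserving_fst.ae hfst,
      Measure.quasiMeasurePreserving_snd.ae hfst,
      Measure.quasiMeasurePreserving_snd.ae hl] with p e1 e2 e3 e4
    exact ⟨e2, e3, e4, e1⟩
  have hfe : ∀ᵐ p : Cone n × Cone n, Φ (toCone p.1) * Φ (toCone p.2) =
      Φ (toCone ((√2)⁻¹ • (p.1 + p.2))) * Φ (toCone ((√2)⁻¹ • (p.1 - p.2))) := by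
    filter_upwards [hgood, ae_rotPair hgood] with p ⟨e1, e2, e3, e4⟩ ⟨f1, f2, f3, f4⟩
    rw [coneSum_rotPair e1 e2 f1 f2, ← e4] at f4
    change _ = Φ (toCone (rotPair p).1) * Φ (toCone (rotPair p).2)
    rw [e3, f3]
    linear_combination -l * f4
  obtain ⟨c, D, hD⟩ := exists_bilinear_of_ae (μ := volume) (φ := fun s => Φ (toCone s))
    (by fun_prop) hfe (fun h0 => hΦ0 (ae_coneMeasure_of_toCone h0))
  refine ⟨l, c, D, hl0, ae_coneMeasure_of_toCone hl, ?_⟩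
  have h3 : ∀ᵐ s : Cone n, Φ (toCone s) =
      Complex.exp ((toCone s).1 * D (1, (toCone s).2) (1, (toCone s).2) + c) := by
    filter_upwards [hD, hfst] with s hs hs0
    rw [hs]
    -- Homogeneity of degree two: the factor `s.1 ^ 2` is the component `u` and `s.1⁻¹ • s.2` is the
    -- direction.
    have h4 : s = s.1 • ((1, s.1⁻¹ • s.2) : Cone n) :=
      Prod.ext (by simp) (by simp [smul_inv_smul₀ hs0])
    congr 2
    conv_lhs => rw [h4]
    simp only [toCone, map_smul, LinearMap.smul_apply, Complex.real_smul]
    push_cast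
    ring
  exact ae_coneMeasure_of_toCone h3

/-! ### Isotropy of the quadratic form -/

lemma ae_ae_fibre_cone (hn : 1 ≤ n) {P Q : Cone n → Prop} (hP : ∀ᵐ y ∂coneMeasure n, P y)
    (hQ : ∀ᵐ y ∂coneMeasure n, Q y) :
    ∀ᵐ q : LightCone n, ∀ᵐ v : Space n, fibre q v ≠ 0 → P (coneFst q v) ∧ Q (coneSnd q v) := by
  obtain ⟨S, hSP, hSm, hS0⟩ := exists_measurable_superset_of_null (ae_iff.1 hP)
  obtain ⟨T, hTQ, hTm, hT0⟩ := exists_measurable_superset_of_null (ae_iff.1 hQ)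
  obtain ⟨J, hJ⟩ : ∃ J : LightCone n × Cone n × Cone n → ℝ≥0∞,
      J = fun p => S.indicator 1 p.2.1 + T.indicator 1 p.2.2 := ⟨_, rfl⟩
  have hi1 : Measurable (S.indicator (1 : Cone n → ℝ≥0∞)) := measurable_one.indicator hSm
  have hi2 : Measurable (T.indicator (1 : Cone n → ℝ≥0∞)) := measurable_one.indicator hTm
  have hJm : Measurable J := by rw [hJ]; fun_prop
  have h := lintegral_fibre hn hJm
  have hr : ∫⁻ y, ∫⁻ z, ENNReal.ofReal (y.1 ^ ((n : ℝ) - 1) * z.1 ^ ((n : ℝ) - 1)) *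
      J (coneDiff y z, y, z) ∂coneMeasure n ∂coneMeasure n = (0 : ℝ≥0∞) := by
    rw [← lintegral_zero (μ := coneMeasure n)]
    refine lintegral_congr_ae ?_
    filter_upwards [measure_eq_zero_iff_ae_notMem.1 hS0] with y hy
    rw [← lintegral_zero (μ := coneMeasure n)]
    refine lintegral_congr_ae ?_
    filter_upwards [measure_eq_zero_iff_ae_notMem.1 hT0] with z hz
    simp [hJ, hy, hz]
  rw [hr, lintegral_eq_zero_iff (by fun_prop)] at h
  filter_upwards [h] with q hq
  rw [Pi.zero_apply, lintegral_eq_zero_iff (by fun_prop)] at hq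
  filter_upwards [hq] with v hv hne
  have h0 : 0 < fibre q v := (fibre_nonneg q v).lt_of_ne' hne
  simp only [Pi.zero_apply, mul_eq_zero, ENNReal.ofReal_eq_zero, not_le.2 h0, false_or, hJ,
    add_eq_zero, indicator_apply_eq_zero, Pi.one_apply, one_ne_zero, imp_false] at hv
  exact ⟨not_not.1 fun hc => hv.1 (hSP hc), not_not.1 fun hc => hv.2 (hTQ hc)⟩

/-- Allows the data to be replaced by their continuous exponential representatives, so that the
exchange equation can afterwards be evaluated at single points. -/
lemma coneDefect_congr (hn : 1 ≤ n) {β : ℝ} {Φ Ψ Φ' Ψ' : Cone n → ℂ}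
    (hΦ : ∀ᵐ y ∂coneMeasure n, Φ y = Φ' y) (hΨ : ∀ᵐ y ∂coneMeasure n, Ψ y = Ψ' y) :
    coneDefect β Φ Ψ = coneDefect β Φ' Ψ' := by
  refine lintegral_congr_ae ?_
  filter_upwards [ae_ae_fibre_cone hn hΦ hΨ] with q hq
  refine lintegral_congr_ae ?_
  filter_upwards [hq] with v hv
  by_cases h0 : fibre q v = 0
  · simp [h0]
  congr 1
  refine lintegral_congr_ae ?_
  filter_upwards [hq] with v' hv'
  by_cases h0' : fibre q v' = 0
  · simp [h0']
  rw [(hv h0).1, (hv h0).2, (hv' h0').1, (hv' h0').2]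

lemma eq_of_ae_eq_of_continuousAt {X : Type*} [TopologicalSpace X] [MeasurableSpace X]
    (μ : Measure X) [μ.IsOpenPosMeasure] {f g : X → ℂ} {x : X} {P : X → Prop}
    (h : ∀ᵐ y ∂μ, P y → f y = g y) (hP : ∀ᶠ y in 𝓝 x, P y) (hf : ContinuousAt f x)
    (hg : ContinuousAt g x) : f x = g x := by
  have hd := Measure.dense_of_ae h
  have hne : (𝓝[{y | P y → f y = g y}] x).NeBot := mem_closure_iff_nhdsWithin_neBot.1 (hd x)
  refine tendsto_nhds_unique (l := 𝓝[{y | P y → f y = g y}] x)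
    (hf.tendsto.mono_left nhdsWithin_le_nhds) ((hg.tendsto.mono_left nhdsWithin_le_nhds).congr' ?_)
  filter_upwards [self_mem_nhdsWithin, mem_nhdsWithin_of_mem_nhds hP] with y h1 h2
  exact (h1 h2).symm

/-- At `t = 1/(‖z‖ + 1)` the imaginary part of `t z` is below `1 < π`, where the exponential is
injective. -/
lemma eq_zero_of_exp_smul_eq_one {z : ℂ} (h : ∀ t : ℝ, 0 < t → Complex.exp (t * z) = 1) :
    z = 0 := by
  have hpos : 0 < ‖z‖ + 1 := by positivity
  have h1 := h (‖z‖ + 1)⁻¹ (by positivity)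
  have hb : |(((‖z‖ + 1)⁻¹ : ℝ) * z : ℂ).im| < 1 := by
    refine (Complex.abs_im_le_norm _).trans_lt ?_
    rw [norm_mul, Complex.norm_real, norm_inv, Real.norm_of_nonneg hpos.le, inv_mul_lt_iff₀ hpos]
    linarith
  have hpi := Real.pi_gt_three
  rw [abs_lt] at hb
  rw [← Complex.exp_zero] at h1
  have h2 := Complex.exp_inj_of_neg_pi_lt_of_le_pi (by linarith [hb.1]) (by linarith [hb.2])
    (by simpa using Real.pi_pos) (by simpa using Real.pi_pos.le) h1
  rcases mul_eq_zero.1 h2 with h3 | h3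
  · rw [Complex.ofReal_eq_zero] at h3
    exact absurd h3 (by positivity)
  · exact h3

/-- Null vectors with component `t` and directions `e`, `-e` have a sum that depends only on `t` and
`‖e‖`; so the splitting of it in a direction `w` of equal length is again symmetric. -/
lemma share_symm {e w : Space n} {t : ℝ} (ht : 0 < t) (hew : ‖w‖ = ‖e‖) (he : e ≠ 0) :
    share (coneSum (t, e) (t, -e)) w = t := by
  have h0 : 0 < ‖e‖ := norm_pos_iff.2 he
  simp only [share, boxQ, linL, coneSum, smul_neg, add_neg_cancel, norm_neg, norm_zero,
    inner_zero_left, hew]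
  field_simp
  ring

lemma remainder_symm {e w : Space n} {t : ℝ} (ht : 0 < t) (hew : ‖w‖ = ‖e‖) (he : e ≠ 0) :
    remainder (coneSum (t, e) (t, -e)) w = (t, -w) := by
  rw [remainder, share_symm ht hew he]
  have h1 : (coneSum (t, e) (t, -e)).1 - t = t := by simp [coneSum]
  have h2 : (coneSum (t, e) (t, -e)).2.2 = 0 := by simp [coneSum]
  rw [h1, h2, zero_sub, smul_neg, inv_smul_smul₀ ht.ne']

lemma continuous_bilinear_self (D : Cone n →ₗ[ℝ] Cone n →ₗ[ℝ] ℂ) :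
    Continuous fun p : Cone n => D p p := by
  have h : ∀ p q, (LinearMap.toContinuousLinearMap
      ((LinearMap.toContinuousLinearMap : (Cone n →ₗ[ℝ] ℂ) ≃ₗ[ℝ] (Cone n →L[ℝ] ℂ)).toLinearMap
        ∘ₗ D)) p q = D p q := fun p q => rfl
  simp only [← h]
  fun_prop

lemma continuousAt_share {p : LightCone n} {w : Space n} (h : linL p w ≠ 0) :
    ContinuousAt (fun r : LightCone n × Space n => share r.1 r.2) (p, w) := by
  unfold share
  refine ContinuousAt.div ?_ ?_ h
  · unfold boxQ; fun_prop
  · unfold linL; fun_prop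

/-- The quadratic form of a solution of the exchange equation is isotropic. -/
theorem isotropic_of_coneDefect_eq_zero (hn : 1 ≤ n) {β : ℝ} {l c : ℂ}
    {D : Cone n →ₗ[ℝ] Cone n →ₗ[ℝ] ℂ} (hl : l ≠ 0)
    (h : coneDefect β (fun y => Complex.exp (y.1 * D (1, y.2) (1, y.2) + c))
      (fun y => l * Complex.exp (y.1 * D (1, y.2) (1, y.2) + c)) = 0) :
    ∃ κ : ℂ, ∀ v : Space n, D (0, v) (0, v) = κ * (‖v‖ : ℂ) ^ 2 := by
  obtain ⟨F, hF⟩ : ∃ F : Cone n → ℂ,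
      F = fun y => Complex.exp (y.1 * D (1, y.2) (1, y.2) + c) := ⟨_, rfl⟩
  have hFc : Continuous F := by
    have h1 : Continuous fun y : Cone n => D (1, y.2) (1, y.2) :=
      (continuous_bilinear_self D).comp (by fun_prop)
    rw [hF]
    exact Complex.continuous_exp.comp
      (((Complex.continuous_ofReal.comp continuous_fst).mul h1).add continuous_const)
  have hae := ae_eq_of_coneDefect_eq_zero hn (Φ := F) (Ψ := fun y => l * F y)
    hFc.measurable (hFc.measurable.const_mul l) (by rw [hF]; exact h)
  have hμ : ((coneMeasure n).prod (coneMeasure n)).prod (volume : Measure (Space n)) =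
      (volume : Measure ((Cone n × Cone n) × Space n)).restrict
        (((Ioi 0 ×ˢ univ) ×ˢ (Ioi 0 ×ˢ univ)) ×ˢ univ) := by
    rw [coneMeasure_eq, Measure.prod_restrict]
    conv_lhs => rw [← Measure.restrict_univ (μ := (volume : Measure (Space n))),
      Measure.prod_restrict]
    rfl
  rw [hμ, ae_restrict_iff' (((measurableSet_Ioi.prod MeasurableSet.univ).prod
    (measurableSet_Ioi.prod MeasurableSet.univ)).prod MeasurableSet.univ)] at hae
  have hop : (volume : Measure ((Cone n × Cone n) × Space n)).IsOpenPosMeasure :=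
    Measure.prod.instIsOpenPosMeasure (μ := (volume : Measure (Cone n × Cone n)))
      (ν := (volume : Measure (Space n)))
  -- Symmetric pairs form a null set, so the almost everywhere equation is carried to them by
  -- continuity of both sides at these points.
  have key : ∀ (t : ℝ) (e w : Space n), 0 < t → ‖w‖ = ‖e‖ → e ≠ 0 →
      F (t, e) * F (t, -e) = F (t, -w) * F (t, w) := by
    intro t e w ht hew he
    have h0 : 0 < ‖e‖ := norm_pos_iff.2 he
    have hL : linL (coneSum (t, e) (t, -e)) w ≠ 0 := by
      simp only [linL, coneSum, smul_neg, add_neg_cancel, norm_neg, inner_zero_left, hew]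
      have : 0 < t * ‖e‖ ^ 2 := by positivity
      nlinarith
    have hcs : Continuous fun r : (Cone n × Cone n) × Space n => (coneSum r.1.1 r.1.2, r.2) := by
      unfold coneSum; fun_prop
    have hsh : ContinuousAt (fun r : (Cone n × Cone n) × Space n =>
        share (coneSum r.1.1 r.1.2) r.2) (((t, e), (t, -e)), w) :=
      ContinuousAt.comp (g := fun r : LightCone n × Space n => share r.1 r.2)
        (f := fun r : (Cone n × Cone n) × Space n => (coneSum r.1.1 r.1.2, r.2))
        (continuousAt_share hL) hcs.continuousAt
    have hd : ContinuousAt (fun r : (Cone n × Cone n) × Space n =>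
        (coneSum r.1.1 r.1.2).1 - share (coneSum r.1.1 r.1.2) r.2) (((t, e), (t, -e)), w) :=
      (continuous_fst.comp (continuous_fst.comp hcs)).continuousAt.sub hsh
    have hrem : ContinuousAt (fun r : (Cone n × Cone n) × Space n =>
        remainder (coneSum r.1.1 r.1.2) r.2) (((t, e), (t, -e)), w) := by
      refine hd.prodMk ((hd.inv₀ ?_).smul
        ((continuous_snd.comp (continuous_snd.comp (continuous_fst.comp hcs))).continuousAt.sub
          (hsh.smul continuous_snd.continuousAt)))
      simp only
      rw [share_symm ht hew he]
      simpa [coneSum] using ht.ne'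
    have h1 := eq_of_ae_eq_of_continuousAt (volume : Measure ((Cone n × Cone n) × Space n))
      (x := (((t, e), (t, -e)), w)) hae ?_ ?_ ?_
    · simp only at h1
      rw [share_symm ht hew he, remainder_symm ht hew he] at h1
      refine mul_left_cancel₀ hl ?_
      linear_combination h1
    · refine IsOpen.mem_nhds (((isOpen_Ioi.prod isOpen_univ).prod
        (isOpen_Ioi.prod isOpen_univ)).prod isOpen_univ) ?_
      simp [ht]
    · have : Continuous fun r : (Cone n × Cone n) × Space n => F r.1.1 * (l * F r.1.2) := by
        fun_prop
      exact this.continuousAt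
    · refine (hFc.continuousAt.comp hrem).mul (continuousAt_const.mul ?_)
      exact ContinuousAt.comp (g := F) (f := fun r : (Cone n × Cone n) × Space n =>
        ((share (coneSum r.1.1 r.1.2) r.2, r.2) : Cone n)) hFc.continuousAt
        (hsh.prodMk continuous_snd.continuousAt)
  have hexp : ∀ v : Space n, D (1, v) (1, v) + D (1, -v) (1, -v) =
      2 * D (1, 0) (1, 0) + 2 * D (0, v) (0, v) := by
    intro v
    have e1 : ((1, v) : Cone n) = (1, 0) + (0, v) := by simp
    have e2 : ((1, -v) : Cone n) = (1, 0) - (0, v) := by simp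
    rw [e1, e2]
    simp only [map_add, map_sub, LinearMap.add_apply, LinearMap.sub_apply]
    ring
  have hiso : ∀ e w : Space n, ‖w‖ = ‖e‖ → D (0, e) (0, e) = D (0, w) (0, w) := by
    intro e w hew
    by_cases he : e = 0
    · have hw : w = 0 := by rw [← norm_eq_zero, hew, he, norm_zero]
      rw [he, hw]
    · have h2 : 2 * (D (0, e) (0, e) - D (0, w) (0, w)) = 0 := by
        refine eq_zero_of_exp_smul_eq_one fun t ht => ?_
        have h3 := key t e w ht hew he
        simp only [hF] at h3
        rw [← Complex.exp_add, ← Complex.exp_add] at h3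
        have h4 : (t : ℂ) * (2 * (D (0, e) (0, e) - D (0, w) (0, w))) =
            (t * D (1, e) (1, e) + c + (t * D (1, -e) (1, -e) + c)) -
            (t * D (1, -w) (1, -w) + c + (t * D (1, w) (1, w) + c)) := by
          linear_combination t * hexp w - t * hexp e
        rw [h4, Complex.exp_sub, h3, div_self (Complex.exp_ne_zero _)]
      linear_combination h2 / 2
  obtain ⟨e, he⟩ : ∃ e : Space n, ‖e‖ = 1 := ⟨EuclideanSpace.single ⟨0, hn⟩ 1, by simp⟩
  refine ⟨D (0, e) (0, e), fun v => ?_⟩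
  rw [hiso v (‖v‖ • e) (by rw [norm_smul, he, norm_norm, mul_one])]
  have h5 : ((0, ‖v‖ • e) : Cone n) = ‖v‖ • ((0, e) : Cone n) := by simp
  rw [h5]
  simp only [map_smul, LinearMap.smul_apply, Complex.real_smul]
  ring

/-! ### Vanishing defect and exponential data -/

lemma ae_of_ae_pt (hn : 1 ≤ n) {p : Space (n + 1) → Prop} (hp : MeasurableSet {ξ | p ξ})
    (h : ∀ᵐ y ∂coneMeasure n, p (pt y.1 y.2)) : ∀ᵐ ξ, p ξ := by
  have h1 := lintegral_pt_cone hn (H := {ξ | p ξ}ᶜ.indicator 1)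
    (measurable_one.indicator hp.compl)
  rw [lintegral_indicator_one hp.compl] at h1
  rw [ae_iff]
  refine h1.trans ?_
  rw [← lintegral_zero (μ := coneMeasure n)]
  refine lintegral_congr_ae ?_
  filter_upwards [h] with y hy
  rw [indicator_of_notMem (by simpa using hy), mul_zero]

lemma norm_pt_pos {y : Cone n} (hy : 0 < y.1) : 0 < ‖pt y.1 y.2‖ := by
  rw [norm_pt hy.le]; positivity

lemma not_ae_lift_eq_zero (hn : 1 ≤ n) {f : Space (n + 1) → ℂ} (hf : Measurable f)
    (h : ¬ f =ᵐ[volume] 0) : ¬ ∀ᵐ y ∂coneMeasure n, lift f y = 0 := by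
  refine fun h0 => h (ae_of_ae_pt hn (measurableSet_eq_fun hf measurable_const) ?_)
  filter_upwards [h0, ae_coneMeasure_pos] with y hy hpos
  have h1 : ((‖pt y.1 y.2‖ : ℝ) : ℂ) ≠ 0 := by exact_mod_cast (norm_pt_pos hpos).ne'
  exact (mul_eq_zero.1 hy).resolve_left h1

/-- The exponential in light-cone coordinates. -/
lemma exponent_pt {y : Cone n} (hy : 0 < y.1) (δ κ : ℂ) (T : Space n →ₗ[ℝ] ℂ) :
    (y.1 : ℂ) * (δ + T y.2 + κ * (‖y.2‖ : ℂ) ^ 2) = (δ + κ) * (‖pt y.1 y.2‖ : ℂ) +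
      ∑ i, Fin.cons (α := fun _ => ℂ) (κ - δ) (fun j => T (EuclideanSpace.single j 1)) i *
        (pt y.1 y.2 i : ℂ) := by
  have h1 : T y.2 = ∑ j, T (EuclideanSpace.single j 1) * (y.2 j : ℂ) := by
    conv_lhs => rw [← (EuclideanSpace.basisFun (Fin n) ℝ).sum_repr y.2]
    rw [map_sum]
    refine Finset.sum_congr rfl fun j _ => ?_
    rw [map_smul, Complex.real_smul, mul_comm]
    simp
  rw [Fin.sum_univ_succ, Fin.cons_zero, h1, norm_pt hy.le]
  simp only [Fin.cons_succ, pt, join_zero, join_succ, PiLp.smul_apply, smul_eq_mul]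
  push_cast
  have h2 : ∑ j : Fin n, T (EuclideanSpace.single j 1) * ((y.1 : ℂ) * (y.2 j : ℂ)) =
      y.1 * ∑ j, T (EuclideanSpace.single j 1) * (y.2 j : ℂ) := by
    rw [Finset.mul_sum]
    exact Finset.sum_congr rfl fun j _ => by ring
  rw [h2]
  ring

/-- Data with vanishing defect are exponentials. -/
theorem exists_exponential_of_coneDefect_eq_zero (hn : 1 ≤ n) {β : ℝ} {f g : Space (n + 1) → ℂ}
    (hf : Measurable f) (hg : Measurable g) (hf0 : ¬ f =ᵐ[volume] 0) (hg0 : ¬ g =ᵐ[volume] 0)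
    (h : coneDefect β (lift f) (lift g) = 0) :
    ∃ (l a c : ℂ) (b : Fin (n + 1) → ℂ), l ≠ 0 ∧ (∀ᵐ ξ, f ξ = l * g ξ) ∧
      ∀ᵐ ξ : Space (n + 1), f ξ =
        Complex.exp (a * (‖ξ‖ : ℂ) + ∑ i, b i * (ξ i : ℂ) + c) / (‖ξ‖ : ℂ) := by
  obtain ⟨l, c, D, hl, hlg, hD⟩ := exists_bilinear_of_coneDefect_eq_zero hn (measurable_lift hf)
    (measurable_lift hg) h (not_ae_lift_eq_zero hn hf hf0) (not_ae_lift_eq_zero hn hg hg0)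
  have hD' : ∀ᵐ y ∂coneMeasure n, lift g y =
      l⁻¹ * Complex.exp (y.1 * D (1, y.2) (1, y.2) + c) := by
    filter_upwards [hlg, hD] with y h1 h2
    rw [← h2, h1, inv_mul_cancel_left₀ hl]
  rw [coneDefect_congr hn hD hD'] at h
  obtain ⟨κ, hκ⟩ := isotropic_of_coneDefect_eq_zero hn (inv_ne_zero hl) h
  obtain ⟨T, hT⟩ : ∃ T : Space n →ₗ[ℝ] ℂ, ∀ v, T v = D (1, 0) (0, v) + D (0, v) (1, 0) :=
    ⟨(D (1, 0) + D.flip (1, 0)) ∘ₗ LinearMap.inr ℝ ℝ (Space n), fun v => rfl⟩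
  have hq : ∀ v, D (1, v) (1, v) = D (1, 0) (1, 0) + T v + κ * (‖v‖ : ℂ) ^ 2 := by
    intro v
    have e1 : ((1, v) : Cone n) = (1, 0) + (0, v) := by simp
    rw [e1, hT, ← hκ]
    simp only [map_add, LinearMap.add_apply]
    ring
  refine ⟨l, D (1, 0) (1, 0) + κ, c, Fin.cons (α := fun _ => ℂ) (κ - D (1, 0) (1, 0))
    (fun j => T (EuclideanSpace.single j 1)), hl, ?_, ?_⟩
  · refine ae_of_ae_pt hn (measurableSet_eq_fun hf (by fun_prop)) ?_
    filter_upwards [hlg, ae_coneMeasure_pos] with y hy hpos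
    have h1 : ((‖pt y.1 y.2‖ : ℝ) : ℂ) ≠ 0 := by exact_mod_cast (norm_pt_pos hpos).ne'
    refine mul_left_cancel₀ h1 ?_
    simp only [lift] at hy
    rw [hy]
    ring
  · refine ae_of_ae_pt hn (measurableSet_eq_fun hf (by fun_prop)) ?_
    filter_upwards [hD, ae_coneMeasure_pos] with y hy hpos
    have h1 : ((‖pt y.1 y.2‖ : ℝ) : ℂ) ≠ 0 := by exact_mod_cast (norm_pt_pos hpos).ne'
    rw [eq_div_iff h1, mul_comm, ← exponent_pt hpos, ← hq]
    exact hy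

lemma coneDiff_coneFst {q : LightCone n} {v : Space n} (hL : linL q v ≠ 0)
    (hu : recoil q v + q.1 ≠ 0) : coneDiff (coneFst q v) (coneSnd q v) = q := by
  have hr : recoil q v * linL q v = boxQ q := div_mul_cancel₀ _ hL
  simp only [coneDiff, coneFst, coneSnd]
  refine Prod.ext (by simp) (Prod.ext ?_ ?_)
  · simp only [norm_smul, norm_inv, Real.norm_eq_abs, mul_pow, inv_pow, sq_abs, norm_add_sq_real,
      inner_smul_right]
    rw [linL, boxQ] at hr
    field_simp
    linear_combination -hr
  · simp only
    rw [smul_inv_smul₀ hu, add_sub_cancel_right]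

/-- The defect of exponentials vanishes. -/
theorem coneDefect_exp (hn : 1 ≤ n) {β : ℝ} {Φ Ψ : Cone n → ℂ} {δ κ c c' : ℂ}
    {T : Space n →ₗ[ℝ] ℂ}
    (hΦ : ∀ y : Cone n, 0 < y.1 → Φ y = c * Complex.exp (y.1 * (δ + T y.2 + κ * (‖y.2‖ : ℂ) ^ 2)))
    (hΨ : ∀ y : Cone n, 0 < y.1 → Ψ y = c' * Complex.exp (y.1 * (δ + T y.2 + κ * (‖y.2‖ : ℂ) ^ 2))) :
    coneDefect β Φ Ψ = 0 := by
  -- The exponent is the restriction to null vectors of a linear form on space-time. On a fibre the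
  -- quotient of the two data is thus a function of `q` only, which is the case of equality in
  -- Cauchy–Schwarz.
  obtain ⟨S, hS⟩ : ∃ S : LightCone n → ℂ, S = fun q => δ * q.1 + T q.2.2 + κ * q.2.1 := ⟨_, rfl⟩
  have hSd : ∀ y z : Cone n, S (coneDiff y z) = y.1 * (δ + T y.2 + κ * (‖y.2‖ : ℂ) ^ 2) -
      z.1 * (δ + T z.2 + κ * (‖z.2‖ : ℂ) ^ 2) := by
    intro y z
    simp only [hS, coneDiff, map_sub, map_smul, Complex.real_smul]
    push_cast
    ring
  have hgood : ∀ (q : LightCone n), ∀ᵐ v : Space n, fibre q v ≠ 0 →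
      Φ (coneFst q v) * c' = c * Complex.exp (S q) * Ψ (coneSnd q v) := by
    intro q
    have hx : ∀ᵐ v : Space n, 0 < boxQ q → q.2.2 - q.1 • v ≠ 0 := by
      by_cases h0 : q.1 = 0
      · refine ae_of_all _ fun v hQ => ?_
        rw [h0, zero_smul, sub_zero]
        intro h1
        simp [boxQ, h0, h1] at hQ
      · filter_upwards [ae_ne hn (q.1⁻¹ • q.2.2)] with v hv _ h1
        rw [sub_eq_zero] at h1
        exact hv (by rw [h1, inv_smul_smul₀ h0])
    filter_upwards [hx] with v hv hne
    have hmem : (q, v) ∈ coneDom n := by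
      by_contra h1
      exact hne (indicator_of_notMem h1 _)
    obtain ⟨hQ, hL⟩ := hmem
    simp only at hQ hL
    have hr : 0 < recoil q v := div_pos hQ hL
    have hu : 0 < recoil q v + q.1 := by
      -- A square identity showing that the first vector of the pair has positive component, except
      -- in the one direction excluded by `hx`.
      have h2 : (recoil q v + q.1) * linL q v = ‖q.2.2 - q.1 • v‖ ^ 2 := by
        rw [add_mul, recoil, div_mul_cancel₀ _ hL.ne', norm_sub_sq_real, norm_smul,
          inner_smul_right, mul_pow, Real.norm_eq_abs, sq_abs, boxQ, linL]
        ring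
      have h3 : 0 < ‖q.2.2 - q.1 • v‖ := norm_pos_iff.2 (hv hQ)
      have h4 : 0 < (recoil q v + q.1) * linL q v := by rw [h2]; positivity
      exact pos_of_mul_pos_left h4 hL.le
    rw [hΦ _ hu, hΨ _ hr]
    have h5 := hSd (coneFst q v) (coneSnd q v)
    rw [coneDiff_coneFst hL.ne' hu.ne', eq_sub_iff_add_eq] at h5
    rw [← h5, Complex.exp_add]
    ring
  have hc : c' = 0 → ∀ y : Cone n, 0 < y.1 → Ψ y = 0 := fun h0 y hy => by rw [hΨ y hy, h0, zero_mul]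
  rw [coneDefect, ← lintegral_zero (μ := (volume : Measure (LightCone n)))]
  refine lintegral_congr fun q => ?_
  rw [← lintegral_zero (μ := (volume : Measure (Space n)))]
  refine lintegral_congr_ae ?_
  filter_upwards [hgood q] with v hv
  by_cases h0 : fibre q v = 0
  · simp [h0]
  rw [mul_eq_zero, ENNReal.ofReal_eq_zero]
  right
  rw [← lintegral_zero (μ := (volume : Measure (Space n)))]
  refine lintegral_congr_ae ?_
  filter_upwards [hgood q] with v' hv'
  by_cases h0' : fibre q v' = 0
  · simp [h0']
  have hrec : ∀ {v : Space n}, fibre q v ≠ 0 → 0 < (coneSnd q v).1 := fun {v} hne => by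
    have hmem : (q, v) ∈ coneDom n := by
      by_contra h1
      exact hne (indicator_of_notMem h1 _)
    exact div_pos hmem.1 hmem.2
  have h6 : Φ (coneFst q v) * Ψ (coneSnd q v') - Φ (coneFst q v') * Ψ (coneSnd q v) = 0 := by
    by_cases hc0 : c' = 0
    · rw [hc hc0 _ (hrec h0), hc hc0 _ (hrec h0')]; ring
    · refine mul_left_cancel₀ hc0 ?_
      linear_combination Ψ (coneSnd q v') * hv h0 - Ψ (coneSnd q v) * hv' h0'
  rw [h6]
  simp

/-! ### Energy of exponential data -/

lemma norm_pt_sub {y : Cone n} (hy : 0 < y.1) : ‖pt y.1 y.2‖ - pt y.1 y.2 0 = y.1 := by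
  rw [norm_pt hy.le, pt, join_zero]; ring

lemma exp_rpow_factor {u s δ a b : ℝ} (hu : 0 < u) (hs : 0 < s) :
    u ^ n * s * (Real.exp (-(2 * δ * (u * s))) * (u * s) ^ (a - 1) * u ^ b) =
      s ^ a * (u ^ (n + a + b - 1) * Real.exp (-(2 * δ * s * u))) := by
  have h1 : u ^ (n + a + b - 1 : ℝ) = u ^ n * u ^ (a - 1) * u ^ b := by
    rw [← Real.rpow_natCast, ← Real.rpow_add hu, ← Real.rpow_add hu]
    congr 1; ring
  have h2 : s ^ a = s * s ^ (a - 1) := by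
    rw [Real.rpow_sub hs, Real.rpow_one]; field_simp
  rw [h1, h2, Real.mul_rpow hu.le hs.le, show 2 * δ * (u * s) = 2 * δ * s * u by ring]
  ring

/-- In cone coordinates the `u`-integral is a Gamma integral, convergent at zero by `hab`; it leaves
a power of `1 + |v|²`, integrable over `ℝ^n` by `hb`. -/
lemma lintegral_exp_rpow_lt_top (hn : 1 ≤ n) {δ a b : ℝ} (hδ : 0 < δ) (hb : -(n : ℝ) / 2 < b)
    (hab : 0 < n + a + b) :
    ∫⁻ ξ : Space (n + 1), ENNReal.ofReal
      (Real.exp (-(2 * δ * ‖ξ‖)) * ‖ξ‖ ^ (a - 1) * (‖ξ‖ - ξ 0) ^ b) < ∞ := by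
  rw [lintegral_pt_cone hn (by fun_prop), lintegral_coneMeasure_symm (by fun_prop)]
  have h1 : ∀ v : Space n, ∫⁻ u in Ioi (0 : ℝ), ENNReal.ofReal (u ^ n * ((‖v‖ ^ 2 + 1) / 2)) *
      ENNReal.ofReal (Real.exp (-(2 * δ * ‖pt u v‖)) * ‖pt u v‖ ^ (a - 1) *
        (‖pt u v‖ - pt u v 0) ^ b) =
      ENNReal.ofReal ((2 : ℝ) ^ (n + b : ℝ) * ((2 * δ) ^ (-(n + a + b)) * Real.Gamma (n + a + b))) *
        ENNReal.ofReal ((1 + 1 * ‖v‖ ^ 2) ^ (-(n + b : ℝ))) := by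
    intro v
    have hs : 0 < (‖v‖ ^ 2 + 1) / 2 := by positivity
    have h2 : ∀ u ∈ Ioi (0 : ℝ), ENNReal.ofReal (u ^ n * ((‖v‖ ^ 2 + 1) / 2)) *
        ENNReal.ofReal (Real.exp (-(2 * δ * ‖pt u v‖)) * ‖pt u v‖ ^ (a - 1) *
          (‖pt u v‖ - pt u v 0) ^ b) = ENNReal.ofReal (((‖v‖ ^ 2 + 1) / 2) ^ a) *
        ENNReal.ofReal (u ^ (n + a + b - 1) * Real.exp (-(2 * δ * ((‖v‖ ^ 2 + 1) / 2) * u))) := by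
      intro u hu
      have hu' : 0 < u := hu
      have h3 := norm_pt_sub (y := (u, v)) hu'
      simp only at h3
      rw [← ENNReal.ofReal_mul (by positivity), ← ENNReal.ofReal_mul (by positivity), h3,
        norm_pt hu'.le, ← exp_rpow_factor hu' hs, mul_div_assoc]
    rw [setLIntegral_congr_fun measurableSet_Ioi h2, lintegral_const_mul _ (by fun_prop),
      lintegral_gamma hab (by positivity), ← ENNReal.ofReal_mul (by positivity),
      ← ENNReal.ofReal_mul (by have := Real.Gamma_pos_of_pos hab; positivity)]
    congr 1
    have h4 : (1 : ℝ) + 1 * ‖v‖ ^ 2 = 2 * ((‖v‖ ^ 2 + 1) / 2) := by ring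
    rw [h4, Real.mul_rpow (by positivity) hs.le, Real.mul_rpow zero_le_two hs.le]
    have h5 : ((‖v‖ ^ 2 + 1) / 2) ^ a * ((‖v‖ ^ 2 + 1) / 2) ^ (-(n + a + b)) =
        ((‖v‖ ^ 2 + 1) / 2) ^ (-(n + b : ℝ)) := by
      rw [← Real.rpow_add hs]; congr 1; ring
    have h6 : (2 : ℝ) ^ (n + b : ℝ) * 2 ^ (-(n + b : ℝ)) = 1 := by
      rw [← Real.rpow_add two_pos, add_neg_cancel, Real.rpow_zero]
    linear_combination (2 * δ) ^ (-(n + a + b)) * Real.Gamma (n + a + b) * h5 -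
      (2 * δ) ^ (-(n + a + b)) * Real.Gamma (n + a + b) * ((‖v‖ ^ 2 + 1) / 2) ^ (-(n + b : ℝ)) * h6
  simp_rw [h1]
  rw [lintegral_const_mul' _ _ ENNReal.ofReal_ne_top,
    lintegral_rpow_quadratic one_pos one_pos (by linarith)]
  exact ENNReal.mul_lt_top ENNReal.ofReal_lt_top ENNReal.ofReal_lt_top

/-- A rotation taking the first coordinate to a given linear form. -/
lemma exists_isometry_inner (B : Space (n + 1)) :
    ∃ ρ : Space (n + 1) ≃ₗᵢ[ℝ] Space (n + 1), ∀ ξ, inner ℝ B (ρ ξ) = ‖B‖ * ξ 0 := by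
  have hn : ‖‖B‖ • (EuclideanSpace.single 0 1 : Space (n + 1))‖ = ‖B‖ := by
    rw [norm_smul]; simp
  refine ⟨(ℝ ∙ (‖B‖ • (EuclideanSpace.single 0 1 : Space (n + 1)) - B))ᗮ.reflection, fun ξ => ?_⟩
  have h := LinearIsometryEquiv.inner_map_map
    (ℝ ∙ (‖B‖ • (EuclideanSpace.single 0 1 : Space (n + 1)) - B))ᗮ.reflection
    (‖B‖ • EuclideanSpace.single 0 1) ξ
  rw [Submodule.reflection_sub hn] at h
  rw [h, inner_smul_left]
  simp [EuclideanSpace.inner_single_left]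

lemma exp_datum_rpow {δ C γ N : ℝ} (hN : 0 < N) :
    (C * Real.exp (-(δ * N)) / N) ^ 2 * N ^ (γ + 1) =
      C ^ 2 * (Real.exp (-(2 * δ * N)) * N ^ (γ - 1)) := by
  have h1 : N ^ (γ + 1) = N ^ 2 * N ^ (γ - 1) := by
    rw [← Real.rpow_natCast, ← Real.rpow_add hN]; congr 1; push_cast; ring
  have h2 : Real.exp (-(2 * δ * N)) = Real.exp (-(δ * N)) ^ 2 := by
    rw [← Real.exp_nat_mul]; congr 1; push_cast; ring
  rw [h1, h2]
  field_simp

/-- Exponentially decaying data have finite energy. -/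
theorem energy_exp_lt_top (hn : 1 ≤ n) {β δ C : ℝ} (hδ : 0 < δ)
    (hβ : (1 - (n : ℝ)) / 2 < β) :
    energy (d := n + 1) β (fun ξ => ((C * Real.exp (-(δ * ‖ξ‖)) / ‖ξ‖ : ℝ) : ℂ))
      (fun ξ => ((C * Real.exp (-(δ * ‖ξ‖)) / ‖ξ‖ : ℝ) : ℂ)) < ∞ := by
  have hn' : (1 : ℝ) ≤ n := by exact_mod_cast hn
  obtain ⟨γ, hγ⟩ : ∃ γ : ℝ, γ = (n : ℝ) / 2 - 1 + 2 * β := ⟨_, rfl⟩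
  have e1 : (((n + 1 : ℕ) : ℝ) - 1) / 2 + 2 * β = γ + 1 := by rw [hγ]; push_cast; ring
  have e2 : (((n + 1 : ℕ) : ℝ) - 3) / 2 + 2 * β = γ := by rw [hγ]; push_cast; ring
  -- Integrability of the angular factor, `-n/2 < γ`, is the condition `β > (2-d)/2`. It is stronger
  -- than `β > -n/4` only for `n = 1`.
  have hK := lintegral_exp_rpow_lt_top hn (a := 0) (b := γ) hδ (by rw [hγ]; linarith)
    (by rw [hγ]; linarith)
  have hA := lintegral_exp_rpow_lt_top hn (a := γ) (b := 0) hδ (by linarith)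
    (by rw [hγ]; linarith)
  obtain ⟨K, hKdef⟩ : ∃ K, K = ∫⁻ ξ : Space (n + 1), ENNReal.ofReal
      (Real.exp (-(2 * δ * ‖ξ‖)) * ‖ξ‖ ^ ((0 : ℝ) - 1) * (‖ξ‖ - ξ 0) ^ γ) := ⟨_, rfl⟩
  rw [← hKdef] at hK
  have h0 : ∀ᵐ ξ : Space (n + 1), ξ ≠ 0 := Measure.ae_ne volume 0
  rw [energy, e1, e2, Measure.volume_eq_prod, lintegral_prod _ (Measurable.aemeasurable (by fun_prop))]
  have hinner : ∀ x : Space (n + 1), x ≠ 0 → ∫⁻ y : Space (n + 1), ENNReal.ofReal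
      (‖((C * Real.exp (-(δ * ‖x‖)) / ‖x‖ : ℝ) : ℂ)‖ ^ 2 *
        ‖((C * Real.exp (-(δ * ‖y‖)) / ‖y‖ : ℝ) : ℂ)‖ ^ 2 * (‖x‖ * ‖y‖) ^ (γ + 1) *
        (1 - inner ℝ (‖x‖⁻¹ • x) (‖y‖⁻¹ • y)) ^ γ) =
      (ENNReal.ofReal (C ^ 2 * C ^ 2) * K) * ENNReal.ofReal
        (Real.exp (-(2 * δ * ‖x‖)) * ‖x‖ ^ (γ - 1) * (‖x‖ - x 0) ^ (0 : ℝ)) := by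
    intro x hx
    have hxn : 0 < ‖x‖ := norm_pos_iff.2 hx
    -- Rotating the direction of `x` to the first axis shows that the inner integral over `y`
    -- depends on `x` only through its norm.
    obtain ⟨ρ, hρ⟩ := exists_isometry_inner (‖x‖⁻¹ • x)
    have hu : ‖‖x‖⁻¹ • x‖ = 1 := by
      rw [norm_smul, norm_inv, norm_norm, inv_mul_cancel₀ hxn.ne']
    rw [← ρ.measurePreserving.lintegral_comp (by fun_prop), hKdef,
      mul_comm (ENNReal.ofReal (C ^ 2 * C ^ 2)), mul_assoc, ← ENNReal.ofReal_mul (by positivity),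
      ← lintegral_mul_const' _ _ ENNReal.ofReal_ne_top]
    refine lintegral_congr_ae ?_
    filter_upwards [h0] with y hy
    have hyn : 0 < ‖y‖ := norm_pos_iff.2 hy
    have hy0 : 0 ≤ ‖y‖ - y 0 := by
      have := PiLp.norm_apply_le y 0
      have h1 := le_abs_self (y 0)
      rw [Real.norm_eq_abs] at this
      linarith
    rw [← ENNReal.ofReal_mul (by positivity)]
    congr 1
    rw [inner_smul_right, ρ.norm_map, hρ, hu, one_mul, Real.rpow_zero]
    have h2 : 1 - ‖y‖⁻¹ * y 0 = (‖y‖ - y 0) / ‖y‖ := by field_simp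
    have h3 : ‖y‖ ^ ((0 : ℝ) - 1) = ‖y‖ ^ (γ - 1) * (‖y‖ ^ γ)⁻¹ := by
      rw [← Real.rpow_neg hyn.le, ← Real.rpow_add hyn]; congr 1; ring
    rw [h2, h3, Real.div_rpow hy0 hyn.le, Real.mul_rpow hxn.le hyn.le, Complex.norm_real,
      Complex.norm_real, Real.norm_eq_abs, Real.norm_eq_abs, sq_abs, sq_abs]
    have h4 := exp_datum_rpow (δ := δ) (C := C) (γ := γ) hxn
    have h5 := exp_datum_rpow (δ := δ) (C := C) (γ := γ) hyn
    calc _ = ((C * Real.exp (-(δ * ‖x‖)) / ‖x‖) ^ 2 * ‖x‖ ^ (γ + 1)) *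
          ((C * Real.exp (-(δ * ‖y‖)) / ‖y‖) ^ 2 * ‖y‖ ^ (γ + 1)) *
          ((‖y‖ - y 0) ^ γ / ‖y‖ ^ γ) := by ring
      _ = _ := by rw [h4, h5]; ring
  rw [lintegral_congr_ae (h0.mono hinner), lintegral_const_mul' _ _
    (ENNReal.mul_ne_top ENNReal.ofReal_ne_top hK.ne)]
  exact ENNReal.mul_lt_top (ENNReal.mul_lt_top ENNReal.ofReal_lt_top hK) hA

lemma energy_comp_isometry {d : ℕ} {β : ℝ} {f g : Space d → ℂ} (ρ : Space d ≃ₗᵢ[ℝ] Space d) :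
    energy β (fun ξ => f (ρ ξ)) (fun ξ => g (ρ ξ)) = energy β f g := by
  have hmp : MeasurePreserving (Prod.map ρ ρ) (volume : Measure (Space d × Space d)) volume :=
    ρ.measurePreserving.prod ρ.measurePreserving
  have hme : MeasurableEmbedding (Prod.map ρ ρ) :=
    (ρ.toHomeomorph.prodCongr ρ.toHomeomorph).measurableEmbedding
  conv_rhs => rw [energy, ← hmp.lintegral_comp_emb hme]
  rw [energy]
  refine lintegral_congr fun y => ?_
  simp only [Prod.map_fst, Prod.map_snd, ρ.norm_map, inner_smul_left, inner_smul_right,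
    ρ.inner_map_map]

lemma ae_coneMeasure_neBot (n : ℕ) : (ae (coneMeasure n)).NeBot := by
  refine ⟨fun hb => ?_⟩
  have hf := eventually_false_iff_eq_bot.2 hb
  rw [ae_coneMeasure_iff] at hf
  have h1 : ∀ᵐ z : Cone n, ¬ 0 < z.1 := hf
  rw [ae_iff] at h1
  simp only [not_not] at h1
  have h2 : IsOpen {z : Cone n | 0 < z.1} := isOpen_lt continuous_const continuous_fst
  exact h2.measure_ne_zero volume ⟨(1, 0), by simp⟩ h1

/-- Data without exponential decay in the direction of the pole have infinite energy. -/
theorem energy_exp_eq_top (hn : 1 ≤ n) {β R C : ℝ} (hC : 0 < C) :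
    energy (d := n + 1) β (fun ξ => ((C * Real.exp (-(R * (‖ξ‖ - ξ 0))) / ‖ξ‖ : ℝ) : ℂ))
      (fun ξ => ((C * Real.exp (-(R * (‖ξ‖ - ξ 0))) / ‖ξ‖ : ℝ) : ℂ)) = ∞ := by
  have hlift : ∀ y : Cone n, 0 < y.1 → lift
      (fun ξ => ((C * Real.exp (-(R * (‖ξ‖ - ξ 0))) / ‖ξ‖ : ℝ) : ℂ)) y =
      ((C * Real.exp (-(R * y.1)) : ℝ) : ℂ) := by
    intro y hy
    have h1 := norm_pt_pos hy
    rw [lift, norm_pt_sub hy, ← Complex.ofReal_mul]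
    congr 1
    field_simp
  rw [energy_eq hn (by fun_prop) (by fun_prop), coneEnergy]
  have hpow : ENNReal.ofReal (2 ^ (-((n : ℝ) / 2 - 1 + 2 * β))) ≠ 0 := by
    have : (0 : ℝ) < 2 ^ (-((n : ℝ) / 2 - 1 + 2 * β)) := by positivity
    simpa using this
  obtain ⟨G, hG⟩ : ∃ G : ℝ → ℝ≥0∞, G = fun u => ∫⁻ z : Cone n,
      ‖((C * Real.exp (-(R * u)) : ℝ) : ℂ)‖ₑ ^ 2 *
        ‖((C * Real.exp (-(R * z.1)) : ℝ) : ℂ)‖ₑ ^ 2 *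
          ENNReal.ofReal (coneWeight β (u, 0) z) ∂coneMeasure n := ⟨_, rfl⟩
  have hGm : Measurable G := by rw [hG]; fun_prop
  have hinner : ∀ y : Cone n, 0 < y.1 → ∫⁻ z,
      ‖lift (fun ξ => ((C * Real.exp (-(R * (‖ξ‖ - ξ 0))) / ‖ξ‖ : ℝ) : ℂ)) y‖ₑ ^ 2 *
      ‖lift (fun ξ => ((C * Real.exp (-(R * (‖ξ‖ - ξ 0))) / ‖ξ‖ : ℝ) : ℂ)) z‖ₑ ^ 2 *
      ENNReal.ofReal (coneWeight β y z) ∂coneMeasure n = G y.1 := by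
    intro y hy
    have h1 : ∀ᵐ z ∂coneMeasure n,
        ‖lift (fun ξ => ((C * Real.exp (-(R * (‖ξ‖ - ξ 0))) / ‖ξ‖ : ℝ) : ℂ)) y‖ₑ ^ 2 *
        ‖lift (fun ξ => ((C * Real.exp (-(R * (‖ξ‖ - ξ 0))) / ‖ξ‖ : ℝ) : ℂ)) z‖ₑ ^ 2 *
        ENNReal.ofReal (coneWeight β y z) =
        ‖((C * Real.exp (-(R * y.1)) : ℝ) : ℂ)‖ₑ ^ 2 *
          ‖((C * Real.exp (-(R * z.1)) : ℝ) : ℂ)‖ₑ ^ 2 * ENNReal.ofReal (coneWeight β y z) := by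
      filter_upwards [ae_coneMeasure_pos] with z hz
      rw [hlift y hy, hlift z hz]
    rw [lintegral_congr_ae h1, hG]
    beta_reduce
    rw [lintegral_coneMeasure (by fun_prop), lintegral_coneMeasure (by fun_prop)]
    refine lintegral_congr fun u => ?_
    -- The lifted data depend on `u` only and the weight on the difference of the directions, so the
    -- inner integral does not change with the direction of `y`. Integrating a positive constant
    -- over all directions gives infinity.
    rw [← lintegral_add_right_eq_self _ y.2]
    refine lintegral_congr fun v => ?_
    have h2 : coneWeight β y (u, v + y.2) = coneWeight β (y.1, 0) (u, v) := by
      simp only [coneWeight]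
      rw [show y.2 - (v + y.2) = 0 - v by abel]
    rw [h2]
  have hpos : ∀ u, 0 < u → G u ≠ 0 := by
    intro u hu h0
    rw [hG] at h0
    simp only at h0
    rw [lintegral_eq_zero_iff (by fun_prop)] at h0
    have := ae_coneMeasure_neBot n
    obtain ⟨z, hz, hz0, hzv⟩ := (h0.and (ae_coneMeasure_pos.and (ae_cone_snd_ne hn 0))).exists
    have hd : 0 < ‖(0 : Space n) - z.2‖ := norm_pos_iff.2 (sub_ne_zero.2 hzv)
    have hw : 0 < coneWeight β (u, 0) z := by
      simp only [coneWeight]; positivity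
    simp only [Pi.zero_apply, mul_eq_zero, pow_eq_zero_iff two_ne_zero, enorm_eq_zero,
      Complex.ofReal_eq_zero, Real.exp_ne_zero, hC.ne', or_self, ENNReal.ofReal_eq_zero,
      not_le.2 hw] at hz
  have hout : ∫⁻ y, G y.1 ∂coneMeasure n = ∞ := by
    rw [lintegral_coneMeasure (by fun_prop)]
    simp only [lintegral_const]
    have : Nontrivial (Space n) := by
      have : Nonempty (Fin n) := ⟨⟨0, hn⟩⟩
      infer_instance
    rw [measure_univ_of_isAddLeftInvariant, lintegral_mul_const _ hGm, ENNReal.mul_top]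
    intro h0
    rw [lintegral_eq_zero_iff hGm, EventuallyEq, ae_restrict_iff' measurableSet_Ioi, ae_iff] at h0
    refine absurd (measure_mono_null (fun u hu => ?_) h0)
      (isOpen_Ioi.measure_ne_zero volume ⟨1, mem_Ioi.2 one_pos⟩ : volume (Ioi (0 : ℝ)) ≠ 0)
    exact fun h => hpos u hu (h hu)
  rw [lintegral_congr_ae (ae_coneMeasure_pos.mono hinner), hout, ENNReal.mul_top hpow]

/-- The exponential datum `e^{a|ξ| + b·ξ + c} / |ξ|`. -/
def expDatum {d : ℕ} (a c : ℂ) (b : Fin d → ℂ) (ξ : Space d) : ℂ :=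
  Complex.exp (a * (‖ξ‖ : ℂ) + ∑ i, b i * (ξ i : ℂ) + c) / (‖ξ‖ : ℂ)

@[fun_prop]
lemma measurable_expDatum {d : ℕ} {a c : ℂ} {b : Fin d → ℂ} : Measurable (expDatum a c b) := by
  unfold expDatum; fun_prop

lemma expDatum_ne_zero {d : ℕ} {a c : ℂ} {b : Fin d → ℂ} {ξ : Space d} (hξ : ξ ≠ 0) :
    expDatum a c b ξ ≠ 0 := by
  refine div_ne_zero (Complex.exp_ne_zero _) ?_
  exact_mod_cast norm_ne_zero_iff.2 hξ

/-- The real part of a complex vector. -/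
def rePart {d : ℕ} (b : Fin d → ℂ) : Space d := WithLp.toLp 2 fun i => (b i).re

lemma norm_rePart {d : ℕ} (b : Fin d → ℂ) : ‖rePart b‖ = Real.sqrt (∑ i, (b i).re ^ 2) := by
  rw [EuclideanSpace.norm_eq]; simp [rePart]

lemma norm_expDatum {d : ℕ} (a c : ℂ) (b : Fin d → ℂ) (ξ : Space d) :
    ‖expDatum a c b ξ‖ =
      Real.exp c.re * Real.exp (a.re * ‖ξ‖ + inner ℝ (rePart b) ξ) / ‖ξ‖ := by
  have h : inner ℝ (rePart b) ξ = ∑ i, (b i).re * ξ i := by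
    simp [rePart, PiLp.inner_apply, mul_comm]
  rw [expDatum, norm_div, Complex.norm_exp, Complex.norm_real, norm_norm, ← Real.exp_add, h]
  congr 2
  simp
  ring

lemma coneDefect_expDatum (hn : 1 ≤ n) {β : ℝ} (a c k : ℂ) (b : Fin (n + 1) → ℂ) :
    coneDefect β (lift (expDatum a c b)) (lift fun ξ => k * expDatum a c b ξ) = 0 := by
  obtain ⟨T, hT⟩ : ∃ T : Space n →ₗ[ℝ] ℂ, T = ∑ j : Fin n,
      (LinearMap.toSpanSingleton ℝ ℂ (b j.succ)).comp
        ((EuclideanSpace.proj j : Space n →L[ℝ] ℝ) : Space n →ₗ[ℝ] ℝ) := ⟨_, rfl⟩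
  have hTs : ∀ j, T (EuclideanSpace.single j 1) = b j.succ := by
    intro j
    rw [hT]
    simp [LinearMap.sum_apply, PiLp.single_apply]
  have hb : (Fin.cons ((a + b 0) / 2 - (a - b 0) / 2)
      (fun j => T (EuclideanSpace.single j 1)) : Fin (n + 1) → ℂ) = b := by
    ext i
    refine Fin.cases ?_ (fun j => ?_) i
    · simp only [Fin.cons_zero]; ring
    · simp only [Fin.cons_succ, hTs]
  have key : ∀ y : Cone n, 0 < y.1 → lift (expDatum a c b) y = Complex.exp c *
      Complex.exp (y.1 * ((a - b 0) / 2 + T y.2 + (a + b 0) / 2 * (‖y.2‖ : ℂ) ^ 2)) := by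
    intro y hy
    have h0 : ((‖pt y.1 y.2‖ : ℝ) : ℂ) ≠ 0 := by exact_mod_cast (norm_pt_pos hy).ne'
    rw [exponent_pt hy, hb, lift, expDatum, mul_div_cancel₀ _ h0, ← Complex.exp_add]
    congr 1
    ring
  refine coneDefect_exp hn (c' := k * Complex.exp c) key fun y hy => ?_
  rw [mul_assoc, ← key y hy, lift, lift]
  ring

/-- By Cauchy–Schwarz `Re b · ξ ≤ |Re b||ξ|`, so both data are dominated by a radial exponential
with rate `-Re a - |Re b| > 0`. -/
lemma energy_expDatum_lt_top (hn : 1 ≤ n) {β : ℝ} (hβ : (1 - (n : ℝ)) / 2 < β) {a : ℂ} (c k : ℂ)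
    {b : Fin (n + 1) → ℂ} (hab : ‖rePart b‖ < -a.re) :
    energy β (expDatum a c b) (fun ξ => k * expDatum a c b ξ) < ∞ := by
  have hb : ∀ ξ, ‖expDatum a c b ξ‖ ≤
      Real.exp c.re * Real.exp (-((-a.re - ‖rePart b‖) * ‖ξ‖)) / ‖ξ‖ := by
    intro ξ
    rw [norm_expDatum]
    gcongr
    linarith [real_inner_le_norm (rePart b) ξ]
  have hC : Real.exp c.re ≤ max 1 ‖k‖ * Real.exp c.re :=
    le_mul_of_one_le_left (Real.exp_pos _).le (le_max_left _ _)
  refine (energy_mono (f := fun ξ => (((max 1 ‖k‖ * Real.exp c.re) *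
    Real.exp (-((-a.re - ‖rePart b‖) * ‖ξ‖)) / ‖ξ‖ : ℝ) : ℂ)) (g := fun ξ =>
    (((max 1 ‖k‖ * Real.exp c.re) * Real.exp (-((-a.re - ‖rePart b‖) * ‖ξ‖)) / ‖ξ‖ : ℝ) : ℂ))
    (ae_of_all _ fun ξ => ?_) (ae_of_all _ fun ξ => ?_)).trans_lt
    (energy_exp_lt_top hn (by linarith) hβ)
  · rw [Complex.norm_real, Real.norm_of_nonneg (by positivity)]
    refine (hb ξ).trans ?_
    gcongr
  · rw [Complex.norm_real, Real.norm_of_nonneg (by positivity), norm_mul]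
    calc _ ≤ max 1 ‖k‖ * (Real.exp c.re * Real.exp (-((-a.re - ‖rePart b‖) * ‖ξ‖)) / ‖ξ‖) :=
          mul_le_mul (le_max_right _ _) (hb ξ) (norm_nonneg _) (by positivity)
      _ = _ := by ring

/-- After rotating `Re b` to the first axis, the exponent is at least `-|Re b| (|ξ| - ξ₀)`, and the
energy dominates that of data without decay along the axis. -/
lemma energy_expDatum_eq_top (hn : 1 ≤ n) {β : ℝ} {a k : ℂ} (c : ℂ) (hk : k ≠ 0)
    {b : Fin (n + 1) → ℂ} (hab : -a.re ≤ ‖rePart b‖) :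
    energy β (expDatum a c b) (fun ξ => k * expDatum a c b ξ) = ∞ := by
  obtain ⟨ρ, hρ⟩ := exists_isometry_inner (rePart b)
  have hb : ∀ ξ, Real.exp c.re * Real.exp (-(‖rePart b‖ * (‖ξ‖ - ξ 0))) / ‖ξ‖ ≤
      ‖expDatum a c b (ρ ξ)‖ := by
    intro ξ
    rw [norm_expDatum, hρ, ρ.norm_map]
    gcongr
    nlinarith [norm_nonneg ξ]
  have hk' : 0 < ‖k‖ := norm_pos_iff.2 hk
  have hm : 0 < min 1 ‖k‖ := lt_min one_pos hk'
  rw [← energy_comp_isometry ρ, ← top_le_iff,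
    ← energy_exp_eq_top hn (β := β) (R := ‖rePart b‖) (mul_pos hm (Real.exp_pos c.re))]
  refine energy_mono (ae_of_all _ fun ξ => ?_) (ae_of_all _ fun ξ => ?_)
  · rw [Complex.norm_real, Real.norm_of_nonneg (by positivity)]
    refine le_trans ?_ (hb ξ)
    gcongr
    exact mul_le_of_le_one_left (Real.exp_pos _).le (min_le_left _ _)
  · rw [Complex.norm_real, Real.norm_of_nonneg (by positivity), norm_mul]
    calc _ = min 1 ‖k‖ * (Real.exp c.re * Real.exp (-(‖rePart b‖ * (‖ξ‖ - ξ 0))) / ‖ξ‖) := by ring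
      _ ≤ _ := mul_le_mul (min_le_right _ _) (hb ξ) (by positivity) hk'.le

lemma energy_ne_zero (hn : 1 ≤ n) {β : ℝ} {f g : Space (n + 1) → ℂ} (hf : Measurable f)
    (hg : Measurable g) (hf0 : ∀ ξ, ξ ≠ 0 → f ξ ≠ 0) (hg0 : ∀ ξ, ξ ≠ 0 → g ξ ≠ 0) :
    energy β f g ≠ 0 := by
  have hl : ∀ {F : Space (n + 1) → ℂ}, (∀ ξ, ξ ≠ 0 → F ξ ≠ 0) → ∀ y : Cone n, 0 < y.1 →
      lift F y ≠ 0 := fun hF y hy => mul_ne_zero (by exact_mod_cast (norm_pt_pos hy).ne')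
    (hF _ (norm_pos_iff.1 (norm_pt_pos hy)))
  have hlf := measurable_lift hf
  have hlg := measurable_lift hg
  rw [energy_eq hn hf hg, coneEnergy]
  refine mul_ne_zero ?_ fun h => ?_
  · have : (0 : ℝ) < 2 ^ (-((n : ℝ) / 2 - 1 + 2 * β)) := by positivity
    simpa using this
  have := ae_coneMeasure_neBot n
  rw [lintegral_eq_zero_iff (Measurable.lintegral_prod_right' (f := fun p : Cone n × Cone n =>
    ‖lift f p.1‖ₑ ^ 2 * ‖lift g p.2‖ₑ ^ 2 * ENNReal.ofReal (coneWeight β p.1 p.2))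
    (by fun_prop))] at h
  obtain ⟨y, hy, hy0⟩ := (h.and ae_coneMeasure_pos).exists
  simp only [Pi.zero_apply] at hy
  rw [lintegral_eq_zero_iff (by fun_prop)] at hy
  obtain ⟨z, hz, hz0, hzv⟩ := (hy.and (ae_coneMeasure_pos.and (ae_cone_snd_ne hn y.2))).exists
  have hd : 0 < ‖y.2 - z.2‖ := norm_pos_iff.2 (sub_ne_zero.2 hzv)
  have hw : 0 < coneWeight β y z := by
    simp only [coneWeight]; positivity
  simp only [Pi.zero_apply, mul_eq_zero, pow_eq_zero_iff two_ne_zero, enorm_eq_zero,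
    hl hf0 y hy0, hl hg0 z hz0, or_self, ENNReal.ofReal_eq_zero, not_le.2 hw] at hz

/-! ### Extremisers -/

lemma sharpConst_pos (hn : 1 ≤ n) {β : ℝ} (hβ : -(n : ℝ) / 4 < β) : 0 < sharpConst β (n + 1) := by
  have h1 := coneConst_pos hβ hn
  have h2 := amp_pos (n + 1)
  refine pos_of_mul_pos_left (b := (2 : ℝ) ^ (-((n : ℝ) / 2 - 1 + 2 * β))) ?_ (by positivity)
  rw [sharpConst_eq]
  positivity

theorem exists_isBoxPowProduct_of_energy (hn : 1 ≤ n) {β : ℝ} (hβ : -(n : ℝ) / 4 < β)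
    {f g : Space (n + 1) → ℂ} (hf : Measurable f) (hg : Measurable g) (hE : energy β f g ≠ ∞) :
    ∃ V, IsBoxPowProduct β f g V := by
  have h2 : (0 : ℝ) < 2 ^ (-((n : ℝ) / 2 - 1 + 2 * β)) := by positivity
  obtain ⟨V, hV, -⟩ := exists_isBoxPowProduct hn hβ hf hg (fun h => hE <| by
    rw [energy_eq hn hf hg, h, ENNReal.mul_top (by simpa using h2)])
  exact ⟨V, hV⟩

/-- Exponential pairs saturate the bilinear estimate. -/
theorem exists_isBoxPowProduct_expDatum (hn : 1 ≤ n) {β : ℝ} (hβ : -(n : ℝ) / 4 < β)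
    (hβ' : (1 - (n : ℝ)) / 2 < β) {a : ℂ} (c k : ℂ) {b : Fin (n + 1) → ℂ}
    (hab : ‖rePart b‖ < -a.re) :
    ∃ V, IsBoxPowProduct β (expDatum a c b) (fun ξ => k * expDatum a c b ξ) V ∧
      eLpNorm V 2 volume ^ 2 = ENNReal.ofReal (sharpConst β (n + 1)) *
        energy β (expDatum a c b) (fun ξ => k * expDatum a c b ξ) := by
  have hE := (energy_expDatum_lt_top hn hβ' c k hab).ne
  have hm : Measurable fun ξ => k * expDatum a c b ξ := by fun_prop
  obtain ⟨V, hV⟩ := exists_isBoxPowProduct_of_energy hn hβ measurable_expDatum hm hE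
  refine ⟨V, hV, ?_⟩
  rw [← hV.sq_eLpNorm_add hn hβ measurable_expDatum hm hE, coneDefect_expDatum hn, mul_zero,
    add_zero]

/-- The data saturating the bilinear estimate are the exponential pairs. -/
theorem IsBoxPowProduct.isExtremalPair (hn : 1 ≤ n) {β : ℝ} (hβ : -(n : ℝ) / 4 < β)
    {f g : Space (n + 1) → ℂ} (hf : Measurable f) (hg : Measurable g)
    (hf0 : ¬ f =ᵐ[volume] 0) (hg0 : ¬ g =ᵐ[volume] 0) (hE : energy β f g ≠ ∞)
    {V : Spacetime (n + 1) → ℂ} (hV : IsBoxPowProduct β f g V)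
    (heq : eLpNorm V 2 volume ^ 2 = ENNReal.ofReal (sharpConst β (n + 1)) * energy β f g) :
    IsExtremalPair f g := by
  have hid := hV.sq_eLpNorm_add hn hβ hf hg hE
  have hD : coneDefect β (lift f) (lift g) = 0 := by
    rw [heq] at hid
    have h1 := ENNReal.add_right_inj (ENNReal.mul_ne_top ENNReal.ofReal_ne_top hE) |>.1
      (hid.trans (add_zero _).symm)
    have hp : 0 < amp (n + 1) ^ 2 / 2 / (2 * Real.pi) ^ (n + 1 + 1) / 2 := by
      have := amp_pos (n + 1)
      positivity
    rcases mul_eq_zero.1 h1 with h | h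
    · exact absurd h (by simpa using hp)
    · exact h
  obtain ⟨l, a, c, b, hl, hlg, hexp⟩ :=
    exists_exponential_of_coneDefect_eq_zero hn hf hg hf0 hg0 hD
  -- Vanishing defect only gives the exponential form; the decay condition on the parameters comes
  -- from finiteness of the energy.
  have hab : ‖rePart b‖ < -a.re := by
    by_contra hab
    refine hE ?_
    rw [← energy_expDatum_eq_top hn c (inv_ne_zero hl) (not_lt.1 hab)]
    refine energy_congr hexp ?_
    filter_upwards [hlg, hexp] with ξ h1 h2
    have h3 : f ξ = expDatum a c b ξ := h2
    rw [← h3, h1, inv_mul_cancel_left₀ hl]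
  refine ⟨l, a, c, b, ?_, norm_rePart b ▸ hab, hlg, hexp⟩
  linarith [norm_nonneg (rePart b)]

/-- Extremal pairs are, up to null sets, pairs of proportional exponential data. -/
lemma IsExtremalPair.exists_expDatum {f g : Space (n + 1) → ℂ} (h : IsExtremalPair f g) :
    ∃ (a c k : ℂ) (b : Fin (n + 1) → ℂ), ‖rePart b‖ < -a.re ∧ f =ᵐ[volume] expDatum a c b ∧
      g =ᵐ[volume] fun ξ => k * expDatum a c b ξ := by
  obtain ⟨l, a, c, b, -, hab, hlg, hexp⟩ := h
  refine ⟨a, c, l⁻¹, b, (norm_rePart b).symm ▸ hab, hexp, ?_⟩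
  filter_upwards [hlg, hexp, Measure.ae_ne volume (0 : Space (n + 1))] with ξ h1 h2 h3
  have h4 : f ξ = expDatum a c b ξ := h2
  have hl : l ≠ 0 := by
    rintro rfl
    rw [zero_mul] at h1
    exact expDatum_ne_zero h3 (h4.symm.trans h1)
  rw [← h4, h1, inv_mul_cancel_left₀ hl]

end HalfWave

end

/-! ### The main theorem -/

open HalfWave in
theorem theorem1 (d : ℕ) (hd : 2 ≤ d) (β : ℝ) (hβ : (1 - (d : ℝ)) / 4 < β) :
    (∀ fHat gHat : Space d → ℂ,
      AEStronglyMeasurable fHat volume → AEStronglyMeasurable gHat volume →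
      energy β fHat gHat < ∞ →
      ∃ V : Spacetime d → ℂ, IsBoxPowProduct β fHat gHat V ∧
        eLpNorm V 2 volume ^ 2 ≤ ENNReal.ofReal (sharpConst β d) * energy β fHat gHat) ∧
    (betaThreshold d < β →
      (∀ C : ℝ,
        (∀ fHat gHat : Space d → ℂ,
          AEStronglyMeasurable fHat volume → AEStronglyMeasurable gHat volume →
          energy β fHat gHat < ∞ →
          ∀ V : Spacetime d → ℂ, IsBoxPowProduct β fHat gHat V →
            eLpNorm V 2 volume ^ 2 ≤ ENNReal.ofReal C * energy β fHat gHat) →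
        sharpConst β d ≤ C) ∧
      (∀ fHat gHat : Space d → ℂ,
        AEStronglyMeasurable fHat volume → AEStronglyMeasurable gHat volume →
        ¬ fHat =ᵐ[volume] 0 → ¬ gHat =ᵐ[volume] 0 →
        ((energy β fHat gHat < ∞ ∧
          ∃ V : Spacetime d → ℂ, IsBoxPowProduct β fHat gHat V ∧
            eLpNorm V 2 volume ^ 2 = ENNReal.ofReal (sharpConst β d) * energy β fHat gHat) ↔
          IsExtremalPair fHat gHat))) := by
  obtain ⟨n, rfl⟩ : ∃ n, d = n + 1 := ⟨d - 1, by omega⟩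
  have hn : 1 ≤ n := by omega
  have hβn : -(n : ℝ) / 4 < β := by
    push_cast at hβ
    linarith
  refine ⟨fun f g hf hg hE => ?_, fun hthr => ?_⟩
  · have hE' : energy β (hf.mk f) (hg.mk g) ≠ ∞ := energy_congr hf.ae_eq_mk hg.ae_eq_mk ▸ hE.ne
    have hfm := hf.stronglyMeasurable_mk.measurable
    have hgm := hg.stronglyMeasurable_mk.measurable
    obtain ⟨V, hV⟩ := exists_isBoxPowProduct_of_energy hn hβn hfm hgm hE'
    refine ⟨V, hV.congr hf.ae_eq_mk.symm hg.ae_eq_mk.symm, ?_⟩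
    rw [energy_congr hf.ae_eq_mk hg.ae_eq_mk, ← hV.sq_eLpNorm_add hn hβn hfm hgm hE']
    exact le_self_add
  have hβ' : (1 - (n : ℝ)) / 2 < β := by
    have h := (le_max_right _ _).trans_lt hthr
    push_cast at h
    linarith
  refine ⟨fun C hC => ?_, fun f g hf hg hf0 hg0 => ⟨?_, fun h => ?_⟩⟩
  -- Optimality is tested on `e^{-|ξ|}/|ξ|` for both data: the energy is finite and nonzero, so it
  -- can be cancelled from the inequality.
  · have hab : ‖rePart (0 : Fin (n + 1) → ℂ)‖ < -(-1 : ℂ).re := by simp [norm_rePart]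
    have hfin := energy_expDatum_lt_top hn hβ' 0 1 hab
    have hm : Measurable fun ξ => 1 * expDatum (-1) 0 (0 : Fin (n + 1) → ℂ) ξ := by fun_prop
    obtain ⟨V, hV, heq⟩ := exists_isBoxPowProduct_expDatum hn hβn hβ' 0 1 hab
    have h := hC _ _ measurable_expDatum.aestronglyMeasurable hm.aestronglyMeasurable hfin V hV
    have h0 := energy_ne_zero hn (β := β) (measurable_expDatum (a := -1) (c := 0) (b := 0)) hm
      (fun ξ hξ => expDatum_ne_zero hξ) (fun ξ hξ => by
        rw [one_mul]; exact expDatum_ne_zero hξ)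
    rw [heq, ENNReal.mul_le_mul_iff_left h0 hfin.ne, ENNReal.ofReal_le_ofReal_iff'] at h
    exact h.resolve_right (sharpConst_pos hn hβn).not_ge
  · rintro ⟨hE, V, hV, heq⟩
    have hfm := hf.stronglyMeasurable_mk.measurable
    have hgm := hg.stronglyMeasurable_mk.measurable
    rw [energy_congr hf.ae_eq_mk hg.ae_eq_mk] at hE heq
    obtain ⟨l, a, c, b, ha, hab, hlg, hexp⟩ :=
      (hV.congr hf.ae_eq_mk hg.ae_eq_mk).isExtremalPair hn hβn hfm hgm
        (fun h => hf0 (hf.ae_eq_mk.trans h)) (fun h => hg0 (hg.ae_eq_mk.trans h)) hE.ne heq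
    refine ⟨l, a, c, b, ha, hab, ?_, ?_⟩
    · filter_upwards [hlg, hf.ae_eq_mk, hg.ae_eq_mk] with ξ h1 h2 h3
      rw [h2, h3, h1]
    · filter_upwards [hexp, hf.ae_eq_mk] with ξ h1 h2
      rw [h2, h1]
  · obtain ⟨a, c, k, b, hab, hfe, hge⟩ := h.exists_expDatum
    obtain ⟨V, hV, heq⟩ := exists_isBoxPowProduct_expDatum hn hβn hβ' c k hab
    rw [energy_congr hfe hge]
    exact ⟨energy_expDatum_lt_top hn hβ' c k hab, V, hV.congr hfe.symm hge.symm, heq⟩
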